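/- Let $N\ge 2$. On $\mathbb R^{2N-1}$ with coordinates $a_1,\dots,a_{N-1},b_1,\dots,b_N$ (and $a_0=a_N=0$, $a_j=b_j=0$ for all other indices outside these ranges) let $L$ be the $N\times N$ matrix whose $i$-th row has the entries $a_i+b_i$ in columns $j\le i$, $a_i$ in column $i+1$, and $0$ elsewhere, and put $H_m=\frac1m\operatorname{Tr}L^m$ ($m\ge1$). The relativistic Toda equations are $$\dot a_j=a_j(b_j-b_{j+1}+a_{j-1}-a_{j+1}),\qquad \dot b_j=b_j(a_{j-1}-a_j);$$ let $\chi$ be the corresponding vector field. Define skew-symmetric brackets on coordinates, where all brackets not listed (up to skew-symmetry) vanish: $\pi_1$: $\{a_i,b_i\}=-a_i$, $\{a_i,b_{i+1}\}=a_i$, $\{b_i,b_{i+1}\}=-a_i$; $\pi_2$: $\{a_i,a_{i+1}\}=a_ia_{i+1}$, $\{a_i,b_i\}=-a_ib_i$, $\{a_i,b_{i+1}\}=a_ib_{i+1}$; $\pi_3$: $\{a_i,a_{i+1}\}=a_i^2a_{i+1}+a_ia_{i+1}^2+2a_ia_{i+1}b_{i+1}$, $\{a_i,a_{i+2}\}=a_ia_{i+1}a_{i+2}$,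 $\{a_i,b_i\}=-a_ib_i(a_i+b_i)$, $\{a_i,b_{i+1}\}=a_ib_{i+1}(a_i+b_{i+1})$, $\{a_i,b_{i+2}\}=a_ia_{i+1}b_{i+2}$, $\{a_{i+1},b_i\}=-a_ia_{i+1}b_i$, $\{b_i,b_{i+1}\}=a_ib_ib_{i+1}$. Two Poisson tensors are compatible if their sum is Poisson; a Casimir is a function whose bracket with every function vanishes; $\chi_f(h)=\{f,h\}$; $Z$ is a master symmetry of $\chi$ if $[[Z,\chi],\chi]=0$ but $[Z,\chi]\ne0$. "The eigenvalues of $L$ are in involution" means that the $H_m$ pairwise commute and that any two smooth functions on an open set which are (possibly complex) eigenvalues of $L$ there have zero bracket. Let $X_1=\sum r_i\partial_{a_i}+\sum s_i\partial_{b_i}$ with $$r_i=a_i^2+(i+2)a_ib_{i+1}+(1-i)a_ib_i+(i+2)a_ia_{i+1}+(1-i)a_{i-1}a_i,\qquad s_i=b_i^2+(i+1)a_ib_i+(1-i)a_{i-1}b_i.$$ Then: 1. For $g\in\mathbb R$, let $f(t)=\sqrt{1+g^2e^t}$, $H=\sum_{j=1}^N e^{p_j}f(q_{j-1}-q_j)f(q_j-q_{j+1})$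 on $\mathbb R^{2N}$ with $q_0=-\infty$, $q_{N+1}=\infty$, and $$a_j=g^2e^{q_j-q_{j+1}+p_j}\,\frac{f(q_{j-1}-q_j)}{f(q_j-q_{j+1})}\quad(1\le j\le N-1),\qquad b_j=\frac{\partial H}{\partial p_j}-a_j\quad(1\le j\le N,\ a_N=0).$$ This map $(q,p)\mapsto(a,b)$ transforms the symplectic bracket $\sum_j\big(\frac{\partial u}{\partial p_j}\frac{\partial v}{\partial q_j}-\frac{\partial u}{\partial q_j}\frac{\partial v}{\partial p_j}\big)$ into $\pi_2$ (it is a Poisson map) and $H$ into $H_1$. 2. $\pi_1$ and $\pi_2$ are compatible Poisson tensors, and $\chi$ is the Hamiltonian vector field of $H_1$ for $\pi_2$ and of $H_2$ for $\pi_1$. $\operatorname{Tr}L$ is a Casimir of $\pi_1$, $\det L$ is a Casimir of $\pi_2$, and the eigenvalues of $L$ are in involution with respect to $\pi_2$. 3. $X_1(H_m)=(m+1)H_{m+1}$ for all $m\ge1$, $X_1$ is a master symmetry of $\chi$, and $L_{X_1}\pi_2=-\pi_3$. The tensor $\pi_3$ is Poisson and compatible with $\pi_1$ and with $\pi_2$;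 the eigenvalues of $L$ are in involution with respect to $\pi_3$; $\operatorname{Tr}L^{-1}$ is a Casimir of $\pi_3$ on the open set $\det L\ne0$; and $L_{X_1}\pi_3=0$. 4. There is a smooth vector field $X_2$ on $\mathbb R^{2N-1}$ which is a master symmetry of $\chi$, satisfies $X_2(H_m)=(m+2)H_{m+2}$ for all $m\ge1$, and is such that $\pi_4=L_{X_2}\pi_2$ is Poisson, the eigenvalues of $L$ are in involution with respect to $\pi_4$, and all $H_m$ are Casimirs of $L_{X_2}\pi_4$. For $N=3$ one can take $X_2=\sum_{i=1}^2r_i\partial_{a_i}+\sum_{i=1}^3s_i\partial_{b_i}$ with $$\begin{aligned} r_1&=a_1(a_1^2+5a_1b_1-a_2^2+2a_2b_1-2a_2b_2-a_2b_3+4b_1^2+2b_1b_2-b_2^2),\\ r_2&=a_2(3a_1^2+4a_1a_2+3a_1b_1+6a_1b_2+2a_1b_3+a_2^2+4a_2b_2+a_2b_3-2b_1b_2+2b_1b_3+3b_2^2+2b_2b_3),\\ s_1&=b_1(-2a_1^2-2a_1a_2-a_1b_1-2a_1b_2+b_1^2),\\ s_2&=b_2(3a_1^2+2a_1a_2+3a_1b_1+4a_1b_2-a_2^2+2a_2b_1-a_2b_3+b_2^2),\\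 s_3&=b_3(2a_2^2+2a_1a_2-2a_2b_1+2a_2b_2+3a_2b_3+b_3^2). \end{aligned}$$ -/

import Mathlib

open scoped ContDiff

noncomputable section

namespace RelToda

/-! ### Bivector fields, brackets and Lie derivatives on a coordinate space -/

section General

variable {ι : Type} [Fintype ι] [DecidableEq ι]

/-- A field of contravariant 2-tensors on `ℝ^ι`, given by its matrix of components
`π x i j = {x_i, x_j}(x)`. -/
abbrev Tensor2 (ι : Type) : Type := (ι → ℝ) → Matrix ι ι ℝ

/-- Vector fields on `ℝ^ι`. -/
abbrev VField (ι : Type) : Type := (ι → ℝ) → (ι → ℝ)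

/-- The partial derivative `∂f/∂x_i` at `x`, for real or complex valued `f`. -/
def pd {A : Type} [NormedRing A] [NormedAlgebra ℝ A] (i : ι) (f : (ι → ℝ) → A) (x : ι → ℝ) : A :=
  fderiv ℝ f x (Pi.single i 1)

/-- The bracket `{f, g} = ∑ π_ij ∂_i f ∂_j g` of two functions. It is extended
complex-bilinearly to complex valued functions. -/
def bracket {A : Type} [NormedRing A] [NormedAlgebra ℝ A] (π : Tensor2 ι) (f g : (ι → ℝ) → A)
    (x : ι → ℝ) : A :=
  ∑ i, ∑ j, π x i j • (pd i f x * pd j g x)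

/-- `π` is a (smooth) Poisson tensor: its bracket is a Poisson bracket on `C^∞(ℝ^ι)`. -/
structure IsPoisson (π : Tensor2 ι) : Prop where
  smooth : ∀ i j, ContDiff ℝ ∞ fun x => π x i j
  skew : ∀ f g : (ι → ℝ) → ℝ, ContDiff ℝ ∞ f → ContDiff ℝ ∞ g →
    bracket π f g = - bracket π g f
  add_right : ∀ f g h : (ι → ℝ) → ℝ, ContDiff ℝ ∞ f → ContDiff ℝ ∞ g → ContDiff ℝ ∞ h →
    bracket π f (g + h) = bracket π f g + bracket π f h
  smul_right : ∀ (c : ℝ) (f g : (ι → ℝ) → ℝ), ContDiff ℝ ∞ f → ContDiff ℝ ∞ g →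
    bracket π f (c • g) = c • bracket π f g
  leibniz : ∀ f g h : (ι → ℝ) → ℝ, ContDiff ℝ ∞ f → ContDiff ℝ ∞ g → ContDiff ℝ ∞ h →
    bracket π f (g * h) = bracket π f g * h + bracket π f h * g
  jacobi : ∀ f g h : (ι → ℝ) → ℝ, ContDiff ℝ ∞ f → ContDiff ℝ ∞ g → ContDiff ℝ ∞ h →
    bracket π f (bracket π g h) + bracket π g (bracket π h f) + bracket π h (bracket π f g) = 0

/-- Two Poisson tensors form a Poisson pair (are compatible) if their sum is again Poisson. -/
def Compatible (π π' : Tensor2 ι) : Prop :=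
  IsPoisson π ∧ IsPoisson π' ∧ IsPoisson (π + π')

/-- The Hamiltonian vector field `χ_f`, with `χ_f(g) = {f, g}`. -/
def hamVF (π : Tensor2 ι) (f : (ι → ℝ) → ℝ) : VField ι :=
  fun x j => bracket π f (fun y => y j) x

/-- The derivative `X(f)` of a function along a vector field. -/
def along (X : VField ι) (f : (ι → ℝ) → ℝ) (x : ι → ℝ) : ℝ := fderiv ℝ f x (X x)

/-- The Lie derivative `L_X π`, i.e. `(L_X π)(df, dg) = X{f, g} - {X f, g} - {f, X g}`
in components. -/
def lieDeriv (X : VField ι) (π : Tensor2 ι) : Tensor2 ι := fun x =>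
  Matrix.of fun i j =>
    along X (fun y => π y i j) x
      - ∑ k, pd k (fun y => X y i) x * π x k j
      - ∑ k, π x i k * pd k (fun y => X y j) x

/-- `f` is smooth on `U` and is there a Casimir of `π`. -/
def IsCasimirOn (π : Tensor2 ι) (U : Set (ι → ℝ)) (f : (ι → ℝ) → ℝ) : Prop :=
  ContDiffOn ℝ ∞ f U ∧
    ∀ g : (ι → ℝ) → ℝ, ContDiff ℝ ∞ g → ∀ x ∈ U, bracket π f g x = 0

/-- `Z` is a master symmetry of the differential equation defined by `χ`:
`[[Z, χ], χ] = 0` but `[Z, χ] ≠ 0`. -/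
def IsMasterSymmetry (Z χ : VField ι) : Prop :=
  VectorField.lieBracket ℝ (VectorField.lieBracket ℝ Z χ) χ = 0 ∧
    VectorField.lieBracket ℝ Z χ ≠ 0

end General

/-! ### The relativistic Toda lattice in the variables `(a, b)` -/

/-- Indices of the coordinates `a_1, …, a_{N-1}` (left) and `b_1, …, b_N` (right). -/
abbrev Idx (N : ℕ) : Type := Fin (N - 1) ⊕ Fin N

/-- The phase space `ℝ^{2N-1}`. -/
abbrev Phase (N : ℕ) : Type := Idx N → ℝ

variable {N : ℕ}

/-- The coordinate `a_j`, `1 ≤ j ≤ N - 1`; by convention `a_j = 0` for other `j`. -/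
def a (x : Phase N) (j : ℕ) : ℝ :=
  if h : 1 ≤ j ∧ j ≤ N - 1 then x (Sum.inl ⟨j - 1, by omega⟩) else 0

/-- The coordinate `b_j`, `1 ≤ j ≤ N`; by convention `b_j = 0` for other `j`. -/
def b (x : Phase N) (j : ℕ) : ℝ :=
  if h : 1 ≤ j ∧ j ≤ N then x (Sum.inr ⟨j - 1, by omega⟩) else 0

/-- The vector with coordinates `a_i = r i` and `b_i = s i` (indices starting at 1). -/
def mkVec (N : ℕ) (r s : ℕ → ℝ) : Phase N :=
  Sum.elim (fun i => r (i.val + 1)) (fun i => s (i.val + 1))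

/-- The skew-symmetric tensor with prescribed brackets `{a_i, a_j} = aa i j`,
`{a_i, b_j} = ab i j` and `{b_i, b_j} = bb i j` (indices starting at 1). The tables `aa` and `bb`
list the nonzero brackets with `i < j` only. -/
def ofTable (aa ab bb : Phase N → ℕ → ℕ → ℝ) : Tensor2 (Idx N) := fun x =>
  let U : Matrix (Idx N) (Idx N) ℝ := Matrix.of fun k l =>
    match k, l with
    | Sum.inl i, Sum.inl j => aa x (i.val + 1) (j.val + 1)
    | Sum.inl i, Sum.inr j => ab x (i.val + 1) (j.val + 1)
    | Sum.inr _, Sum.inl _ => 0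
    | Sum.inr i, Sum.inr j => bb x (i.val + 1) (j.val + 1)
  U - U.transpose

/-- The linear bracket. -/
def pi1 (N : ℕ) : Tensor2 (Idx N) :=
  ofTable (fun _ _ _ => 0)
    (fun x i j => if j = i then - a x i else if j = i + 1 then a x i else 0)
    (fun x i j => if j = i + 1 then - a x i else 0)

/-- The quadratic bracket. -/
def pi2 (N : ℕ) : Tensor2 (Idx N) :=
  ofTable (fun x i j => if j = i + 1 then a x i * a x (i + 1) else 0)
    (fun x i j => if j = i then - (a x i * b x i)
      else if j = i + 1 then a x i * b x (i + 1) else 0)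
    (fun _ _ _ => 0)

/-- The cubic bracket. -/
def pi3 (N : ℕ) : Tensor2 (Idx N) :=
  ofTable
    (fun x i j =>
      if j = i + 1 then
        a x i ^ 2 * a x (i + 1) + a x i * a x (i + 1) ^ 2 + 2 * a x i * a x (i + 1) * b x (i + 1)
      else if j = i + 2 then a x i * a x (i + 1) * a x (i + 2)
      else 0)
    (fun x i j =>
      if j = i then - (a x i * b x i * (a x i + b x i))
      else if j = i + 1 then a x i * b x (i + 1) * (a x i + b x (i + 1))
      else if j = i + 2 then a x i * a x (i + 1) * b x (i + 2)
      else if i = j + 1 then - (a x j * a x (j + 1) * b x j)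
      else 0)
    (fun x i j => if j = i + 1 then a x i * b x i * b x (i + 1) else 0)

/-- The Lax matrix: row `i` is `a_i + b_i` up to the diagonal, followed by `a_i` (recall
`a_N = 0`). -/
def lax (x : Phase N) : Matrix (Fin N) (Fin N) ℝ := Matrix.of fun i j =>
  if j.val ≤ i.val then a x (i.val + 1) + b x (i.val + 1)
  else if j.val = i.val + 1 then a x (i.val + 1)
  else 0

/-- `H_m = (1/m) Tr L^m`. -/
def Ham (N m : ℕ) (x : Phase N) : ℝ := (1 / (m : ℝ)) * (lax x ^ m).trace

/-- The equations of motion of the relativistic Toda lattice. -/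
def todaVF (N : ℕ) : VField (Idx N) := fun x =>
  mkVec N (fun j => a x j * (b x j - b x (j + 1) + a x (j - 1) - a x (j + 1)))
    (fun j => b x j * (a x (j - 1) - a x j))

/-- The vector field `X_1`. -/
def X1 (N : ℕ) : VField (Idx N) := fun x =>
  mkVec N
    (fun i => a x i ^ 2 + ((i : ℝ) + 2) * a x i * b x (i + 1) + (1 - (i : ℝ)) * a x i * b x i
      + ((i : ℝ) + 2) * a x i * a x (i + 1) + (1 - (i : ℝ)) * a x (i - 1) * a x i)
    (fun i => b x i ^ 2 + ((i : ℝ) + 1) * a x i * b x i + (1 - (i : ℝ)) * a x (i - 1) * b x i)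

/-- The explicit vector field `X_2` for the lattice with three particles. (The formula is
meaningful for `N = 3` only.) -/
def X2three (N : ℕ) : VField (Idx N) := fun x =>
  let a1 := a x 1
  let a2 := a x 2
  let b1 := b x 1
  let b2 := b x 2
  let b3 := b x 3
  mkVec N
    (fun i => match i with
      | 1 => a1 * (a1 ^ 2 + 5 * a1 * b1 - a2 ^ 2 + 2 * a2 * b1 - 2 * a2 * b2 - a2 * b3
          + 4 * b1 ^ 2 + 2 * b1 * b2 - b2 ^ 2)
      | 2 => a2 * (3 * a1 ^ 2 + 4 * a1 * a2 + 3 * a1 * b1 + 6 * a1 * b2 + 2 * a1 * b3 + a2 ^ 2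
          + 4 * a2 * b2 + a2 * b3 - 2 * b1 * b2 + 2 * b1 * b3 + 3 * b2 ^ 2 + 2 * b2 * b3)
      | _ => 0)
    (fun i => match i with
      | 1 => b1 * (-2 * a1 ^ 2 - 2 * a1 * a2 - a1 * b1 - 2 * a1 * b2 + b1 ^ 2)
      | 2 => b2 * (3 * a1 ^ 2 + 2 * a1 * a2 + 3 * a1 * b1 + 4 * a1 * b2 - a2 ^ 2 + 2 * a2 * b1
          - a2 * b3 + b2 ^ 2)
      | 3 => b3 * (2 * a2 ^ 2 + 2 * a1 * a2 - 2 * a2 * b1 + 2 * a2 * b2 + 3 * a2 * b3 + b3 ^ 2)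
      | _ => 0)

/-- The constants of motion `H_m`, `m ≥ 1`, are in involution. -/
def HamsInvolution (π : Tensor2 (Idx N)) : Prop :=
  ∀ m n : ℕ, 1 ≤ m → 1 ≤ n → bracket π (Ham N m) (Ham N n) = 0

/-- The eigenvalues of `L` are in involution: any two functions that are smooth on an open set
and are (possibly complex) eigenvalues of `L` there have vanishing bracket on that set. -/
def EigenvaluesInvolution (π : Tensor2 (Idx N)) : Prop :=
  ∀ (U : Set (Phase N)) (l m : Phase N → ℂ), IsOpen U →
    ContDiffOn ℝ ∞ l U → ContDiffOn ℝ ∞ m U →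
    (∀ x ∈ U, Module.End.HasEigenvalue
      (Matrix.toLin' ((lax x).map (fun t : ℝ => (t : ℂ)))) (l x)) →
    (∀ x ∈ U, Module.End.HasEigenvalue
      (Matrix.toLin' ((lax x).map (fun t : ℝ => (t : ℂ)))) (m x)) →
    ∀ x ∈ U, bracket π l m x = 0

/-- A bracket is trivial if every `H_m` is a Casimir. -/
def IsTrivialBracket (π : Tensor2 (Idx N)) : Prop :=
  ∀ m : ℕ, 1 ≤ m → IsCasimirOn π Set.univ (Ham N m)

/-! ### Canonical variables -/

/-- Canonical variables `(q, p)` in `ℝ^{2N}`: `q_j` on the left, `p_j` on the right. -/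
abbrev CanIdx (N : ℕ) : Type := Fin N ⊕ Fin N

/-- The coordinate `q_j`, `1 ≤ j ≤ N` (zero for other `j`; those values are never used). -/
def q (z : CanIdx N → ℝ) (j : ℕ) : ℝ :=
  if h : 1 ≤ j ∧ j ≤ N then z (Sum.inl ⟨j - 1, by omega⟩) else 0

/-- The coordinate `p_j`, `1 ≤ j ≤ N` (zero for other `j`; those values are never used). -/
def p (z : CanIdx N → ℝ) (j : ℕ) : ℝ :=
  if h : 1 ≤ j ∧ j ≤ N then z (Sum.inr ⟨j - 1, by omega⟩) else 0

/-- The symplectic bracket `{f, g} = ∑ (∂f/∂p_j ∂g/∂q_j - ∂f/∂q_j ∂g/∂p_j)`; with the convention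
`χ_H(f) = {H, f}` Hamilton's equations read `q̇ = ∂H/∂p`, `ṗ = -∂H/∂q`. -/
def piSymp (N : ℕ) : Tensor2 (CanIdx N) := fun _ => Matrix.of fun k l =>
  match k, l with
  | Sum.inr i, Sum.inl j => if i = j then 1 else 0
  | Sum.inl i, Sum.inr j => if i = j then -1 else 0
  | _, _ => 0

/-- `f(q_j - q_{j+1})` with `f(t) = √(1 + g² e^t)`; it is `1` at the two ends `j = 0` and `j = N`
because of the convention `q_0 = -∞`, `q_{N+1} = ∞`. -/
def link (g : ℝ) (z : CanIdx N → ℝ) (j : ℕ) : ℝ :=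
  if 1 ≤ j ∧ j ≤ N - 1 then Real.sqrt (1 + g ^ 2 * Real.exp (q z j - q z (j + 1))) else 1

/-- The relativistic Toda Hamiltonian
`∑_{j=1}^N e^{p_j} f(q_{j-1} - q_j) f(q_j - q_{j+1})`. -/
def canHam (N : ℕ) (g : ℝ) (z : CanIdx N → ℝ) : ℝ :=
  ∑ j ∈ Finset.Icc 1 N, Real.exp (p z j) * link g z (j - 1) * link g z j

/-- `a_j = g² e^{q_j - q_{j+1} + p_j} f(q_{j-1} - q_j) / f(q_j - q_{j+1})`, with `a_N = 0`. -/
def aOf (g : ℝ) (z : CanIdx N → ℝ) (j : ℕ) : ℝ :=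
  if 1 ≤ j ∧ j ≤ N - 1 then
    g ^ 2 * Real.exp (q z j - q z (j + 1) + p z j) * link g z (j - 1) / link g z j
  else 0

/-- `q̇_j = ∂H/∂p_j` (for `1 ≤ j ≤ N`). -/
def qdot (g : ℝ) (z : CanIdx N → ℝ) (j : ℕ) : ℝ :=
  if h : 1 ≤ j ∧ j ≤ N then pd (Sum.inr ⟨j - 1, by omega⟩) (canHam N g) z else 0

/-- The change of variables `(q, p) ↦ (a, b)`, with `b_j = q̇_j - a_j`. -/
def changeVar (N : ℕ) (g : ℝ) (z : CanIdx N → ℝ) : Phase N :=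
  mkVec N (fun j => aOf g z j) (fun j => qdot g z j - aOf g z j)

end RelToda

end

open scoped ContDiff

noncomputable section

namespace RelToda

/-! ### Biderivations of a commutative algebra -/

section Biderivation

variable {R : Type*} [CommRing R] [Algebra ℝ R]

/-! Apart from the eigenvalues, `Tr L⁻¹` and the canonical variables, the theorem is an assertion
about polynomials. Brackets are therefore treated as biderivations of `ℝ[a, b]` and vector fields as
derivations; `fn`, `vfOf` and `tensorOf` carry identities back to `ℝ^{2N-1}`, and
`isPoisson_tensorOf` extends the Jacobi identity from coordinates to smooth functions.

Poisson property. A Lie derivative obeys the Leibniz rule on Schouten brackets (`lie_schouten`). The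
bracket π₂ is log-canonical and π₁ is linear of a very simple type, so both are Poisson. Along X₁
the Lie derivatives are π₁ ↦ -2π₂, π₂ ↦ -π₃, π₃ ↦ 0, and differentiating [π₁,π₁] = 0 and [π₂,π₂] = 0
repeatedly yields the vanishing of all other Schouten brackets among the three.

Spectral part. Taking differences of columns makes 1 - tL tridiagonal, so the truncated determinants
p_n (`pp`) satisfy a three-term recursion, and p_N = det(1 - tL) = exp(-∑ H_m t^m). Statements about
all H_m become identities for p_N, proved by induction along the recursion: t{p_N,·}₂ = {p_N,·}₁ is
the Lenard relation {H_m,·}₂ = {H_{m+1},·}₁, and X₁ p_N = p_N' + H₁ p_N gives X₁ H_m = (m+1)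
H_{m+1}. Involution, Casimirs, {H_m,·}₃ = {H_{m+1},·}₂ and the master symmetry property follow
formally. The differential of an eigenvalue is, on a dense open set, a combination of differentials
of coefficients of p_N, whence the eigenvalues are in involution.

Second master symmetry. `D2` is built so that t D2(p_N) = p_N' + H₁ p_N + t (H₁² - 2e) p_N, with e
the coefficient of t² in p_N; hence D2 H_m = (m+2) H_{m+2}. A derivation that kills p_N and p_{N-1}
is zero, because these two polynomials determine all coordinates. Closed formulas for {p_N(s),
p_{N-1}(t)}₂ then give {H_m,·}₄ = -2{H_{m+2},·}₂ and {p_{N-1}(s), p_{N-1}(t)}₄ = 0. Since [π₂,π₄] =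
0, the Hamiltonian fields of the H_m preserve π₄, and the Jacobi identity for π₄ only remains to be
seen on the coefficients of p_{N-1}, where it is trivial. Adding the Hamiltonian field of 2H₂ -
H₁²/2 changes none of this and produces the explicit X₂ for N = 3.

Canonical variables. With f_j the link factors, b_j = e^{p_j} f_{j-1}/f_j and a_j = (f_j² - 1) b_j,
so the brackets are read off from logarithmic differentials. -/

/-- Biderivations of a commutative `ℝ`-algebra. -/
abbrev Bider (R : Type*) [CommRing R] [Algebra ℝ R] : Type _ :=
  Derivation ℝ R (Derivation ℝ R R)

/-- Evaluation of derivations at an element, as a linear map. -/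
def derEval (g : R) : Derivation ℝ R R →ₗ[R] R where
  toFun v := v g
  map_add' _ _ := rfl
  map_smul' _ _ := rfl

/-- The bracket with a fixed second argument, as a derivation. -/
def Bider.left (B : Bider R) (g : R) : Derivation ℝ R R := (derEval g).compDer B

@[simp] theorem Bider.left_apply (B : Bider R) (f g : R) : B.left g f = B f g := rfl

theorem bider_mul_left (B : Bider R) (f g h : R) : B (f * g) h = f * B g h + g * B f h := by
  simp [Derivation.leibniz]

theorem bider_mul_right (B : Bider R) (f g h : R) : B f (g * h) = g * B f h + h * B f g := by
  simp [Derivation.leibniz]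

/-- Skew-symmetric biderivations. -/
def Bider.Skew (B : Bider R) : Prop := ∀ f g, B f g = - B g f

/-- The Lie derivative of a biderivation along a derivation. -/
def lieB (X : Derivation ℝ R R) (B : Bider R) : Bider R where
  toFun f := ⁅X, B f⁆ - B (X f)
  map_add' f g := by ext; simp [Derivation.commutator_apply]; ring
  map_smul' c f := by ext; simp [smul_sub]
  map_one_eq_zero' := by ext; simp
  leibniz' f g := by
    ext h
    simp [Derivation.leibniz]; ring

theorem lieB_apply (X : Derivation ℝ R R) (B : Bider R) (f g : R) :
    lieB X B f g = X (B f g) - B (X f) g - B f (X g) := by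
  change (⁅X, B f⁆ - B (X f)) g = _
  simp [Derivation.commutator_apply]; ring

theorem Bider.Skew.lieB {B : Bider R} (hB : B.Skew) (X : Derivation ℝ R R) :
    (RelToda.lieB X B).Skew := fun f g => by
  rw [lieB_apply, lieB_apply, hB f g, hB (X f), hB f (X g), map_neg]; ring

/-- The trilinear form of the Schouten bracket of two biderivations. -/
def schouten (B B' : Bider R) (f g h : R) : R :=
  B f (B' g h) - B' g (B f h) + (B' f (B g h) - B g (B' f h)) - B (B' f g) h - B' (B f g) h

theorem schouten_comm (B B' : Bider R) (f g h : R) :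
    schouten B B' f g h = schouten B' B f g h := by
  unfold schouten; ring

theorem schouten_swap_left {B B' : Bider R} (hB : B.Skew) (hB' : B'.Skew) (f g h : R) :
    schouten B B' f g h = - schouten B B' g f h := by
  simp only [schouten, hB f g, hB' f g, map_neg, Derivation.coe_neg, Pi.neg_apply]; ring

theorem schouten_swap_right {B B' : Bider R} (hB : B.Skew) (hB' : B'.Skew) (f g h : R) :
    schouten B B' f g h = - schouten B B' f h g := by
  simp only [schouten, hB h g, hB' h g, map_neg, hB (B' f g) h, hB' (B f g) h,
    hB (B' f h) g, hB' (B f h) g]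
  ring

/-- The Schouten bracket as a derivation in its last argument. -/
def schoutenDer (B B' : Bider R) (f g : R) : Derivation ℝ R R :=
  ⁅B f, B' g⁆ + ⁅B' f, B g⁆ - B (B' f g) - B' (B f g)

theorem schoutenDer_apply (B B' : Bider R) (f g h : R) :
    schoutenDer B B' f g h = schouten B B' f g h := by
  simp [schoutenDer, schouten, Derivation.commutator_apply]

/-- A derivation may be moved through every bracket at the cost of replacing the bracket by its Lie
derivative or differentiating an argument. Skew-symmetry plays no role. This rule is what propagates
the Jacobi identity from one tensor to the next. -/
theorem lie_schouten (X : Derivation ℝ R R) (B B' : Bider R) (f g h : R) :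
    X (schouten B B' f g h) = schouten (lieB X B) B' f g h + schouten B (lieB X B') f g h
      + schouten B B' (X f) g h + schouten B B' f (X g) h + schouten B B' f g (X h) := by
  simp only [schouten, lieB_apply, map_add, map_sub, Derivation.coe_sub, Pi.sub_apply]; ring

/-- If a Schouten bracket vanishes, its Lie derivatives vanish. -/
theorem schouten_lieB_of_eq_zero {B B' : Bider R} (h0 : ∀ f g h, schouten B B' f g h = 0)
    (X : Derivation ℝ R R) (f g h : R) :
    schouten (lieB X B) B' f g h + schouten B (lieB X B') f g h = 0 := by
  have := lie_schouten X B B' f g h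
  simp only [h0, map_zero, add_zero] at this
  exact this.symm

theorem schouten_smul_left (c : ℝ) (B B' : Bider R) (f g h : R) :
    schouten (c • B) B' f g h = c • schouten B B' f g h := by
  simp only [schouten, Derivation.coe_smul, Pi.smul_apply, Derivation.map_smul, smul_sub, smul_add]

theorem schouten_smul_right (c : ℝ) (B B' : Bider R) (f g h : R) :
    schouten B (c • B') f g h = c • schouten B B' f g h := by
  simp only [schouten, Derivation.coe_smul, Pi.smul_apply, Derivation.map_smul, smul_sub, smul_add]

theorem schouten_add_add (B B' : Bider R) (f g h : R) :
    schouten (B + B') (B + B') f g h = schouten B B f g h + schouten B' B' f g h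
      + (schouten B B' f g h + schouten B B' f g h) := by
  simp only [schouten, Derivation.coe_add, Pi.add_apply, map_add]; ring

theorem jacobi_of_schouten {B : Bider R} (h0 : ∀ f g h, schouten B B f g h = 0)
    (f g h : R) : B f (B g h) = B (B f g) h + B g (B f h) := by
  have := h0 f g h
  simp only [schouten] at this
  have h2 : (2 : ℝ) • (B f (B g h)) = (2 : ℝ) • (B (B f g) h + B g (B f h)) := by
    rw [two_smul, two_smul]; linear_combination this
  have := congrArg (fun x => (2⁻¹ : ℝ) • x) h2
  simpa [smul_smul] using this

/-- The Hamiltonian derivations preserve a Poisson biderivation. -/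
theorem lieB_ham_self {B : Bider R} (h0 : ∀ f g h, schouten B B f g h = 0) (f : R) :
    lieB (B f) B = 0 := by
  ext g h
  simp only [lieB_apply, jacobi_of_schouten h0 f g h, Derivation.coe_zero, Pi.zero_apply]
  simp

theorem lieB_add_left (X Y : Derivation ℝ R R) (B : Bider R) :
    lieB (X + Y) B = lieB X B + lieB Y B := by
  ext f g; simp [lieB_apply]; ring

end Biderivation

/-! ### Biderivations of a polynomial ring -/

section Polynomials

variable {ι : Type}

/-- The polynomial biderivation with given brackets of the coordinates. -/
def biderOf (T : ι → ι → MvPolynomial ι ℝ) : Bider (MvPolynomial ι ℝ) :=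
  MvPolynomial.mkDerivation ℝ fun i => MvPolynomial.mkDerivation ℝ fun j => T i j

@[simp] theorem biderOf_X (T : ι → ι → MvPolynomial ι ℝ) (i j : ι) :
    biderOf T (.X i) (.X j) = T i j := by simp [biderOf]

theorem bider_ext {B B' : Bider (MvPolynomial ι ℝ)}
    (h : ∀ i j, B (.X i) (.X j) = B' (.X i) (.X j)) : B = B' := by
  refine MvPolynomial.derivation_ext fun i => MvPolynomial.derivation_ext fun j => h i j

theorem skew_of_X {B : Bider (MvPolynomial ι ℝ)}
    (h : ∀ i j, B (.X i) (.X j) = - B (.X j) (.X i)) : B.Skew := by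
  have h1 : ∀ i, B.left (.X i) = - B (.X i) := fun i =>
    MvPolynomial.derivation_ext fun j => by simpa using h j i
  have h2 : ∀ f, B.left f = - B f := fun f => MvPolynomial.derivation_ext fun i => by
    have := DFunLike.congr_fun (h1 i) f
    simp only [Bider.left_apply, Derivation.coe_neg, Pi.neg_apply] at this ⊢
    rw [this, neg_neg]
  intro f g
  have := DFunLike.congr_fun (h2 g) f
  simpa using this

end Polynomials

/-! ### Polynomial tensors as tensor fields -/

section Bridge

set_option linter.unusedSectionVars false

variable {ι : Type} [Fintype ι] [DecidableEq ι]

local notation "𝓟" => MvPolynomial ι ℝ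

/-- The polynomial function defined by a polynomial. -/
def fn (F : MvPolynomial ι ℝ) (x : ι → ℝ) : ℝ := MvPolynomial.eval x F

theorem hasFDerivAt_fn (F : 𝓟) (x : ι → ℝ) :
    HasFDerivAt (fn F) (∑ i, fn (MvPolynomial.pderiv i F) x •
      ContinuousLinearMap.proj (R := ℝ) (φ := fun _ : ι => ℝ) i) x := by
  induction F using MvPolynomial.induction_on with
  | C c =>
    have : fn (MvPolynomial.C c : 𝓟) = fun _ => c := by ext; simp [fn]
    rw [this]
    refine (hasFDerivAt_const c x).congr_fderiv ?_
    simp [fn]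
  | add p q hp hq =>
    have : fn (p + q) = fn p + fn q := by ext; simp [fn]
    rw [this]
    refine (hp.add hq).congr_fderiv ?_
    simp [fn, add_smul, Finset.sum_add_distrib]
  | mul_X p j hp =>
    have : fn (p * .X j) = fun x => fn p x * x j := by ext; simp [fn]
    rw [this]
    refine (hp.mul (hasFDerivAt_apply j x)).congr_fderiv ?_
    ext v
    simp only [fn, Derivation.leibniz, MvPolynomial.pderiv_X, smul_eq_mul, map_add, map_mul,
      MvPolynomial.eval_X, add_smul, Finset.sum_add_distrib, add_apply,
      smul_apply, FunLike.coe_sum, Finset.sum_apply,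
      ContinuousLinearMap.proj_apply, Finset.mul_sum]
    congr 1
    · rw [Finset.sum_eq_single j] <;> simp +contextual [eq_comm]
    · exact Finset.sum_congr rfl fun i _ => by ring

theorem fderiv_fn (F : 𝓟) (x v : ι → ℝ) :
    fderiv ℝ (fn F) x v = ∑ i, fn (MvPolynomial.pderiv i F) x * v i := by
  rw [(hasFDerivAt_fn F x).fderiv]; simp

theorem contDiff_fn (F : 𝓟) : ContDiff ℝ ∞ (fn F) := by
  induction F using MvPolynomial.induction_on with
  | C c =>
    have : fn (MvPolynomial.C c : 𝓟) = fun _ => c := by ext; simp [fn]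
    rw [this]; exact contDiff_const
  | add p q hp hq =>
    have : fn (p + q) = fn p + fn q := by ext; simp [fn]
    rw [this]; exact hp.add hq
  | mul_X p j hp =>
    have : fn (p * .X j) = fun x => fn p x * x j := by ext; simp [fn]
    rw [this]; exact hp.mul (contDiff_apply ℝ ℝ j)

theorem pd_fn (F : 𝓟) (i : ι) : pd i (fn F) = fn (MvPolynomial.pderiv i F) := by
  ext x
  rw [pd, fderiv_fn, Finset.sum_eq_single i] <;> simp +contextual

theorem fn_X (i : ι) : fn (.X i : 𝓟) = fun x => x i := by ext; simp [fn]

theorem sum_derivation_apply {κ : Type*} (s : Finset κ) (v : κ → Derivation ℝ 𝓟 𝓟) (F : 𝓟) :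
    (∑ i ∈ s, v i) F = ∑ i ∈ s, v i F := map_sum (derEval F) v s

/-- The chain rule: a derivation of a polynomial ring is the combination of partial derivatives with
coefficients `v (X i)`. It is the bridge between algebraic and analytic brackets. -/
theorem fn_derivation (v : Derivation ℝ 𝓟 𝓟) (F : 𝓟) (x : ι → ℝ) :
    fn (v F) x = ∑ i, fn (MvPolynomial.pderiv i F) x * fn (v (.X i)) x := by
  have : v = ∑ i, v (.X i) • MvPolynomial.pderiv (R := ℝ) i := by
    refine MvPolynomial.derivation_ext fun j => ?_
    rw [sum_derivation_apply, Finset.sum_eq_single j] <;>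
    simp +contextual [MvPolynomial.pderiv_X, eq_comm]
  conv_lhs => rw [this]
  rw [sum_derivation_apply]
  simp [fn, map_sum, mul_comm]

/-- The tensor field of a polynomial biderivation. -/
def tensorOf (B : Bider 𝓟) : Tensor2 ι := fun x => Matrix.of fun i j => fn (B (.X i) (.X j)) x

/-- The vector field of a derivation of polynomials. -/
def vfOf (v : Derivation ℝ 𝓟 𝓟) : VField ι := fun x i => fn (v (.X i)) x

theorem along_vfOf (v : Derivation ℝ 𝓟 𝓟) (F : 𝓟) : along (vfOf v) (fn F) = fn (v F) := by
  ext x; rw [along, fderiv_fn, fn_derivation]; rfl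

theorem contDiff_vfOf (v : Derivation ℝ 𝓟 𝓟) : ContDiff ℝ ∞ (vfOf v) :=
  contDiff_pi.2 fun i => contDiff_fn (v (.X i))

/-- The bracket of a polynomial with an arbitrary function. -/
theorem bracket_fn_left (B : Bider 𝓟) (F : 𝓟) (g : (ι → ℝ) → ℝ) (x : ι → ℝ) :
    bracket (tensorOf B) (fn F) g x = ∑ j, fn (B F (.X j)) x * pd j g x := by
  rw [bracket, Finset.sum_comm]
  refine Finset.sum_congr rfl fun j _ => ?_
  rw [← Bider.left_apply, fn_derivation, Finset.sum_mul]
  refine Finset.sum_congr rfl fun i _ => ?_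
  simp [tensorOf, pd_fn]; ring

theorem bracket_fn (B : Bider 𝓟) (F G : 𝓟) :
    bracket (tensorOf B) (fn F) (fn G) = fn (B F G) := by
  ext x
  rw [bracket_fn_left, fn_derivation]
  exact Finset.sum_congr rfl fun j _ => by rw [pd_fn]; ring

theorem hamVF_fn (B : Bider 𝓟) (F : 𝓟) : hamVF (tensorOf B) (fn F) = vfOf (B F) := by
  ext x j
  rw [hamVF, vfOf, ← fn_X, bracket_fn]

theorem lieDeriv_tensorOf (v : Derivation ℝ 𝓟 𝓟) (B : Bider 𝓟) :
    lieDeriv (vfOf v) (tensorOf B) = tensorOf (lieB v B) := by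
  ext x i j
  have e2 : ∀ i, (fun y => vfOf v y i) = fn (v (.X i)) := fun i => rfl
  have hv : ∀ F : 𝓟, fn (B F (.X j)) x
      = ∑ k, fn (MvPolynomial.pderiv k F) x * fn (B (.X k) (.X j)) x := fun F => by
    rw [← Bider.left_apply, fn_derivation]; rfl
  simp only [lieDeriv, Matrix.of_apply, e2, along_vfOf, pd_fn, tensorOf, lieB_apply]
  have h1 := hv (v (.X i))
  have h2 := fn_derivation (B (.X i)) (v (.X j)) x
  simp only [fn, map_sub] at h1 h2 ⊢
  rw [h1, h2]
  congr 1
  exact Finset.sum_congr rfl fun k _ => mul_comm _ _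

theorem lieBracket_vfOf (v w : Derivation ℝ 𝓟 𝓟) :
    VectorField.lieBracket ℝ (vfOf v) (vfOf w) = vfOf ⁅v, w⁆ := by
  ext x i
  have hd : ∀ u : Derivation ℝ 𝓟 𝓟, Differentiable ℝ (vfOf u) := fun u =>
    (contDiff_vfOf u).differentiable (by simp)
  have key : ∀ u t : Derivation ℝ 𝓟 𝓟, fderiv ℝ (vfOf t) x (vfOf u x) i = fn (u (t (.X i))) x := by
    intro u t
    have := congrFun (along_vfOf u (t (.X i))) x
    rw [← this, along]
    have h := fderiv_apply (𝕜 := ℝ) (Φ := vfOf t) (x := x) (hd t x) i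
    exact (DFunLike.congr_fun h (vfOf u x)).symm
  rw [VectorField.lieBracket, Pi.sub_apply, key, key]
  simp [vfOf, fn, Derivation.commutator_apply]

theorem tensorOf_add (B B' : Bider 𝓟) : tensorOf (B + B') = tensorOf B + tensorOf B' := by
  ext; simp [tensorOf, fn]

theorem tensorOf_neg (B : Bider 𝓟) : tensorOf (-B) = - tensorOf B := by
  ext; simp [tensorOf, fn]

theorem tensorOf_zero : tensorOf (0 : Bider 𝓟) = 0 := by
  ext; simp [tensorOf, fn]

theorem fn_injective : Function.Injective (fn : 𝓟 → (ι → ℝ) → ℝ) := fun _ _ h =>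
  MvPolynomial.funext fun x => congrFun h x

theorem vfOf_eq_zero {v : Derivation ℝ 𝓟 𝓟} : vfOf v = 0 ↔ v = 0 := by
  constructor
  · intro h
    refine MvPolynomial.derivation_ext fun i => fn_injective ?_
    ext x
    simpa [fn, vfOf] using congrFun (congrFun h x) i
  · rintro rfl; ext; simp [vfOf, fn]

/-- A polynomial whose brackets with the coordinates vanish is a Casimir. -/
theorem isCasimirOn_univ_fn {B : Bider 𝓟} {F : 𝓟} (h : B F = 0) :
    IsCasimirOn (tensorOf B) Set.univ (fn F) := by
  refine ⟨(contDiff_fn F).contDiffOn, fun g _ x _ => ?_⟩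
  rw [bracket_fn_left]
  simp [h, fn]

/-! ### Smooth Poisson tensors -/

theorem bracket_eq_fderiv (π : Tensor2 ι) (f g : (ι → ℝ) → ℝ) (x : ι → ℝ) :
    bracket π f g x = fderiv ℝ g x (hamVF π f x) := by
  have hv : ∀ v : ι → ℝ, fderiv ℝ g x v = ∑ j, v j * pd j g x := by
    intro v
    conv_lhs => rw [pi_eq_sum_univ' v]
    rw [map_sum]
    refine Finset.sum_congr rfl fun j _ => ?_
    rw [map_smul, smul_eq_mul]
    congr 2
  rw [hv]
  have hc : ∀ k j : ι, pd k (fun y : ι → ℝ => y j) x = if k = j then 1 else 0 := by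
    intro k j
    rw [pd, fderiv_apply differentiableAt_id j]
    simp [Pi.single_apply, eq_comm]
  simp only [hamVF, bracket, hc, Finset.sum_mul]
  rw [Finset.sum_comm]
  simp [mul_assoc]

theorem contDiff_pd {f : (ι → ℝ) → ℝ} (hf : ContDiff ℝ ∞ f) (i : ι) : ContDiff ℝ ∞ (pd i f) :=
  (hf.fderiv_right (m := ∞) (by simp)).clm_apply contDiff_const

theorem contDiff_bracket {π : Tensor2 ι} (hπ : ∀ i j, ContDiff ℝ ∞ fun x => π x i j)
    {f g : (ι → ℝ) → ℝ} (hf : ContDiff ℝ ∞ f) (hg : ContDiff ℝ ∞ g) :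
    ContDiff ℝ ∞ (bracket π f g) := by
  refine ContDiff.sum fun i _ => ContDiff.sum fun j _ => ?_
  exact (hπ i j).mul ((contDiff_pd hf i).mul (contDiff_pd hg j))

theorem contDiff_hamVF {π : Tensor2 ι} (hπ : ∀ i j, ContDiff ℝ ∞ fun x => π x i j)
    {f : (ι → ℝ) → ℝ} (hf : ContDiff ℝ ∞ f) : ContDiff ℝ ∞ (hamVF π f) :=
  contDiff_pi.2 fun j => contDiff_bracket hπ hf (contDiff_apply ℝ ℝ j)

/-- The second-order terms cancel by symmetry of the second derivative, so a commutator of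
directional derivatives is again a directional derivative. -/
theorem fderiv_fderiv_sub {h : (ι → ℝ) → ℝ} (hh : ContDiff ℝ ∞ h) {V W : VField ι}
    (hV : ContDiff ℝ ∞ V) (hW : ContDiff ℝ ∞ W) (x : ι → ℝ) :
    fderiv ℝ (fun y => fderiv ℝ h y (W y)) x (V x) - fderiv ℝ (fun y => fderiv ℝ h y (V y)) x (W x)
      = fderiv ℝ h x (VectorField.lieBracket ℝ V W x) := by
  have hd : DifferentiableAt ℝ (fderiv ℝ h) x :=
    ((hh.fderiv_right (m := ∞) (by simp)).differentiable (by simp)) x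
  have e : ∀ {U : VField ι}, ContDiff ℝ ∞ U → ∀ v, fderiv ℝ (fun y => fderiv ℝ h y (U y)) x v
      = fderiv ℝ (fderiv ℝ h) x v (U x) + fderiv ℝ h x (fderiv ℝ U x v) := by
    intro U hU v
    have := hd.hasFDerivAt.clm_apply ((hU.differentiable (by simp)) x).hasFDerivAt
    rw [this.fderiv]
    simp [add_comm]
  rw [e hW, e hV, VectorField.lieBracket, map_sub]
  have hs : IsSymmSndFDerivAt ℝ h x :=
    (contDiff_infty.1 hh 2).contDiffAt.isSymmSndFDerivAt (by simp)
  rw [hs.eq (V x) (W x)]; ring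

theorem bracket_skew {π : Tensor2 ι} (hskew : ∀ x i j, π x i j = - π x j i)
    (f g : (ι → ℝ) → ℝ) (x : ι → ℝ) : bracket π f g x = - bracket π g f x := by
  rw [bracket, bracket, Finset.sum_comm, ← Finset.sum_neg_distrib]
  refine Finset.sum_congr rfl fun i _ => ?_
  rw [← Finset.sum_neg_distrib]
  refine Finset.sum_congr rfl fun j _ => ?_
  rw [hskew x j i]; simp only [smul_eq_mul]; ring

/-- A smooth skew-symmetric tensor is Poisson if the Jacobi identity holds for coordinates. -/
theorem isPoisson_of_coordinates {π : Tensor2 ι} (hπ : ∀ i j, ContDiff ℝ ∞ fun x => π x i j)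
    (hskew : ∀ x i j, π x i j = - π x j i)
    (hJ : ∀ i j k : ι, ∀ x, bracket π (fun y => y i) (bracket π (fun y => y j) (fun y => y k)) x
      + bracket π (fun y => y j) (bracket π (fun y => y k) (fun y => y i)) x
      + bracket π (fun y => y k) (bracket π (fun y => y i) (fun y => y j)) x = 0) :
    IsPoisson π := by
  have sk := bracket_skew hskew
  have sk' : ∀ f g : (ι → ℝ) → ℝ, bracket π f g = - bracket π g f := fun f g => by
    ext x; simpa using sk f g x
  have hneg : ∀ (f g : (ι → ℝ) → ℝ) (x : ι → ℝ), bracket π f (-g) x = - bracket π f g x := by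
    intro f g x
    rw [bracket_eq_fderiv, bracket_eq_fderiv, fderiv_neg]; rfl
  let J : ((ι → ℝ) → ℝ) → ((ι → ℝ) → ℝ) → ((ι → ℝ) → ℝ) → (ι → ℝ) → ℝ := fun f g h x =>
    bracket π f (bracket π g h) x + bracket π g (bracket π h f) x + bracket π h (bracket π f g) x
  have hc : ∀ k : ι, ContDiff ℝ ∞ fun y : ι → ℝ => y k := fun k => contDiff_apply ℝ ℝ k
  -- For fixed `f` and `g` the Jacobiator is the derivative of `h` along the vector field [χ_f, χ_g]
  -- - χ_{f,g}; it therefore vanishes as soon as it vanishes on coordinates.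
  have J1 : ∀ f g h, ContDiff ℝ ∞ f → ContDiff ℝ ∞ g → ContDiff ℝ ∞ h → ∀ x,
      J f g h x = fderiv ℝ h x (VectorField.lieBracket ℝ (hamVF π f) (hamVF π g) x
        - hamVF π (bracket π f g) x) := by
    intro f g h hf hg hh x
    rw [map_sub, ← fderiv_fderiv_sub hh (contDiff_hamVF hπ hf) (contDiff_hamVF hπ hg),
      ← bracket_eq_fderiv]
    have e : ∀ g : (ι → ℝ) → ℝ, (fun y => fderiv ℝ h y (hamVF π g y)) = bracket π g h :=
      fun g => by ext y; rw [bracket_eq_fderiv]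
    rw [e, e, ← bracket_eq_fderiv, ← bracket_eq_fderiv]
    change _ + _ + _ = _
    rw [sk' h f, hneg, sk (bracket π f g) h]; ring
  have J2 : ∀ f g, ContDiff ℝ ∞ f → ContDiff ℝ ∞ g → (∀ k x, J f g (fun y => y k) x = 0) →
      ∀ h, ContDiff ℝ ∞ h → ∀ x, J f g h x = 0 := by
    intro f g hf hg h0 h hh x
    rw [J1 f g h hf hg hh]
    have : VectorField.lieBracket ℝ (hamVF π f) (hamVF π g) x - hamVF π (bracket π f g) x = 0 := by
      ext k
      have := h0 k x
      rw [J1 f g _ hf hg (hc k), fderiv_apply differentiableAt_id k] at this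
      simpa using this
    rw [this, map_zero]
  have Jc : ∀ f g h x, J f g h x = J g h f x := fun f g h x => by
    change _ + _ + _ = _ + _ + _; ring
  -- Cyclic symmetry brings each slot in turn into the last position, so coordinates are replaced by
  -- arbitrary smooth functions one argument at a time.
  have J3 : ∀ f g h, ContDiff ℝ ∞ f → ContDiff ℝ ∞ g → ContDiff ℝ ∞ h → ∀ x, J f g h x = 0 := by
    have a1 : ∀ i j h, ContDiff ℝ ∞ h → ∀ x, J (fun y => y i) (fun y => y j) h x = 0 :=
      fun i j => J2 _ _ (hc i) (hc j) fun k x => hJ i j k x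
    have a2 : ∀ i h g, ContDiff ℝ ∞ h → ContDiff ℝ ∞ g → ∀ x, J h (fun y => y i) g x = 0 :=
      fun i h g hh hg => J2 _ _ hh (hc i) (fun k x => by rw [Jc]; exact a1 i k h hh x) g hg
    intro f g h hf hg hh
    exact J2 f g hf hg (fun k x => by rw [Jc]; exact a2 k g f hg hf x) h hh
  have dif : ∀ {g : (ι → ℝ) → ℝ}, ContDiff ℝ ∞ g → ∀ x, DifferentiableAt ℝ g x :=
    fun hg x => (hg.differentiable (by simp)) x
  refine ⟨hπ, fun f g _ _ => sk' f g, fun f g h _ hg hh => ?_, fun c f g _ hg => ?_,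
    fun f g h _ hg hh => ?_, fun f g h hf hg hh => ?_⟩
  · ext x
    simp only [Pi.add_apply, bracket_eq_fderiv]
    rw [fderiv_add (dif hg x) (dif hh x)]; rfl
  · ext x
    simp only [Pi.smul_apply, bracket_eq_fderiv]
    rw [fderiv_const_smul (dif hg x)]; rfl
  · ext x
    simp only [Pi.add_apply, Pi.mul_apply, bracket_eq_fderiv]
    rw [fderiv_mul (dif hg x) (dif hh x)]
    simp; ring
  · ext x
    exact J3 f g h hf hg hh x

theorem isPoisson_tensorOf {B : Bider 𝓟} (hB : B.Skew)
    (h0 : ∀ f g h, schouten B B f g h = 0) : IsPoisson (tensorOf B) := by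
  refine isPoisson_of_coordinates (fun i j => contDiff_fn _) (fun x i j => ?_) fun i j k x => ?_
  · change fn _ x = - fn _ x
    rw [hB]; simp [fn]
  · simp only [← fn_X, bracket_fn]
    have := jacobi_of_schouten h0 (.X i) (.X j) (.X k)
    rw [hB (.X k) (.X i), hB (.X k) (B _ _), this]
    simp [fn]

end Bridge

/-! ### The polynomial brackets -/

section Tables

variable {N : ℕ}

/-- Polynomials in the coordinates `a_1, …, b_N`. -/
abbrev Pol (N : ℕ) : Type := MvPolynomial (Idx N) ℝ

/-- The polynomial `a_j`. -/
def pa (N j : ℕ) : Pol N :=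
  if h : 1 ≤ j ∧ j ≤ N - 1 then .X (Sum.inl ⟨j - 1, by omega⟩) else 0

/-- The polynomial `b_j`. -/
def pb (N j : ℕ) : Pol N :=
  if h : 1 ≤ j ∧ j ≤ N then .X (Sum.inr ⟨j - 1, by omega⟩) else 0

theorem fn_pa (j : ℕ) (x : Phase N) : fn (pa N j) x = a x j := by
  unfold pa a fn; split_ifs <;> simp

theorem fn_pb (j : ℕ) (x : Phase N) : fn (pb N j) x = b x j := by
  unfold pb b fn; split_ifs <;> simp

theorem X_inl (i : Fin (N - 1)) : (.X (Sum.inl i) : Pol N) = pa N (i + 1) := by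
  rw [pa, dif_pos ⟨by omega, by omega⟩]; rfl

theorem X_inr (i : Fin N) : (.X (Sum.inr i) : Pol N) = pb N (i + 1) := by
  rw [pb, dif_pos ⟨by omega, by omega⟩]; rfl

@[simp] theorem pa_zero : pa N 0 = 0 := by simp [pa]

theorem pa_eq_zero {j : ℕ} (h : ¬ (1 ≤ j ∧ j ≤ N - 1)) : pa N j = 0 := dif_neg h

theorem pb_eq_zero {j : ℕ} (h : ¬ (1 ≤ j ∧ j ≤ N)) : pb N j = 0 := dif_neg h

theorem pb_ne_zero {j : ℕ} (h : 1 ≤ j ∧ j ≤ N) : pb N j ≠ 0 := by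
  rw [pb, dif_pos h]; exact MvPolynomial.X_ne_zero _

/-- The biderivation with prescribed brackets `{a_i, a_j}`, `{a_i, b_j}`, `{b_i, b_j}`. -/
def biderOfTable (aa ab bb : ℕ → ℕ → Pol N) : Bider (Pol N) :=
  biderOf fun k l => match k, l with
    | Sum.inl i, Sum.inl j => aa (i + 1) (j + 1) - aa (j + 1) (i + 1)
    | Sum.inl i, Sum.inr j => ab (i + 1) (j + 1)
    | Sum.inr i, Sum.inl j => - ab (j + 1) (i + 1)
    | Sum.inr i, Sum.inr j => bb (i + 1) (j + 1) - bb (j + 1) (i + 1)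

theorem biderOfTable_skew (aa ab bb : ℕ → ℕ → Pol N) : (biderOfTable aa ab bb).Skew :=
  skew_of_X fun i j => by
    rcases i with i | i <;> rcases j with j | j <;> simp [biderOfTable]

theorem tensorOf_biderOfTable (aa ab bb : ℕ → ℕ → Pol N) :
    tensorOf (biderOfTable aa ab bb)
      = ofTable (fun x i j => fn (aa i j) x) (fun x i j => fn (ab i j) x)
        (fun x i j => fn (bb i j) x) := by
  ext x i j
  rcases i with i | i <;> rcases j with j | j <;>
    simp [biderOfTable, tensorOf, ofTable, fn, Matrix.transpose_apply]

variable {aa ab bb : ℕ → ℕ → Pol N}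

/-- The hypotheses say that table entries die when an index leaves its range. The table formula then
holds for all natural indices, and the boundary conventions need no separate cases later. -/
theorem biderOfTable_aa (h1 : ∀ i j, pa N i = 0 → aa i j = 0) (h2 : ∀ i j, pa N j = 0 → aa i j = 0)
    (i j : ℕ) : biderOfTable aa ab bb (pa N i) (pa N j) = aa i j - aa j i := by
  by_cases hi : 1 ≤ i ∧ i ≤ N - 1
  · by_cases hj : 1 ≤ j ∧ j ≤ N - 1
    · conv_lhs => rw [pa, pa, dif_pos hi, dif_pos hj]
      simp [biderOfTable, Nat.sub_add_cancel hi.1, Nat.sub_add_cancel hj.1]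
    · rw [h1 j i (pa_eq_zero hj), h2 i j (pa_eq_zero hj), pa_eq_zero hj]; simp
  · rw [h2 j i (pa_eq_zero hi), h1 i j (pa_eq_zero hi), pa_eq_zero hi]; simp

theorem biderOfTable_ab (h1 : ∀ i j, pa N i = 0 → ab i j = 0) (h2 : ∀ i j, pb N j = 0 → ab i j = 0)
    (i j : ℕ) : biderOfTable aa ab bb (pa N i) (pb N j) = ab i j := by
  by_cases hi : 1 ≤ i ∧ i ≤ N - 1
  · by_cases hj : 1 ≤ j ∧ j ≤ N
    · conv_lhs => rw [pa, pb, dif_pos hi, dif_pos hj]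
      simp [biderOfTable, Nat.sub_add_cancel hi.1, Nat.sub_add_cancel hj.1]
    · rw [h2 i j (pb_eq_zero hj), pb_eq_zero hj]; simp
  · rw [h1 i j (pa_eq_zero hi), pa_eq_zero hi]; simp

theorem biderOfTable_bb (h1 : ∀ i j, pb N i = 0 → bb i j = 0) (h2 : ∀ i j, pb N j = 0 → bb i j = 0)
    (i j : ℕ) : biderOfTable aa ab bb (pb N i) (pb N j) = bb i j - bb j i := by
  by_cases hi : 1 ≤ i ∧ i ≤ N
  · by_cases hj : 1 ≤ j ∧ j ≤ N
    · conv_lhs => rw [pb, pb, dif_pos hi, dif_pos hj]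
      simp [biderOfTable, Nat.sub_add_cancel hi.1, Nat.sub_add_cancel hj.1]
    · rw [h1 j i (pb_eq_zero hj), h2 i j (pb_eq_zero hj), pb_eq_zero hj]; simp
  · rw [h2 j i (pb_eq_zero hi), h1 i j (pb_eq_zero hi), pb_eq_zero hi]; simp

/-- The linear bracket on polynomials. -/
def B1 (N : ℕ) : Bider (Pol N) :=
  biderOfTable (fun _ _ => 0)
    (fun i j => if j = i then - pa N i else if j = i + 1 then pa N i else 0)
    (fun i j => if j = i + 1 then - pa N i else 0)

/-- The quadratic bracket on polynomials. -/
def B2 (N : ℕ) : Bider (Pol N) :=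
  biderOfTable (fun i j => if j = i + 1 then pa N i * pa N (i + 1) else 0)
    (fun i j => if j = i then - (pa N i * pb N i)
      else if j = i + 1 then pa N i * pb N (i + 1) else 0)
    (fun _ _ => 0)

/-- The cubic bracket on polynomials. -/
def B3 (N : ℕ) : Bider (Pol N) :=
  biderOfTable
    (fun i j =>
      if j = i + 1 then pa N i ^ 2 * pa N (i + 1) + pa N i * pa N (i + 1) ^ 2
          + 2 * pa N i * pa N (i + 1) * pb N (i + 1)
      else if j = i + 2 then pa N i * pa N (i + 1) * pa N (i + 2)
      else 0)
    (fun i j =>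
      if j = i then - (pa N i * pb N i * (pa N i + pb N i))
      else if j = i + 1 then pa N i * pb N (i + 1) * (pa N i + pb N (i + 1))
      else if j = i + 2 then pa N i * pa N (i + 1) * pb N (i + 2)
      else if i = j + 1 then - (pa N j * pa N (j + 1) * pb N j)
      else 0)
    (fun i j => if j = i + 1 then pa N i * pb N i * pb N (i + 1) else 0)

theorem B1_skew : (B1 N).Skew := biderOfTable_skew _ _ _
theorem B2_skew : (B2 N).Skew := biderOfTable_skew _ _ _
theorem B3_skew : (B3 N).Skew := biderOfTable_skew _ _ _

theorem tensorOf_B1 : tensorOf (B1 N) = pi1 N := by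
  rw [B1, tensorOf_biderOfTable, pi1]
  congr 1 <;> (funext x i j; split_ifs <;> simp [fn, ← fn_pa])

theorem tensorOf_B2 : tensorOf (B2 N) = pi2 N := by
  rw [B2, tensorOf_biderOfTable, pi2]
  congr 1 <;> (funext x i j; split_ifs <;> simp [fn, ← fn_pa, ← fn_pb])

theorem tensorOf_B3 : tensorOf (B3 N) = pi3 N := by
  rw [B3, tensorOf_biderOfTable, pi3]
  congr 1 <;> (funext x i j; split_ifs <;> simp [fn, ← fn_pa, ← fn_pb])

/-- The entries `±a_i` of the linear bracket contain no factor `b_j`; they still vanish when `b_i`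
or `b_{i+1}` is out of range, since then `a_i` is too. -/
theorem pa_eq_zero_of_pb {i j : ℕ} (hij : j = i ∨ j = i + 1) (h : pb N j = 0) : pa N i = 0 := by
  refine pa_eq_zero fun hi => pb_ne_zero ⟨?_, ?_⟩ h <;> omega

theorem B1_aa (i j : ℕ) : B1 N (pa N i) (pa N j) = 0 := by
  rw [B1, biderOfTable_aa] <;> simp

theorem B1_ab (i j : ℕ) : B1 N (pa N i) (pb N j) =
    if j = i then - pa N i else if j = i + 1 then pa N i else 0 := by
  rw [B1, biderOfTable_ab]
  · intro i j h; simp [h]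
  · intro i j h
    split_ifs with h1 h2
    · rw [pa_eq_zero_of_pb (.inl h1) h, neg_zero]
    · exact pa_eq_zero_of_pb (.inr h2) h
    · rfl

theorem B1_bb (i j : ℕ) : B1 N (pb N i) (pb N j) =
    if j = i + 1 then - pa N i else if i = j + 1 then pa N j else 0 := by
  rw [B1, biderOfTable_bb]
  · split_ifs <;> first | omega | simp
  · intro i j h
    rw [pa_eq_zero_of_pb (.inl rfl) h]; simp
  · intro i j h
    split_ifs with h1
    · rw [pa_eq_zero_of_pb (.inr h1) h, neg_zero]
    · rfl

theorem B2_aa (i j : ℕ) : B2 N (pa N i) (pa N j) =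
    if j = i + 1 then pa N i * pa N j else if i = j + 1 then - (pa N j * pa N i) else 0 := by
  rw [B2, biderOfTable_aa]
  · split_ifs <;> first | omega | simp [*]
  · intro i j h; simp [h]
  · intro i j h; split_ifs with h1 <;> first | (subst h1; simp [h]) | rfl

theorem B2_ab (i j : ℕ) : B2 N (pa N i) (pb N j) =
    if j = i then - (pa N i * pb N i) else if j = i + 1 then pa N i * pb N (i + 1) else 0 := by
  rw [B2, biderOfTable_ab]
  · intro i j h; simp [h]
  · intro i j h; split_ifs with h1 h1 <;> first | (subst h1; simp [h]) | rfl

theorem B2_bb (i j : ℕ) : B2 N (pb N i) (pb N j) = 0 := by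
  rw [B2, biderOfTable_bb] <;> simp

theorem B3_aa (i j : ℕ) : B3 N (pa N i) (pa N j) =
    if j = i + 1 then pa N i ^ 2 * pa N (i + 1) + pa N i * pa N (i + 1) ^ 2
          + 2 * pa N i * pa N (i + 1) * pb N (i + 1)
    else if j = i + 2 then pa N i * pa N (i + 1) * pa N (i + 2)
    else if i = j + 1 then -(pa N j ^ 2 * pa N (j + 1) + pa N j * pa N (j + 1) ^ 2
          + 2 * pa N j * pa N (j + 1) * pb N (j + 1))
    else if i = j + 2 then -(pa N j * pa N (j + 1) * pa N (j + 2))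
    else 0 := by
  rw [B3, biderOfTable_aa]
  · split_ifs <;> first | omega | simp
  · intro i j h; simp [h]
  · intro i j h; split_ifs with h1 h1 <;> first | (subst h1; simp [h]) | rfl

theorem B3_ab (i j : ℕ) : B3 N (pa N i) (pb N j) =
    if j = i then - (pa N i * pb N i * (pa N i + pb N i))
    else if j = i + 1 then pa N i * pb N (i + 1) * (pa N i + pb N (i + 1))
    else if j = i + 2 then pa N i * pa N (i + 1) * pb N (i + 2)
    else if i = j + 1 then - (pa N j * pa N (j + 1) * pb N j)
    else 0 := by
  rw [B3, biderOfTable_ab]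
  · intro i j h; split_ifs with h1 h1 h1 h1 <;> first | (subst h1; simp [h]) | rfl
  · intro i j h; split_ifs with h1 h1 h1 h1 <;> first | (subst h1; simp [h]) | rfl

theorem B3_bb (i j : ℕ) : B3 N (pb N i) (pb N j) =
    if j = i + 1 then pa N i * pb N i * pb N (i + 1)
    else if i = j + 1 then - (pa N j * pb N j * pb N (j + 1)) else 0 := by
  rw [B3, biderOfTable_bb]
  · split_ifs <;> first | omega | simp
  · intro i j h; simp [h]
  · intro i j h; split_ifs with h1 <;> first | (subst h1; simp [h]) | rfl

end Tables

/-! ### The first master symmetry on the coordinates -/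

section X1
variable {N : ℕ}

/-- The vector field `X_1` as a derivation of polynomials. -/
def D1 (N : ℕ) : Derivation ℝ (Pol N) (Pol N) :=
  MvPolynomial.mkDerivation ℝ fun k => match k with
    | Sum.inl i => pa N (i + 1) * (pa N (i + 1) + ((i : ℕ) + 3 : Pol N) * pb N (i + 2)
        - ((i : ℕ) : Pol N) * pb N (i + 1) + ((i : ℕ) + 3 : Pol N) * pa N (i + 2)
        - ((i : ℕ) : Pol N) * pa N i)
    | Sum.inr i => pb N (i + 1) * (pb N (i + 1) + ((i : ℕ) + 2 : Pol N) * pa N (i + 1)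
        - ((i : ℕ) : Pol N) * pa N i)

theorem D1_pa (i : ℕ) : D1 N (pa N (i + 1)) = pa N (i + 1) * (pa N (i + 1)
      + ((i : ℕ) + 3 : Pol N) * pb N (i + 2) - ((i : ℕ) : Pol N) * pb N (i + 1)
      + ((i : ℕ) + 3 : Pol N) * pa N (i + 2) - ((i : ℕ) : Pol N) * pa N i) := by
  by_cases h : 1 ≤ i + 1 ∧ i + 1 ≤ N - 1
  · conv_lhs => rw [pa, dif_pos h]
    simp [D1]
  · rw [pa_eq_zero h]; simp

theorem D1_pb (i : ℕ) : D1 N (pb N (i + 1)) = pb N (i + 1) * (pb N (i + 1)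
      + ((i : ℕ) + 2 : Pol N) * pa N (i + 1) - ((i : ℕ) : Pol N) * pa N i) := by
  by_cases h : 1 ≤ i + 1 ∧ i + 1 ≤ N
  · conv_lhs => rw [pb, dif_pos h]
    simp [D1]
  · rw [pb_eq_zero h]; simp

theorem vfOf_D1 : vfOf (D1 N) = X1 N := by
  ext x k
  rcases k with i | i
  · rw [vfOf, X_inl, D1_pa]
    simp only [X1, mkVec, Sum.elim_inl, Nat.add_sub_cancel, ← fn_pa, ← fn_pb, fn]
    simp; ring
  · rw [vfOf, X_inr, D1_pb]
    simp only [X1, mkVec, Sum.elim_inr, Nat.add_sub_cancel, ← fn_pa, ← fn_pb, fn]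
    simp; ring

/-- The cubic bracket couples coordinates at index distance at most 2 and X₁ adds at most 1, so at
distance 4 or more every term of the Lie derivatives is zero. Seven offsets remain to be computed.
-/
theorem offset_cases (i j : ℕ) : (∃ d, j = i + (d + 4)) ∨ (∃ d, i = j + (d + 4)) ∨ j = i ∨ j = i + 1
    ∨ j = i + 2 ∨ j = i + 3 ∨ i = j + 1 ∨ i = j + 2 ∨ i = j + 3 := by
  by_cases h : i + 4 ≤ j
  · exact .inl ⟨j - (i + 4), by omega⟩
  by_cases h' : j + 4 ≤ i
  · exact .inr (.inl ⟨i - (j + 4), by omega⟩)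
  omega

/-- Two biderivations agree if they agree on the coordinates `a_i`, `b_i`. -/
theorem bider_ext_coord {B B' : Bider (Pol N)} (hB : B.Skew) (hB' : B'.Skew)
    (haa : ∀ i j, B (pa N (i + 1)) (pa N (j + 1)) = B' (pa N (i + 1)) (pa N (j + 1)))
    (hab : ∀ i j, B (pa N (i + 1)) (pb N (j + 1)) = B' (pa N (i + 1)) (pb N (j + 1)))
    (hbb : ∀ i j, B (pb N (i + 1)) (pb N (j + 1)) = B' (pb N (i + 1)) (pb N (j + 1))) :
    B = B' := by
  refine bider_ext fun i j => ?_
  rcases i with i | i <;> rcases j with j | j <;> simp only [X_inl, X_inr]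
  · exact haa _ _
  · exact hab _ _
  · rw [hB, hB', hab]
  · exact hbb _ _

theorem skew_neg {B : Bider (Pol N)} (hB : B.Skew) : (-B).Skew := fun f g => by
  simp [hB f g]

theorem skew_add {B B' : Bider (Pol N)} (hB : B.Skew) (hB' : B'.Skew) : (B + B').Skew :=
  fun f g => by
    simp [hB f g, hB' f g]; ring

theorem der_ofNat (v : Derivation ℝ (Pol N) (Pol N)) (n : ℕ) [n.AtLeastTwo] :
    v (ofNat(n)) = 0 := by
  rw [← Nat.cast_ofNat, Derivation.map_natCast]

theorem bider_ofNat (B : Bider (Pol N)) (n : ℕ) [n.AtLeastTwo] : B (ofNat(n)) = 0 := by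
  rw [← Nat.cast_ofNat, Derivation.map_natCast]

/-- The index is written `i + (d + 5)` because that is the normal form into which `Nat.add_assoc`
brings the far cases of `offset_cases`. -/
theorem D1_pa_far (i d : ℕ) : D1 N (pa N (i + (d + 5))) = pa N (i + (d + 5)) * (pa N (i + (d + 5))
      + ((i + d : ℕ) + 7 : Pol N) * pb N (i + (d + 6)) - ((i + d : ℕ) + 4 : Pol N) * pb N (i + (d + 5))
      + ((i + d : ℕ) + 7 : Pol N) * pa N (i + (d + 6))
      - ((i + d : ℕ) + 4 : Pol N) * pa N (i + (d + 4))) := by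
  have := D1_pa (N := N) (i + (d + 4))
  simp only [Nat.add_assoc, Nat.reduceAdd] at this
  rw [this]; push_cast; ring

theorem D1_pb_far (i d : ℕ) : D1 N (pb N (i + (d + 5))) = pb N (i + (d + 5)) * (pb N (i + (d + 5))
      + ((i + d : ℕ) + 6 : Pol N) * pa N (i + (d + 5))
      - ((i + d : ℕ) + 4 : Pol N) * pa N (i + (d + 4))) := by
  have := D1_pb (N := N) (i + (d + 4))
  simp only [Nat.add_assoc, Nat.reduceAdd] at this
  rw [this]; push_cast; ring

theorem B1_ba (i j : ℕ) : B1 N (pb N j) (pa N i) =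
    if j = i then pa N i else if j = i + 1 then - pa N i else 0 := by
  rw [B1_skew, B1_ab]; split_ifs <;> simp

theorem B2_ba (i j : ℕ) : B2 N (pb N j) (pa N i) =
    if j = i then pa N i * pb N i else if j = i + 1 then - (pa N i * pb N (i + 1)) else 0 := by
  rw [B2_skew, B2_ab]; split_ifs <;> simp

theorem B3_ba (i j : ℕ) : B3 N (pb N j) (pa N i) =
    if j = i then pa N i * pb N i * (pa N i + pb N i)
    else if j = i + 1 then -(pa N i * pb N (i + 1) * (pa N i + pb N (i + 1)))
    else if j = i + 2 then -(pa N i * pa N (i + 1) * pb N (i + 2))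
    else if i = j + 1 then pa N j * pa N (j + 1) * pb N j
    else 0 := by
  rw [B3_skew, B3_ab]; split_ifs <;> simp

-- A finite check by index offset. This identity and the next two form the chain π₁ → π₂ → π₃ → 0
-- along X₁, from which all compatibility statements are derived.
set_option maxHeartbeats 4000000 in
theorem lieB_D1_B1 : lieB (D1 N) (B1 N) = - (B2 N + B2 N) := by
  refine bider_ext_coord (B1_skew.lieB _) (skew_neg (skew_add B2_skew B2_skew)) ?_ ?_ ?_ <;> intro i j
  · rcases offset_cases i j with ⟨d, rfl⟩ | ⟨d, rfl⟩ | rfl | rfl | rfl | rfl | rfl | rfl | rfl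
    all_goals
      simp [lieB_apply, D1_pa, D1_pa_far, B1_aa, B1_ab, B1_ba, B2_aa, Derivation.leibniz, der_ofNat, bider_ofNat, Nat.add_assoc]
      try ring
  · rcases offset_cases i j with ⟨d, rfl⟩ | ⟨d, rfl⟩ | rfl | rfl | rfl | rfl | rfl | rfl | rfl
    all_goals
      simp [lieB_apply, D1_pa, D1_pb, D1_pa_far, D1_pb_far, B1_aa, B1_ab, B1_bb,
        B2_ab, Derivation.leibniz, der_ofNat, bider_ofNat, Nat.add_assoc]
      try ring
  · rcases offset_cases i j with ⟨d, rfl⟩ | ⟨d, rfl⟩ | rfl | rfl | rfl | rfl | rfl | rfl | rfl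
    all_goals
      simp [lieB_apply, D1_pa, D1_pb, D1_pb_far, B1_ab, B1_ba, B1_bb,
        B2_bb, Derivation.leibniz, der_ofNat, bider_ofNat, Nat.add_assoc]
      try ring

set_option maxHeartbeats 4000000 in
theorem lieB_D1_B2 : lieB (D1 N) (B2 N) = - B3 N := by
  refine bider_ext_coord (B2_skew.lieB _) (skew_neg B3_skew) ?_ ?_ ?_ <;> intro i j
  · rcases offset_cases i j with ⟨d, rfl⟩ | ⟨d, rfl⟩ | rfl | rfl | rfl | rfl | rfl | rfl | rfl
    all_goals
      simp [lieB_apply, D1_pa, D1_pa_far, B2_aa, B2_ab, B2_ba, B3_aa, Derivation.leibniz, der_ofNat, bider_ofNat, Nat.add_assoc]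
      try ring
  · rcases offset_cases i j with ⟨d, rfl⟩ | ⟨d, rfl⟩ | rfl | rfl | rfl | rfl | rfl | rfl | rfl
    all_goals
      simp [lieB_apply, D1_pa, D1_pb, D1_pa_far, D1_pb_far, B2_aa, B2_ab, B2_bb,
        B3_ab, Derivation.leibniz, der_ofNat, bider_ofNat, Nat.add_assoc]
      try ring
  · rcases offset_cases i j with ⟨d, rfl⟩ | ⟨d, rfl⟩ | rfl | rfl | rfl | rfl | rfl | rfl | rfl
    all_goals
      simp [lieB_apply, D1_pb, D1_pb_far, B2_ab, B2_ba, B2_bb,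
        B3_bb, Derivation.leibniz, der_ofNat, bider_ofNat, Nat.add_assoc]
      try ring

set_option maxHeartbeats 4000000 in
theorem lieB_D1_B3 : lieB (D1 N) (B3 N) = 0 := by
  refine bider_ext_coord (B3_skew.lieB _) (fun f g => by simp) ?_ ?_ ?_ <;> intro i j
  · rcases offset_cases i j with ⟨d, rfl⟩ | ⟨d, rfl⟩ | rfl | rfl | rfl | rfl | rfl | rfl | rfl
    all_goals
      simp [lieB_apply, D1_pa, D1_pb, D1_pa_far, B3_aa, B3_ab, B3_ba, Derivation.leibniz, der_ofNat, bider_ofNat, Nat.add_assoc]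
      try ring
  · rcases offset_cases i j with ⟨d, rfl⟩ | ⟨d, rfl⟩ | rfl | rfl | rfl | rfl | rfl | rfl | rfl
    all_goals
      simp [lieB_apply, D1_pa, D1_pb, D1_pa_far, D1_pb_far, B3_aa, B3_ab, B3_bb,
        Derivation.leibniz, der_ofNat, bider_ofNat, Nat.add_assoc]
      try ring
  · rcases offset_cases i j with ⟨d, rfl⟩ | ⟨d, rfl⟩ | rfl | rfl | rfl | rfl | rfl | rfl | rfl
    all_goals
      simp [lieB_apply, D1_pa, D1_pb, D1_pb_far, B3_ab, B3_ba, B3_bb,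
        Derivation.leibniz, der_ofNat, bider_ofNat, Nat.add_assoc]
      try ring

end X1

/-! ### Vanishing Schouten brackets of the three tensors -/

section Separating
variable {R : Type} [CommRing R] [Algebra ℝ R]

/-- A set of elements such that a derivation killing all of them is zero. -/
def Separating (S : Set R) : Prop :=
  ∀ D : Derivation ℝ R R, (∀ s ∈ S, D s = 0) → D = 0

/-- The Schouten bracket is a derivation in its last argument, and skew-symmetry transports this to
the other two; so it is enough to test on a separating set in all three slots. -/
theorem schouten_of_separating {S : Set R} (hS : Separating S) {B B' : Bider R} (hB : B.Skew)
    (hB' : B'.Skew) (h : ∀ f ∈ S, ∀ g ∈ S, ∀ k ∈ S, schouten B B' f g k = 0) (f g k : R) :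
    schouten B B' f g k = 0 := by
  have e : ∀ {f g}, (∀ s ∈ S, schouten B B' f g s = 0) → ∀ k, schouten B B' f g k = 0 := by
    intro f g h k
    have := hS (schoutenDer B B' f g) fun s hs => by rw [schoutenDer_apply, h s hs]
    rw [← schoutenDer_apply, this]; rfl
  have h1 : ∀ f ∈ S, ∀ g ∈ S, ∀ k, schouten B B' f g k = 0 := fun f hf g hg => e (h f hf g hg)
  have h2 : ∀ f ∈ S, ∀ k g, schouten B B' f k g = 0 := fun f hf k => e fun s hs => by
    rw [schouten_swap_right hB hB', h1 f hf s hs, neg_zero]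
  refine e (fun s hs => ?_) k
  rw [schouten_swap_right hB hB', schouten_swap_left hB hB', h2 s hs]; simp

theorem schouten_self_of_jacobi_at {B : Bider R} {f g h : R}
    (hJ : B f (B g h) = B (B f g) h + B g (B f h)) : schouten B B f g h = 0 := by
  simp only [schouten, hJ]; ring

/-- Log-canonical biderivations satisfy the Jacobi identity. -/
theorem schouten_logCanonical {B : Bider R} (hB : B.Skew) {S : Set R} (hS : Separating S)
    (h : ∀ f ∈ S, ∀ g ∈ S, ∃ c : ℝ, B f g = c • (f * g)) (f g k : R) :
    schouten B B f g k = 0 := by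
  refine schouten_of_separating hS hB hB (fun f hf g hg k hk => ?_) f g k
  obtain ⟨c, hc⟩ := h f hf g hg
  obtain ⟨d, hd⟩ := h f hf k hk
  obtain ⟨e, he⟩ := h g hg k hk
  have hc' : B g f = - (c • (f * g)) := by rw [hB, hc]
  refine schouten_self_of_jacobi_at ?_
  rw [he, hd, hc]
  simp only [Derivation.map_smul, Derivation.coe_smul, Pi.smul_apply, bider_mul_left,
    bider_mul_right, hc, hd, he, hc']
  simp only [Algebra.smul_def]
  ring

end Separating

section Tables
variable {N : ℕ}

theorem separating_X : Separating (Set.range (MvPolynomial.X : Idx N → Pol N)) := fun _ h =>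
  MvPolynomial.derivation_ext fun i => h _ ⟨i, rfl⟩

theorem separating_coord {D : Derivation ℝ (Pol N) (Pol N)} (ha : ∀ i, D (pa N i) = 0)
    (hb : ∀ i, D (pb N i) = 0) : D = 0 := by
  refine MvPolynomial.derivation_ext fun i => ?_
  rcases i with i | i
  · rw [X_inl, ha]; rfl
  · rw [X_inr, hb]; rfl

theorem schouten_B2_B2 (f g h : Pol N) : schouten (B2 N) (B2 N) f g h = 0 := by
  refine schouten_logCanonical B2_skew separating_X ?_ f g h
  rintro _ ⟨i, rfl⟩ _ ⟨j, rfl⟩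
  rcases i with i | i <;> rcases j with j | j <;>
    simp only [X_inl, X_inr, B2_aa, B2_ab, B2_ba, B2_bb]
  · split_ifs
    · exact ⟨1, by simp⟩
    · exact ⟨-1, by simp [mul_comm]⟩
    · exact ⟨0, by simp⟩
  · split_ifs with h1 h2
    · exact ⟨-1, by simp [h1]⟩
    · exact ⟨1, by simp [h2]⟩
    · exact ⟨0, by simp⟩
  · split_ifs with h1 h2
    · exact ⟨1, by simp [h1, mul_comm]⟩
    · exact ⟨-1, by simp [h2, mul_comm]⟩
    · exact ⟨0, by simp⟩
  · exact ⟨0, by simp⟩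

/-- In the coordinates a_i and c_i = a_i + b_i the bracket is Lie–Poisson: the a_i commute, the c_i
commute, and each {a_i, c_j} is a constant multiple of a_i. This is an abelian Lie algebra acting
diagonally on an abelian ideal. -/
theorem schouten_B1_B1 (f g h : Pol N) : schouten (B1 N) (B1 N) f g h = 0 := by
  let S : Set (Pol N) := Set.range (pa N) ∪ Set.range fun i => pa N i + pb N i
  have hS : Separating S := fun D hD => by
    have ha : ∀ i, D (pa N i) = 0 := fun i => hD _ (.inl ⟨i, rfl⟩)
    refine separating_coord ha fun i => ?_
    simpa [ha] using hD _ (.inr ⟨i, rfl⟩)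
  have hab : ∀ i j, ∃ c : ℝ, B1 N (pa N i) (pa N j + pb N j) = c • pa N i := by
    intro i j
    rw [map_add, B1_aa, B1_ab]
    split_ifs
    · exact ⟨-1, by simp⟩
    · exact ⟨1, by simp⟩
    · exact ⟨0, by simp⟩
  have hba : ∀ i j, ∃ c : ℝ, B1 N (pa N j + pb N j) (pa N i) = c • pa N i := by
    intro i j
    obtain ⟨c, hc⟩ := hab i j
    exact ⟨-c, by rw [B1_skew, hc, neg_smul]⟩
  have hbb : ∀ i j, B1 N (pa N i + pb N i) (pa N j + pb N j) = 0 := by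
    intro i j
    simp only [map_add, Derivation.add_apply, B1_aa, B1_ab, B1_ba, B1_bb]
    split_ifs <;> first | omega | (subst_vars; simp)
  refine schouten_of_separating hS B1_skew B1_skew ?_ f g h
  rintro _ (⟨i, rfl⟩ | ⟨i, rfl⟩) _ (⟨j, rfl⟩ | ⟨j, rfl⟩) _ (⟨k, rfl⟩ | ⟨k, rfl⟩) <;>
    refine schouten_self_of_jacobi_at ?_ <;> simp only [B1_aa, hbb, map_zero, Derivation.zero_apply, add_zero]
  · obtain ⟨c, hc⟩ := hab i k
    obtain ⟨d, hd⟩ := hab j k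
    rw [hc, hd]; simp [B1_aa]
  · obtain ⟨c, hc⟩ := hab i j
    obtain ⟨d, hd⟩ := hba k j
    rw [hc, hd]; simp [B1_aa]
  · obtain ⟨c, hc⟩ := hab i j
    obtain ⟨d, hd⟩ := hab i k
    have hc' : B1 N (pa N j + pb N j) (pa N i) = - (c • pa N i) := by rw [B1_skew, hc]
    simp only [hc, hd, hc', Derivation.map_smul, Derivation.coe_smul, Pi.smul_apply]
    module
  · obtain ⟨c, hc⟩ := hba j i
    obtain ⟨d, hd⟩ := hba k i
    rw [hc, hd]; simp [B1_aa]
  · obtain ⟨c, hc⟩ := hba j i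
    obtain ⟨d, hd⟩ := hab j k
    simp only [hc, hd, Derivation.map_smul, Derivation.coe_smul, Pi.smul_apply, smul_smul, mul_comm]
  · obtain ⟨c, hc⟩ := hba k i
    obtain ⟨d, hd⟩ := hba k j
    simp only [hc, hd, Derivation.map_smul, smul_smul, mul_comm,
      zero_add]

theorem lieB_D1_B1' : lieB (D1 N) (B1 N) = (-2 : ℝ) • B2 N := by
  rw [lieB_D1_B1]; ext f g; simp [Algebra.smul_def]; ring

theorem lieB_D1_B2' : lieB (D1 N) (B2 N) = (-1 : ℝ) • B3 N := by
  rw [lieB_D1_B2]; ext f g; simp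

/-- Lie derivative of [π₁,π₁] = 0 along X₁: both terms equal -2[π₁,π₂]. -/
theorem schouten_B1_B2 (f g h : Pol N) : schouten (B1 N) (B2 N) f g h = 0 := by
  have := schouten_lieB_of_eq_zero schouten_B1_B1 (D1 N) f g h
  rw [lieB_D1_B1', schouten_smul_left, schouten_smul_right, schouten_comm (B2 N), ← add_smul] at this
  exact (smul_eq_zero_iff_right (by norm_num)).mp this

theorem schouten_B1_B3 (f g h : Pol N) : schouten (B1 N) (B3 N) f g h = 0 := by
  have := schouten_lieB_of_eq_zero schouten_B1_B2 (D1 N) f g h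
  rw [lieB_D1_B1', lieB_D1_B2', schouten_smul_left, schouten_smul_right, schouten_B2_B2, smul_zero,
    zero_add] at this
  exact (smul_eq_zero_iff_right (by norm_num)).mp this

theorem schouten_B2_B3 (f g h : Pol N) : schouten (B2 N) (B3 N) f g h = 0 := by
  have := schouten_lieB_of_eq_zero schouten_B2_B2 (D1 N) f g h
  rw [lieB_D1_B2', schouten_smul_left, schouten_smul_right, schouten_comm (B3 N), ← add_smul] at this
  exact (smul_eq_zero_iff_right (by norm_num)).mp this

theorem schouten_zero_right (B : Bider (Pol N)) (f g h : Pol N) : schouten B 0 f g h = 0 := by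
  simp [schouten]

/-- Lie derivative of [π₂,π₃] = 0; because π₃ is invariant under X₁, only -[π₃,π₃] survives. -/
theorem schouten_B3_B3 (f g h : Pol N) : schouten (B3 N) (B3 N) f g h = 0 := by
  have := schouten_lieB_of_eq_zero schouten_B2_B3 (D1 N) f g h
  rw [lieB_D1_B2', lieB_D1_B3, schouten_zero_right, add_zero, schouten_smul_left] at this
  exact (smul_eq_zero_iff_right (by norm_num)).mp this

theorem compatible_tensorOf {B B' : Bider (Pol N)} (hB : B.Skew) (hB' : B'.Skew)
    (h1 : ∀ f g h, schouten B B f g h = 0) (h2 : ∀ f g h, schouten B' B' f g h = 0)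
    (h3 : ∀ f g h, schouten B B' f g h = 0) : Compatible (tensorOf B) (tensorOf B') := by
  refine ⟨isPoisson_tensorOf hB h1, isPoisson_tensorOf hB' h2, ?_⟩
  rw [← tensorOf_add]
  refine isPoisson_tensorOf (skew_add hB hB') fun f g h => ?_
  rw [schouten_add_add, h1, h2, h3]; simp

theorem compatible_pi1_pi2 : Compatible (pi1 N) (pi2 N) := by
  rw [← tensorOf_B1, ← tensorOf_B2]
  exact compatible_tensorOf B1_skew B2_skew schouten_B1_B1 schouten_B2_B2 schouten_B1_B2

theorem compatible_pi1_pi3 : Compatible (pi1 N) (pi3 N) := by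
  rw [← tensorOf_B1, ← tensorOf_B3]
  exact compatible_tensorOf B1_skew B3_skew schouten_B1_B1 schouten_B3_B3 schouten_B1_B3

theorem compatible_pi2_pi3 : Compatible (pi2 N) (pi3 N) := by
  rw [← tensorOf_B2, ← tensorOf_B3]
  exact compatible_tensorOf B2_skew B3_skew schouten_B2_B2 schouten_B3_B3 schouten_B2_B3

theorem lieDeriv_X1_pi2 : lieDeriv (X1 N) (pi2 N) = - pi3 N := by
  rw [← vfOf_D1, ← tensorOf_B2, ← tensorOf_B3, lieDeriv_tensorOf, lieB_D1_B2, tensorOf_neg]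

theorem lieDeriv_X1_pi3 : lieDeriv (X1 N) (pi3 N) = 0 := by
  rw [← vfOf_D1, ← tensorOf_B3, lieDeriv_tensorOf, lieB_D1_B3, tensorOf_zero]

end Tables

/-! ### Coefficientwise derivations and the derivative of a determinant -/

section Formal
open Polynomial
variable {R : Type} [CommRing R] [Algebra ℝ R]

/-- A derivation acting on the coefficients of polynomials. -/
def extP (D : Derivation ℝ R R) : Derivation ℝ R[X] R[X] :=
  Derivation.mk'
    ((PolynomialModule.equivPolynomialSelf : PolynomialModule R R ≃ₗ[R[X]] R[X]).toLinearMap.restrictScalars ℝ ∘ₗ D.mapCoeffs.toLinearMap)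
    fun F G => by
      change PolynomialModule.equivPolynomialSelf (D.mapCoeffs (F * G)) = _
      rw [Derivation.leibniz, map_add, map_smul, map_smul]
      rfl

@[simp] theorem coeff_extP (D : Derivation ℝ R R) (F : R[X]) (n : ℕ) :
    (extP D F).coeff n = D (F.coeff n) := rfl

@[simp] theorem extP_C (D : Derivation ℝ R R) (r : R) : extP D (C r) = C (D r) := by
  ext n; simp [coeff_C]; split_ifs <;> simp

@[simp] theorem extP_X (D : Derivation ℝ R R) : extP D (X : R[X]) = 0 := by
  ext n; simp [coeff_X]; split_ifs <;> simp

theorem extP_derivative (D : Derivation ℝ R R) (F : R[X]) :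
    extP D (derivative F) = derivative (extP D F) := by
  ext n
  simp only [coeff_extP, coeff_derivative, Derivation.leibniz, smul_eq_mul]
  have : D ((n : R) + 1) = 0 := by simp
  rw [this]; ring

theorem eval_extP (D : Derivation ℝ R R) (F : R[X]) (s : ℝ) :
    (extP D F).eval (algebraMap ℝ R s) = D (F.eval (algebraMap ℝ R s)) := by
  induction F using Polynomial.induction_on' with
  | add F G hF hG => simp [hF, hG]
  | monomial n r =>
    have : extP D (monomial n r) = monomial n (D r) := by
      ext k; simp [coeff_monomial]; split_ifs <;> simp
    rw [this, eval_monomial, eval_monomial, ← map_pow, Derivation.leibniz]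
    simp [mul_comm]

/-- Two-parameter identities are proved at generic real parameter values, where divisions by s, t or
t - s are legitimate; this lemma turns them into formal identities. The finite set `S` collects the
excluded values. -/
theorem polynomial_ext_real [IsDomain R] {F G : R[X]} (S : Finset ℝ)
    (h : ∀ s ∉ S, F.eval (algebraMap ℝ R s) = G.eval (algebraMap ℝ R s)) : F = G := by
  refine Polynomial.eq_of_infinite_eval_eq F G ?_
  have h1 : (algebraMap ℝ R '' (↑S : Set ℝ)ᶜ).Infinite :=
    Set.Infinite.image (FaithfulSMul.algebraMap_injective ℝ R).injOn S.finite_toSet.infinite_compl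
  refine h1.mono ?_
  rintro _ ⟨s, hs, rfl⟩
  exact h s (by simpa using hs)

/-- A derivation acting on the coefficients of power series. -/
def extPS (D : Derivation ℝ R R) : Derivation ℝ (PowerSeries R) (PowerSeries R) :=
  Derivation.mk'
    { toFun := fun F => PowerSeries.mk fun n => D (PowerSeries.coeff n F)
      map_add' := fun F G => by ext n; simp
      map_smul' := fun c F => by
        ext n
        have h (F : PowerSeries R) : PowerSeries.coeff n (c • F) = c • PowerSeries.coeff n F := rfl
        simp [h] }
    fun F G => by
      ext n
      simp only [LinearMap.coe_mk, AddHom.coe_mk, PowerSeries.coeff_mk, smul_eq_mul, map_add,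
        PowerSeries.coeff_mul, map_sum, Derivation.leibniz, Finset.sum_add_distrib]
      refine congrArg _ ?_
      rw [← Finset.Nat.sum_antidiagonal_swap]
      rfl

@[simp] theorem coeff_extPS (D : Derivation ℝ R R) (F : PowerSeries R) (n : ℕ) :
    PowerSeries.coeff n (extPS D F) = D (PowerSeries.coeff n F) := by
  exact PowerSeries.coeff_mk n fun n => D (PowerSeries.coeff n F)

theorem coe_extP (D : Derivation ℝ R R) (F : R[X]) :
    ((extP D F : R[X]) : PowerSeries R) = extPS D F := by
  ext n; simp

end Formal

/-! ### Jacobi's formula for derivations of a commutative ring -/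

section Jacobi
variable {R A : Type} [CommRing R] [CommRing A] [Algebra R A] {n : Type} [Fintype n] [DecidableEq n]

theorem derivation_prod {ι : Type} [DecidableEq ι] (D : Derivation R A A) (s : Finset ι)
    (f : ι → A) : D (∏ i ∈ s, f i) = ∑ i ∈ s, (∏ j ∈ s.erase i, f j) * D (f i) := by
  induction s using Finset.induction_on with
  | empty => simp
  | insert i s hi ih =>
    rw [Finset.prod_insert hi, Derivation.leibniz, ih, Finset.sum_insert hi,
      Finset.erase_insert hi, smul_eq_mul, smul_eq_mul, Finset.mul_sum, add_comm]
    refine congrArg _ (Finset.sum_congr rfl fun j hj => ?_)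
    rw [Finset.erase_insert_of_ne (by rintro rfl; exact hi hj),
      Finset.prod_insert (fun h => hi (Finset.mem_of_mem_erase h)), mul_assoc]

/-- Jacobi's formula for the derivative of a determinant. -/
theorem derivation_det (D : Derivation R A A) (M : Matrix n n A) :
    D M.det = (M.adjugate * M.map D).trace := by
  -- By Cramer's rule each diagonal entry is the determinant with one column differentiated, so the
  -- claim is the product rule applied column by column to the permutation expansion.
  have h : ∀ i, ((M.adjugate * M.map D).diag i) = (M.updateCol i fun k => D (M k i)).det := by
    intro i
    rw [← Matrix.cramer_apply, Matrix.cramer_eq_adjugate_mulVec]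
    rfl
  rw [Matrix.trace, Finset.sum_congr rfl fun i _ => h i, Matrix.det_apply, map_sum]
  simp only [Matrix.det_apply]
  rw [Finset.sum_comm]
  refine Finset.sum_congr rfl fun σ _ => ?_
  rw [← Finset.smul_sum, Units.smul_def, map_zsmul, derivation_prod, Units.smul_def]
  refine congrArg _ (Finset.sum_congr rfl fun i _ => ?_)
  rw [← Finset.mul_prod_erase _ _ (Finset.mem_univ i), Matrix.updateCol_self, mul_comm]
  refine congrArg _ (Finset.prod_congr rfl fun j hj => ?_)
  rw [Matrix.updateCol_ne (Finset.ne_of_mem_erase hj)]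

end Jacobi

/-! ### Logarithmic derivatives of det(1 - tM) and traces of powers -/

section TracePowers
open PowerSeries
variable {R : Type} [CommRing R] {n : Type} [Fintype n]

theorem derivation_matrix_mul [Algebra ℝ R] (D : Derivation ℝ R R) (M M' : Matrix n n R) :
    (M * M').map D = M.map D * M' + M * M'.map D := by
  ext i j
  simp [Matrix.mul_apply, Finset.sum_add_distrib, Derivation.leibniz, mul_comm, add_comm]

theorem derivation_trace [Algebra ℝ R] (D : Derivation ℝ R R) (M : Matrix n n R) :
    D M.trace = (M.map D).trace := by simp [Matrix.trace]

variable [DecidableEq n]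

/-- The matrix `1 - t M` over power series. -/
def oneSub (M : Matrix n n R) : Matrix n n R⟦X⟧ := 1 - (X : R⟦X⟧) • M.map (C : R →+* R⟦X⟧)

/-- The geometric series `∑ t^j M^j`. -/
def geom (M : Matrix n n R) : Matrix n n R⟦X⟧ := Matrix.of fun i k => mk fun j => (M ^ j) i k

theorem oneSub_mul_geom (M : Matrix n n R) : oneSub M * geom M = 1 := by
  ext i k m
  rw [oneSub, sub_mul, one_mul, smul_mul_assoc, Matrix.sub_apply, Matrix.smul_apply, smul_eq_mul,
    map_sub, Matrix.mul_apply]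
  rcases m with _ | m
  · simp only [geom, Matrix.of_apply, coeff_mk, pow_zero, coeff_zero_X_mul, sub_zero,
      Matrix.one_apply]
    split_ifs <;> simp
  · simp only [geom, Matrix.of_apply, coeff_mk, coeff_succ_X_mul, map_sum, Matrix.map_apply,
      coeff_C_mul, Matrix.one_apply, pow_succ', Matrix.mul_apply, sub_self]
    split_ifs <;> simp [coeff_one]

/-- Over power series 1 - tM is invertible with inverse the geometric series, so Jacobi's formula
becomes a logarithmic derivative. -/
theorem adjugate_oneSub (M : Matrix n n R) :
    (oneSub M).adjugate = (oneSub M).det • geom M := by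
  calc (oneSub M).adjugate = (oneSub M).adjugate * (oneSub M * geom M) := by
        rw [oneSub_mul_geom, mul_one]
    _ = _ := by rw [← mul_assoc, Matrix.adjugate_mul, smul_mul_assoc, one_mul]

/-- `D det(1 - tM) = - det(1 - tM) ∑ t^{j+1} Tr (M^j DM)` for a derivation of the coefficients. -/
theorem extPS_det_oneSub [Algebra ℝ R] (D : Derivation ℝ R R) (M : Matrix n n R) :
    extPS D (oneSub M).det = - (oneSub M).det * (X * mk fun j => (M ^ j * M.map D).trace) := by
  rw [derivation_det, adjugate_oneSub, smul_mul_assoc, Matrix.trace_smul, smul_eq_mul, neg_mul,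
    ← mul_neg]
  congr 1
  have h : (oneSub M).map (extPS D) = - (X : R⟦X⟧) • (M.map D).map (C : R →+* R⟦X⟧) := by
    ext i k m
    simp only [oneSub, Matrix.map_apply, coeff_extPS, Matrix.sub_apply, Matrix.smul_apply,
      smul_eq_mul, map_sub, neg_mul, map_neg, Matrix.one_apply]
    have h1 : D (coeff m (if i = k then 1 else 0)) = 0 := by
      split_ifs <;> simp [coeff_one]; split_ifs <;> simp
    rcases m with _ | m
    · simp only [coeff_zero_X_mul, map_zero, h1, sub_self, neg_zero]
    · rw [h1, coeff_succ_X_mul, coeff_succ_X_mul, coeff_C, coeff_C]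
      split_ifs <;> simp
  rw [h]
  ext m
  rw [neg_smul, mul_neg, Matrix.trace_neg, Matrix.mul_smul, Matrix.trace_smul, smul_eq_mul,
    map_neg, map_neg]
  rcases m with _ | m
  · simp
  · simp [coeff_succ_X_mul, Matrix.trace, Matrix.mul_apply, geom, coeff_mul_C]

/-- The companion of `extPS_det_oneSub` for d/dt: together they express det(1 - tM) = exp(-∑ t^m Tr
M^m / m) without using exponentials. -/
theorem derivative_det_oneSub (M : Matrix n n R) :
    derivative R (oneSub M).det = - (oneSub M).det * mk fun j => (M ^ (j + 1)).trace := by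
  rw [derivation_det, adjugate_oneSub, smul_mul_assoc, Matrix.trace_smul, smul_eq_mul, neg_mul,
    ← mul_neg]
  congr 1
  have h : (oneSub M).map (derivative R) = - M.map (C : R →+* R⟦X⟧) := by
    ext1 i k
    simp only [oneSub, Matrix.map_apply, Matrix.sub_apply, Matrix.smul_apply,
      Matrix.neg_apply, smul_eq_mul, map_sub, Matrix.one_apply, Derivation.leibniz]
    split_ifs <;> simp
  rw [h]
  ext m
  simp [Matrix.trace, Matrix.mul_apply, geom, coeff_mul_C, pow_succ]

theorem derivation_trace_pow [Algebra ℝ R] (D : Derivation ℝ R R) (M : Matrix n n R) (m : ℕ) :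
    D (M ^ (m + 1)).trace = (m + 1) * (M ^ m * M.map D).trace := by
  have h : ∀ m k : ℕ, (M ^ k * (M ^ (m + 1)).map D).trace = (m + 1) * (M ^ (k + m) * M.map D).trace := by
    intro m
    induction m with
    | zero => simp
    | succ m ih =>
      intro k
      rw [pow_succ M (m + 1), derivation_matrix_mul, mul_add, Matrix.trace_add, ← mul_assoc,
        Matrix.trace_mul_comm, ← mul_assoc, ← pow_succ', ih, ← mul_assoc, ← pow_add]
      push_cast
      rw [show k + 1 + m = k + (m + 1) by ring]
      ring
  rw [derivation_trace]
  simpa using h m 0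

end TracePowers

/-! ### Tridiagonal determinants and the characteristic polynomial of the Lax matrix -/

section Tridiagonal
variable {A : Type} [CommRing A]

/-- The tridiagonal matrix with diagonal `d`, superdiagonal `u` and subdiagonal `l`. -/
def tridiag (d u l : ℕ → A) (n : ℕ) : Matrix (Fin n) (Fin n) A := Matrix.of fun i j =>
  if j.val = i.val then d i else if j.val = i.val + 1 then u i
  else if i.val = j.val + 1 then l j else 0

theorem det_tridiag_add_two (d u l : ℕ → A) (n : ℕ) :
    (tridiag d u l (n + 2)).det
      = d (n + 1) * (tridiag d u l (n + 1)).det - u n * l n * (tridiag d u l n).det := by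
  have h1 : (tridiag d u l (n + 2)).submatrix (Fin.last (n + 1)).succAbove
      (Fin.last (n + 1)).succAbove = tridiag d u l (n + 1) := by
    ext i j; simp [tridiag]
  have h2 : ((tridiag d u l (n + 2)).submatrix (Fin.last (n + 1)).succAbove
      (Fin.last n).castSucc.succAbove).det = u n * (tridiag d u l n).det := by
    rw [Matrix.det_succ_column _ (Fin.last n), Fin.sum_univ_castSucc, Finset.sum_eq_zero]
    · have h3 : ((tridiag d u l (n + 2)).submatrix (Fin.last (n + 1)).succAbove
          (Fin.last n).castSucc.succAbove).submatrix (Fin.last n).succAbove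
          (Fin.last n).succAbove = tridiag d u l n := by
        ext i j
        simp [tridiag, Fin.succAbove, Fin.lt_def]
      rw [h3]
      simp [tridiag, Fin.succAbove, ← two_mul]
    · intro i _
      have : (tridiag d u l (n + 2)) ((Fin.last (n + 1)).succAbove i.castSucc)
          ((Fin.last n).castSucc.succAbove (Fin.last n)) = 0 := by
        have hi := i.2
        have e1 : ((Fin.last (n + 1)).succAbove i.castSucc).val = i := by simp
        have e2 : ((Fin.last n).castSucc.succAbove (Fin.last n)).val = n + 1 := by
          simp [Fin.succAbove]
        simp only [tridiag, Matrix.of_apply, e1, e2]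
        rw [if_neg (by omega), if_neg (by omega), if_neg (by omega)]
      rw [Matrix.submatrix_apply, this]; simp
  rw [Matrix.det_succ_row _ (Fin.last (n + 1)), Fin.sum_univ_castSucc, Fin.sum_univ_castSucc,
    Finset.sum_eq_zero, h1, h2]
  · have : (-1 : A) ^ (n + 1 + n) = -1 := by rw [show n + 1 + n = 2 * n + 1 by ring]; simp [pow_succ]
    have e1 : tridiag d u l (n + 2) (Fin.last (n + 1)) (Fin.last n).castSucc = l n := by
      simp [tridiag]; omega
    have e2 : tridiag d u l (n + 2) (Fin.last (n + 1)) (Fin.last (n + 1)) = d (n + 1) := by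
      simp [tridiag]
    rw [e1, e2]
    simp only [Fin.val_last, Fin.val_castSucc, this, ← two_mul, pow_mul, neg_one_sq, one_pow]
    ring
  · intro i _
    have : tridiag d u l (n + 2) (Fin.last (n + 1)) i.castSucc.castSucc = 0 := by
      have hi := i.2
      simp only [tridiag, Matrix.of_apply, Fin.val_last, Fin.val_castSucc]
      rw [if_neg (by omega), if_neg (by omega), if_neg (by omega)]
    rw [this]; simp

theorem det_tridiag_unit (n : ℕ) : (tridiag (fun _ => (1 : A)) (fun _ => 0) (fun _ => -1) n).det = 1 := by
  induction n using Nat.twoStepInduction with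
  | zero => simp
  | one => simp [tridiag]
  | more n _ ih => rw [det_tridiag_add_two, ih]; simp

/-- The Lax matrix with entries in an arbitrary ring. -/
def laxOf (a b : ℕ → A) (n : ℕ) : Matrix (Fin n) (Fin n) A := Matrix.of fun i j =>
  if j.val ≤ i.val then a (i.val + 1) + b (i.val + 1)
  else if j.val = i.val + 1 then a (i.val + 1)
  else 0

/-- Right multiplication by the unipotent bidiagonal matrix subtracts from each column its
successor. Rows of the Lax matrix are constant up to the diagonal, so all entries below the
subdiagonal cancel. The last column has no successor; there the assumption `a n = 0` is needed. -/
theorem one_sub_laxOf_mul (t : A) (a b : ℕ → A) (n : ℕ) (ha : a n = 0) :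
    (1 - t • laxOf a b n) * tridiag (fun _ => (1 : A)) (fun _ => 0) (fun _ => -1) n
      = tridiag (fun i => 1 - t * b (i + 1)) (fun i => - (t * a (i + 1))) (fun _ => -1) n := by
  ext i j
  rw [Matrix.mul_apply]
  by_cases hj : j.val + 1 < n
  · rw [Finset.sum_eq_add j ⟨j.val + 1, hj⟩ (fun h => by simpa using congrArg Fin.val h)]
    · simp only [tridiag, laxOf, Matrix.of_apply, Matrix.sub_apply, Matrix.smul_apply, smul_eq_mul,
        Matrix.one_apply, Fin.ext_iff]
      split_ifs <;> first | omega | (simp; done) | (simp; ring)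
    · rintro k - ⟨h1, h2⟩
      have h1 : k.val ≠ j.val := fun h => h1 (Fin.ext h)
      have h2 : k.val ≠ j.val + 1 := fun h => h2 (Fin.ext h)
      simp only [tridiag, Matrix.of_apply]
      split_ifs <;> first | omega | simp
    · simp
    · simp
  · have hj' : j.val + 1 = n := by omega
    have hi := i.2
    rw [Finset.sum_eq_single j]
    · simp only [tridiag, laxOf, Matrix.of_apply, Matrix.sub_apply, Matrix.smul_apply, smul_eq_mul,
        Matrix.one_apply, Fin.ext_iff]
      split_ifs with h1 h2 h3 h4 <;> first | omega | (simp; done) | skip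
      have : i.val + 1 = n := by omega
      rw [this, ha]; simp
    · rintro k - h1
      have h1 : k.val ≠ j.val := fun h => h1 (Fin.ext h)
      simp only [tridiag, Matrix.of_apply]
      split_ifs <;> first | omega | simp
    · simp

theorem det_one_sub_laxOf (t : A) (a b : ℕ → A) (n : ℕ) (ha : a n = 0) :
    (1 - t • laxOf a b n).det
      = (tridiag (fun i => 1 - t * b (i + 1)) (fun i => - (t * a (i + 1))) (fun _ => -1) n).det := by
  rw [← one_sub_laxOf_mul t a b n ha, Matrix.det_mul, det_tridiag_unit, mul_one]

end Tridiagonal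

/-! ### The polynomials p_n and the generating series of the H_m -/

section LaxPolynomial
open Polynomial
variable {N : ℕ}

/-- The reversed characteristic polynomials `det (1 - t L_n)` of the truncated Lax matrices. -/
def pp (N : ℕ) : ℕ → (Pol N)[X]
  | 0 => 1
  | 1 => 1 - C (pb N 1) * X
  | n + 2 => (1 - C (pb N (n + 2)) * X) * pp N (n + 1) - X * C (pa N (n + 1)) * pp N n

theorem pp_zero : pp N 0 = 1 := rfl

/-- At `n = 0` the truncated index `n - 1` is harmless, since it is multiplied by `a_0 = 0`. -/
theorem pp_succ (n : ℕ) : pp N (n + 1)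
    = (1 - C (pb N (n + 1)) * X) * pp N n - X * C (pa N n) * pp N (n - 1) := by
  cases n with
  | zero => simp [pp]
  | succ n => rfl

/-- The Lax matrix over the polynomial ring. -/
def laxP (N : ℕ) : Matrix (Fin N) (Fin N) (Pol N) := laxOf (pa N) (pb N) N

theorem laxP_map (x : Phase N) : (laxP N).map (MvPolynomial.eval x) = lax x := by
  ext i j
  simp only [laxP, laxOf, lax, Matrix.map_apply, Matrix.of_apply, ← fn_pa, ← fn_pb, fn]
  split_ifs <;> simp

theorem pa_top : pa N N = 0 := by
  apply pa_eq_zero; omega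

theorem charpolyRev_laxP : (laxP N).charpolyRev = pp N N := by
  have h1 : (laxP N).map (C : Pol N →+* (Pol N)[X])
      = laxOf (fun j => C (pa N j)) (fun j => C (pb N j)) N := by
    ext1 i j
    simp only [laxP, laxOf, Matrix.map_apply, Matrix.of_apply]
    split_ifs <;> simp
  rw [Matrix.charpolyRev, h1, det_one_sub_laxOf _ _ _ _ (by rw [pa_top, map_zero])]
  generalize hn : N = n
  have : ∀ n, (tridiag (fun i => 1 - (X : (Pol N)[X]) * C (pb N (i + 1)))
      (fun i => - (X * C (pa N (i + 1)))) (fun _ => -1) n).det = pp N n := by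
    intro n
    induction n using Nat.twoStepInduction with
    | zero => simp [pp]
    | one => simp [tridiag, pp]
    | more n h1 h2 => rw [det_tridiag_add_two, h1, h2, pp]; ring
  subst hn
  exact this N

theorem det_oneSub_laxP : (oneSub (laxP N)).det = (pp N N : PowerSeries (Pol N)) := by
  rw [← charpolyRev_laxP, Matrix.charpolyRev, ← Polynomial.coeToPowerSeries.ringHom_apply,
    RingHom.map_det]
  congr 1
  ext1 i j
  simp only [oneSub, RingHom.mapMatrix_apply, Matrix.map_apply, Matrix.sub_apply, map_sub,
    Matrix.one_apply, Matrix.smul_apply, smul_eq_mul, map_mul, map_one]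
  simp

theorem charpolyRev_lax (x : Phase N) :
    (lax x).charpolyRev = (pp N N).map (MvPolynomial.eval x) := by
  rw [← charpolyRev_laxP, ← laxP_map, Matrix.charpolyRev, Matrix.charpolyRev,
    ← Polynomial.coe_mapRingHom, RingHom.map_det]
  congr 1
  ext1 i j
  simp only [RingHom.mapMatrix_apply, Matrix.map_apply, Matrix.sub_apply, map_sub,
    Matrix.one_apply, Matrix.smul_apply, smul_eq_mul, map_mul, map_one]
  simp

/-- The polynomial `H_m`. -/
def HamP (N m : ℕ) : Pol N := (1 / (m : ℝ)) • (laxP N ^ m).trace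

theorem fn_HamP (m : ℕ) : fn (HamP N m) = Ham N m := by
  ext x
  rw [Ham, ← laxP_map, ← RingHom.mapMatrix_apply, ← map_pow, RingHom.mapMatrix_apply, fn, HamP,
    Matrix.trace, Matrix.trace, MvPolynomial.smul_eval, map_sum]
  rfl

/-- The generating series of the `H_m`. -/
def hamSeries (N : ℕ) : PowerSeries (Pol N) := PowerSeries.mk (HamP N)

theorem HamP_zero : HamP N 0 = 0 := by simp [HamP]

theorem derivation_HamP_succ (D : Derivation ℝ (Pol N) (Pol N)) (m : ℕ) :
    D (HamP N (m + 1)) = (laxP N ^ m * (laxP N).map D).trace := by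
  rw [HamP, Derivation.map_smul, derivation_trace_pow]
  have h : ((m : Pol N) + 1) = MvPolynomial.C ((m : ℝ) + 1) := by simp
  rw [h, ← MvPolynomial.smul_eq_C_mul, smul_smul]
  have : ((m : ℝ) + 1) ≠ 0 := by positivity
  push_cast
  rw [one_div, inv_mul_cancel₀ this, one_smul]

theorem trace_eq_HamP (m : ℕ) : (laxP N ^ (m + 1)).trace = (m + 1 : Pol N) * HamP N (m + 1) := by
  have h : ((m : Pol N) + 1) = MvPolynomial.C ((m : ℝ) + 1) := by simp
  have : ((m : ℝ) + 1) ≠ 0 := by positivity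
  rw [HamP, h, ← MvPolynomial.smul_eq_C_mul, smul_smul]
  push_cast
  rw [mul_one_div_cancel this, one_smul]

/-- This is D p_N = -p_N D(∑ H_m t^m). As p_N has constant term 1 it is a unit of the power series
ring, so information about p_N and about the H_m can be exchanged freely. -/
theorem extPS_pp (D : Derivation ℝ (Pol N) (Pol N)) :
    extPS D (pp N N : PowerSeries (Pol N)) = - pp N N * extPS D (hamSeries N) := by
  rw [← det_oneSub_laxP, extPS_det_oneSub]
  congr 1
  ext m
  rcases m with _ | m
  · simp [hamSeries, HamP_zero]
  · simp [hamSeries, PowerSeries.coeff_succ_X_mul, derivation_HamP_succ]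

theorem derivative_pp :
    ((derivative (pp N N) : (Pol N)[X]) : PowerSeries (Pol N))
      = - pp N N * PowerSeries.derivative (Pol N) (hamSeries N) := by
  rw [← PowerSeries.derivative_coe, ← det_oneSub_laxP, derivative_det_oneSub]
  congr 1
  ext m
  simp [hamSeries, PowerSeries.coeff_derivative, trace_eq_HamP, mul_comm]

theorem coeff_zero_pp (n : ℕ) : (pp N n).coeff 0 = 1 := by
  induction n using Nat.twoStepInduction with
  | zero => simp [pp]
  | one => simp [pp]
  | more n h1 h2 => simp [pp, h1, h2]

theorem pp_coe_isUnit (n : ℕ) : IsUnit (pp N n : PowerSeries (Pol N)) := by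
  rw [PowerSeries.isUnit_iff_constantCoeff]
  have : PowerSeries.constantCoeff (pp N n : PowerSeries (Pol N)) = 1 := by
    rw [← PowerSeries.coeff_zero_eq_constantCoeff_apply, Polynomial.coeff_coe, coeff_zero_pp]
  rw [this]; exact isUnit_one

end LaxPolynomial

/-! ### Lenard relations between the first two brackets -/

section Lenard
open Polynomial
variable {N : ℕ}

theorem extP_eq_zero_of_ham {D : Derivation ℝ (Pol N) (Pol N)}
    (h : ∀ m, 1 ≤ m → D (HamP N m) = 0) : extP D (pp N N) = 0 := by
  have h1 := extPS_pp D
  have h2 : extPS D (hamSeries N) = 0 := by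
    ext m
    rcases m with _ | m
    · simp [hamSeries, HamP_zero]
    · simp [hamSeries, h]
  rw [h2, mul_zero, ← coe_extP] at h1
  exact Polynomial.coe_injective _ (by rw [h1, Polynomial.coe_zero])

theorem ham_shift_of_extP {D D' : Derivation ℝ (Pol N) (Pol N)}
    (h : X * extP D (pp N N) = extP D' (pp N N)) (m : ℕ) :
    D (HamP N m) = D' (HamP N (m + 1)) := by
  have h1 := congrArg (fun F : (Pol N)[X] => (F : PowerSeries (Pol N))) h
  simp only [Polynomial.coe_mul, coe_extP, extPS_pp, Polynomial.coe_X] at h1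
  have h2 : (pp N N : PowerSeries (Pol N)) * (PowerSeries.X * extPS D (hamSeries N))
      = (pp N N : PowerSeries (Pol N)) * extPS D' (hamSeries N) := by linear_combination -h1
  have h3 := (pp_coe_isUnit (N := N) N).mul_left_cancel h2
  simpa [hamSeries, PowerSeries.coeff_succ_X_mul] using congrArg (PowerSeries.coeff (m + 1)) h3

/-- The derivation `F ↦ t D F - D' F`. -/
def pencil (D D' : Derivation ℝ (Pol N) (Pol N)) : Derivation ℝ (Pol N)[X] (Pol N)[X] :=
  (X : (Pol N)[X]) • extP D - extP D'

theorem pencil_apply (D D' : Derivation ℝ (Pol N) (Pol N)) (F : (Pol N)[X]) :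
    pencil D D' F = X * extP D F - extP D' F := rfl

theorem pencil_pp_succ (D D' : Derivation ℝ (Pol N) (Pol N)) (n : ℕ) :
    pencil D D' (pp N (n + 1)) = (1 - C (pb N (n + 1)) * X) * pencil D D' (pp N n)
      - X * C (pa N n) * pencil D D' (pp N (n - 1))
      - X * (X * C (D (pb N (n + 1))) - C (D' (pb N (n + 1)))) * pp N n
      - X * (X * C (D (pa N n)) - C (D' (pa N n))) * pp N (n - 1) := by
  simp only [pencil_apply, pp_succ n, map_sub, Derivation.leibniz, smul_eq_mul, extP_C, extP_X,
    Derivation.map_one_eq_zero]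
  ring

theorem pencil_zero (D D' : Derivation ℝ (Pol N) (Pol N)) : pencil D D' (pp N 0) = 0 := by
  rw [pp_zero, Derivation.map_one_eq_zero]

theorem pencil_eq_zero_of_le {D D' : Derivation ℝ (Pol N) (Pol N)} {k : ℕ}
    (ha : ∀ n < k, D (pa N n) = 0) (ha' : ∀ n < k, D' (pa N n) = 0)
    (hb : ∀ n < k, D (pb N (n + 1)) = 0) (hb' : ∀ n < k, D' (pb N (n + 1)) = 0) (n : ℕ)
    (hn : n ≤ k) : pencil D D' (pp N n) = 0 := by
  induction n using Nat.strong_induction_on with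
  | _ n ih =>
    rcases n with _ | n
    · exact pencil_zero _ _
    · rw [pencil_pp_succ, ih n (by omega) (by omega), ih (n - 1) (by omega) (by omega),
        ha n (by omega), ha' n (by omega), hb n (by omega), hb' n (by omega)]
      simp

/-- Past the support of the bracket the recursion is homogeneous, so two consecutive zeros propagate
upwards. -/
theorem pencil_eq_zero_of_ge {D D' : Derivation ℝ (Pol N) (Pol N)} {k : ℕ}
    (ha : ∀ n, k < n → D (pa N n) = 0) (ha' : ∀ n, k < n → D' (pa N n) = 0)
    (hb : ∀ n, k < n → D (pb N (n + 1)) = 0) (hb' : ∀ n, k < n → D' (pb N (n + 1)) = 0)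
    (h0 : pencil D D' (pp N k) = 0) (h1 : pencil D D' (pp N (k + 1)) = 0) (n : ℕ)
    (hn : k ≤ n) : pencil D D' (pp N n) = 0 := by
  obtain ⟨d, rfl⟩ := Nat.exists_eq_add_of_le hn
  induction d using Nat.twoStepInduction with
  | zero => exact h0
  | one => exact h1
  | more d hd hd' =>
    have e : k + (d + 2) = k + (d + 1) + 1 := rfl
    rw [e, pencil_pp_succ, hd' (by omega), show k + (d + 1) - 1 = k + d by omega, hd (by omega),
      ha _ (by omega), ha' _ (by omega), hb _ (by omega), hb' _ (by omega)]
    simp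

/-- Among all p_n only p_{k+1} is not annihilated for j = k + 1. Since a_j with j ≤ N - 1 forces k +
2 ≤ N, the exceptional index lies strictly below N. -/
theorem pencil_pa (j : ℕ) : pencil ((B2 N).left (pa N j)) ((B1 N).left (pa N j)) (pp N N) = 0 := by
  by_cases hj : 1 ≤ j ∧ j ≤ N - 1
  swap
  · rw [pa_eq_zero hj]; have h0 (B : Bider (Pol N)) : extP (B.left 0) (pp N N) = 0 := by ext1; simp
    rw [pencil_apply, h0, h0]; simp
  obtain ⟨k, rfl⟩ : ∃ k, j = k + 1 := ⟨j - 1, by omega⟩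
  have low := pencil_eq_zero_of_le (D := (B2 N).left (pa N (k + 1)))
    (D' := (B1 N).left (pa N (k + 1))) (k := k)
    (fun n hn => by simp only [Bider.left_apply, B2_aa]; split_ifs <;> first | omega | rfl)
    (fun n hn => by simp only [Bider.left_apply, B1_aa])
    (fun n hn => by simp only [Bider.left_apply, B2_ba]; split_ifs <;> first | omega | rfl)
    (fun n hn => by simp only [Bider.left_apply, B1_ba]; split_ifs <;> first | omega | rfl)
  have e1 : pencil ((B2 N).left (pa N (k + 1))) ((B1 N).left (pa N (k + 1))) (pp N (k + 1))
      = X * C (pa N (k + 1)) * pp N (k + 1) := by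
    rw [pencil_pp_succ, low k le_rfl, low (k - 1) (by omega), pp_succ k]
    simp [Bider.left_apply, B2_aa, B1_aa, B2_ba, B1_ba]
    ring
  have e2 : pencil ((B2 N).left (pa N (k + 1))) ((B1 N).left (pa N (k + 1))) (pp N (k + 2)) = 0 := by
    rw [pencil_pp_succ, e1, Nat.add_sub_cancel, low k le_rfl]
    simp [Bider.left_apply, B2_aa, B1_aa, B2_ba, B1_ba]
    ring
  have e3 : pencil ((B2 N).left (pa N (k + 1))) ((B1 N).left (pa N (k + 1))) (pp N (k + 3)) = 0 := by
    rw [pencil_pp_succ, e2, show k + 2 - 1 = k + 1 by omega, e1]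
    simp [Bider.left_apply, B2_aa, B1_aa, B2_ba, B1_ba]
    ring
  refine pencil_eq_zero_of_ge (k := k + 2) ?_ ?_ ?_ ?_ e2 e3 N (by omega)
  · intro n hn; simp only [Bider.left_apply, B2_aa]; split_ifs <;> first | omega | rfl
  · intro n hn; simp only [Bider.left_apply, B1_aa]
  · intro n hn; simp only [Bider.left_apply, B2_ba]; split_ifs <;> first | omega | rfl
  · intro n hn; simp only [Bider.left_apply, B1_ba]; split_ifs <;> first | omega | rfl

/-- For j = k + 1 the only possible nonzero value occurs at p_k, with value -t a_k p_{k-1}, and k <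
N. -/
theorem pencil_pb (j : ℕ) : pencil ((B2 N).left (pb N j)) ((B1 N).left (pb N j)) (pp N N) = 0 := by
  by_cases hj : 1 ≤ j ∧ j ≤ N
  swap
  · rw [pb_eq_zero hj]; have h0 (B : Bider (Pol N)) : extP (B.left 0) (pp N N) = 0 := by ext1; simp
    rw [pencil_apply, h0, h0]; simp
  obtain ⟨k, rfl⟩ : ∃ k, j = k + 1 := ⟨j - 1, by omega⟩
  have low := pencil_eq_zero_of_le (D := (B2 N).left (pb N (k + 1)))
    (D' := (B1 N).left (pb N (k + 1))) (k := k - 1)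
    (fun n hn => by simp only [Bider.left_apply, B2_ab]; split_ifs <;> first | omega | rfl)
    (fun n hn => by simp only [Bider.left_apply, B1_ab]; split_ifs <;> first | omega | rfl)
    (fun n hn => by simp only [Bider.left_apply, B2_bb])
    (fun n hn => by simp only [Bider.left_apply, B1_bb]; split_ifs <;> first | omega | rfl)
  have e0 : pencil ((B2 N).left (pb N (k + 1))) ((B1 N).left (pb N (k + 1))) (pp N k)
      = - (X * C (pa N k) * pp N (k - 1)) := by
    rcases k with _ | k
    · simp [pp_zero]
    · rw [pencil_pp_succ, low k (by omega), low (k - 1) (by omega)]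
      have h0 : ¬ (k + 1 + 1 = k) := by omega
      simp [Bider.left_apply, B2_bb, B1_bb, B2_ab, B1_ab, h0]
  have e1 : pencil ((B2 N).left (pb N (k + 1))) ((B1 N).left (pb N (k + 1))) (pp N (k + 1)) = 0 := by
    rw [pencil_pp_succ, e0, low (k - 1) le_rfl]
    simp [Bider.left_apply, B2_bb, B1_bb, B2_ab, B1_ab]
    ring
  have e2 : pencil ((B2 N).left (pb N (k + 1))) ((B1 N).left (pb N (k + 1))) (pp N (k + 2)) = 0 := by
    rw [pencil_pp_succ, e1, Nat.add_sub_cancel, e0, pp_succ k]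
    simp [Bider.left_apply, B2_bb, B1_bb, B2_ab, B1_ab]
    ring
  refine pencil_eq_zero_of_ge (k := k + 1) ?_ ?_ ?_ ?_ e1 e2 N (by omega)
  · intro n hn; simp only [Bider.left_apply, B2_ab]; split_ifs <;> first | omega | rfl
  · intro n hn; simp only [Bider.left_apply, B1_ab]; split_ifs <;> first | omega | rfl
  · intro n hn; simp only [Bider.left_apply, B2_bb]
  · intro n hn; simp only [Bider.left_apply, B1_bb]; split_ifs <;> first | omega | rfl

theorem B1_coeff_zero : B1 N ((pp N N).coeff 0) = 0 := by rw [coeff_zero_pp, Derivation.map_one_eq_zero]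

theorem B2_coeff (k : ℕ) : B2 N ((pp N N).coeff k) = B1 N ((pp N N).coeff (k + 1)) := by
  rw [← sub_eq_zero]
  refine separating_coord (fun j => ?_) fun j => ?_
  · simpa [pencil_apply, coeff_X_mul] using congrArg (coeff · (k + 1)) (pencil_pa (N := N) j)
  · simpa [pencil_apply, coeff_X_mul] using congrArg (coeff · (k + 1)) (pencil_pb (N := N) j)

theorem X_mul_extP_B2 (g : Pol N) :
    X * extP ((B2 N).left g) (pp N N) = extP ((B1 N).left g) (pp N N) := by
  ext1 k
  rcases k with _ | k
  · simp [B1_coeff_zero]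
  · simp [coeff_X_mul, B2_coeff]

/-- The Lenard relation `{H_m, ·}_2 = {H_{m+1}, ·}_1`. -/
theorem B2_HamP (m : ℕ) : B2 N (HamP N m) = B1 N (HamP N (m + 1)) := by
  refine DFunLike.ext _ _ fun g => ?_
  exact ham_shift_of_extP (X_mul_extP_B2 g) m

/-- The bottom of the Lenard ladder: with 1/0 = 0 the polynomial `HamP N 0` is zero, so the relation
for m = 0 makes H₁ a Casimir. -/
theorem B1_HamP_one : B1 N (HamP N 1) = 0 := by
  rw [← zero_add 1, ← B2_HamP, HamP_zero, map_zero]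

end Lenard

/-! ### Consequences of the Lenard relations -/

section Consequences
open Polynomial
variable {N : ℕ}

theorem HamP_one : HamP N 1 = ∑ i ∈ Finset.range N, (pa N (i + 1) + pb N (i + 1)) := by
  rw [Finset.sum_range]
  simp [HamP, laxP, laxOf, Matrix.trace]

theorem derivation_sum_apply {ι : Type} (s : Finset ι) (f : ι → Derivation ℝ (Pol N) (Pol N))
    (g : Pol N) : (∑ i ∈ s, f i) g = ∑ i ∈ s, f i g :=
  map_sum (derEval g) f s

theorem B2_HamP_one_pa (j : ℕ) : B2 N (HamP N 1) (pa N (j + 1)) = pa N (j + 1) *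
    (pb N (j + 1) - pb N (j + 2) + pa N j - pa N (j + 2)) := by
  by_cases hj : j + 1 ≤ N - 1
  swap
  · rw [pa_eq_zero (N := N) (j := j + 1) (by omega)]; simp
  have h : ∀ i, B2 N (pa N (i + 1) + pb N (i + 1)) (pa N (j + 1)) =
      (if i = j then pa N (j + 1) * pb N (j + 1) else 0)
      + (if i = j + 1 then - (pa N (j + 1) * (pa N (j + 2) + pb N (j + 2))) else 0)
      + (if i + 1 = j then pa N (j + 1) * pa N j else 0) := by
    intro i
    rw [map_add, Derivation.add_apply, B2_aa, B2_ba]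
    split_ifs <;> first | omega | (subst_vars; simp; try ring)
  rw [HamP_one, map_sum, derivation_sum_apply, Finset.sum_congr rfl fun i _ => h i,
    Finset.sum_add_distrib, Finset.sum_add_distrib, Finset.sum_ite_eq', Finset.sum_ite_eq']
  have h3 : ∑ i ∈ Finset.range N, (if i + 1 = j then pa N (j + 1) * pa N j else 0)
      = pa N (j + 1) * pa N j := by
    rcases j with _ | j
    · simp
    · simp only [Nat.add_right_cancel_iff, Finset.sum_ite_eq', Finset.mem_range]
      rw [if_pos (by omega)]
  rw [h3, if_pos (by simp; omega), if_pos (by simp; omega)]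
  ring

theorem B2_HamP_one_pb (j : ℕ) : B2 N (HamP N 1) (pb N (j + 1)) = pb N (j + 1) *
    (pa N j - pa N (j + 1)) := by
  by_cases hj : j + 1 ≤ N
  swap
  · rw [pb_eq_zero (N := N) (j := j + 1) (by omega)]; simp
  have h : ∀ i, B2 N (pa N (i + 1) + pb N (i + 1)) (pb N (j + 1)) =
      (if i = j then - (pa N (j + 1) * pb N (j + 1)) else 0)
      + (if i + 1 = j then pa N j * pb N (j + 1) else 0) := by
    intro i
    rw [map_add, Derivation.add_apply, B2_ab, B2_bb]
    split_ifs <;> first | omega | (subst_vars; simp; try ring)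
  rw [HamP_one, map_sum, derivation_sum_apply, Finset.sum_congr rfl fun i _ => h i,
    Finset.sum_add_distrib, Finset.sum_ite_eq']
  have h3 : ∑ i ∈ Finset.range N, (if i + 1 = j then pa N j * pb N (j + 1) else 0)
      = pa N j * pb N (j + 1) := by
    rcases j with _ | j
    · simp
    · simp only [Nat.add_right_cancel_iff, Finset.sum_ite_eq', Finset.mem_range]
      rw [if_pos (by omega)]
  rw [h3, if_pos (by simp; omega)]
  ring

theorem vfOf_B2_HamP_one : vfOf (B2 N (HamP N 1)) = todaVF N := by
  ext x k
  rcases k with i | i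
  · rw [vfOf, X_inl, B2_HamP_one_pa]
    simp only [todaVF, mkVec, Sum.elim_inl, Nat.add_sub_cancel, ← fn_pa, ← fn_pb, fn]
    simp
  · rw [vfOf, X_inr, B2_HamP_one_pb]
    simp only [todaVF, mkVec, Sum.elim_inr, Nat.add_sub_cancel, ← fn_pa, ← fn_pb, fn]
    simp

theorem hamVF_pi2_Ham_one : hamVF (pi2 N) (Ham N 1) = todaVF N := by
  rw [← tensorOf_B2, ← fn_HamP, hamVF_fn, vfOf_B2_HamP_one]

theorem hamVF_pi1_Ham_two : hamVF (pi1 N) (Ham N 2) = todaVF N := by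
  rw [← tensorOf_B1, ← fn_HamP, hamVF_fn, ← B2_HamP, vfOf_B2_HamP_one]

theorem isCasimirOn_pi1_trace : IsCasimirOn (pi1 N) Set.univ (fun x => (lax x).trace) := by
  have : (fun x => (lax x).trace) = fn (HamP N 1) := by
    rw [fn_HamP]; ext x; simp [Ham]
  rw [this, ← tensorOf_B1]
  exact isCasimirOn_univ_fn B1_HamP_one

theorem coeff_pp_of_lt {n k : ℕ} (h : n < k) : (pp N n).coeff k = 0 := by
  induction n using Nat.twoStepInduction generalizing k with
  | zero => simp [pp, coeff_one]; omega
  | one =>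
    obtain ⟨k, rfl⟩ : ∃ j, k = j + 2 := ⟨k - 2, by omega⟩
    simp [pp, coeff_one]
  | more n h1 h2 =>
    obtain ⟨k, rfl⟩ : ∃ j, k = j + 1 := ⟨k - 1, by omega⟩
    simp only [pp, sub_mul, one_mul, coeff_sub, mul_assoc, coeff_C_mul, coeff_X_mul]
    rw [h1 (by omega), h2 (by omega), h2 (by omega)]; simp

theorem charpoly_coeff_eq {R : Type} [CommRing R] [Nontrivial R] {n : ℕ}
    (M : Matrix (Fin n) (Fin n) R) {k : ℕ} (hk : k ≤ n) :
    M.charpoly.coeff k = M.charpolyRev.coeff (n - k) := by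
  rw [← Matrix.reverse_charpoly, Polynomial.coeff_reverse, Matrix.charpoly_natDegree_eq_dim,
    Fintype.card_fin, Polynomial.revAt_le (by omega), Nat.sub_sub_self hk]

theorem fn_coeff_pp (x : Phase N) {k : ℕ} (hk : k ≤ N) :
    (lax x).charpoly.coeff k = fn ((pp N N).coeff (N - k)) x := by
  rw [charpoly_coeff_eq _ hk, charpolyRev_lax, Polynomial.coeff_map]; rfl

/-- The top of the ladder: p_N has degree at most N, so the relation ends with the coefficient of
t^{N+1}, which is zero. -/
theorem B2_coeff_top : B2 N ((pp N N).coeff N) = 0 := by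
  rw [B2_coeff, coeff_pp_of_lt (Nat.lt_succ_self N), map_zero]

theorem isCasimirOn_pi2_det : IsCasimirOn (pi2 N) Set.univ (fun x => (lax x).det) := by
  have : (fun x => (lax x).det) = fn ((-1) ^ N * (pp N N).coeff N) := by
    ext x
    rw [Matrix.det_eq_sign_charpoly_coeff, fn_coeff_pp x (Nat.zero_le N)]
    simp [fn]
  rw [this, ← tensorOf_B2]
  refine isCasimirOn_univ_fn ?_
  ext1 i
  rw [bider_mul_left, B2_coeff_top, ← MvPolynomial.C_1, ← map_neg, ← map_pow]
  simp [← MvPolynomial.algebraMap_eq]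

/-- Passing to the linear bracket and back moves one unit of index from the second argument to the
first, until the second is H₀ = 0. -/
theorem B2_HamP_HamP (m n : ℕ) : B2 N (HamP N m) (HamP N n) = 0 := by
  induction n generalizing m with
  | zero => rw [HamP_zero, map_zero]
  | succ n ih =>
    rw [B2_HamP, B1_skew, ← B2_HamP, B2_skew, neg_neg, ih]

theorem hamsInvolution_tensorOf {B : Bider (Pol N)}
    (h : ∀ m n, 1 ≤ m → 1 ≤ n → B (HamP N m) (HamP N n) = 0) : HamsInvolution (tensorOf B) := by
  intro m n hm hn
  rw [← fn_HamP, ← fn_HamP, bracket_fn, h m n hm hn]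
  ext x; simp [fn]

theorem hamsInvolution_pi2 : HamsInvolution (pi2 N) := by
  rw [← tensorOf_B2]; exact hamsInvolution_tensorOf fun m n _ _ => B2_HamP_HamP m n

/-- The second coefficient of `pp N n`, up to sign. -/
def sS (N : ℕ) : ℕ → Pol N
  | 0 => 0
  | n + 1 => sS N n + pb N (n + 1) + pa N n

/-- The last summand is the defect of the truncation: it carries the factor a_n and disappears at n
= N, leaving X₁ p_N = p_N' + H₁ p_N. -/
theorem extP_D1_pp (n : ℕ) : extP (D1 N) (pp N n) = derivative (pp N n) + C (sS N n) * pp N n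
    + ((n : (Pol N)[X]) + 1) * C (pa N n) * (pp N n - pp N (n - 1)) := by
  induction n using Nat.twoStepInduction with
  | zero => simp [pp, sS]
  | one =>
    have := D1_pb (N := N) 0
    simp only [pp, sS, map_sub, Derivation.leibniz, extP_C, extP_X, this, zero_add]
    have h2 : C (2 : Pol N) = 2 := map_ofNat C 2
    simp [pp_zero, h2]
    ring
  | more n h1 h2 =>
    have ha := D1_pa (N := N) n
    have hb := D1_pb (N := N) (n + 1)
    have e := pp_succ (N := N) n
    rw [Nat.add_sub_cancel] at h2
    have e1 : extP (D1 N) (pp N (n + 2)) = - C (D1 N (pb N (n + 2))) * X * pp N (n + 1)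
        + (1 - C (pb N (n + 2)) * X) * extP (D1 N) (pp N (n + 1))
        - X * C (D1 N (pa N (n + 1))) * pp N n - X * C (pa N (n + 1)) * extP (D1 N) (pp N n) := by
      simp only [pp, map_sub, Derivation.leibniz, extP_C, extP_X, smul_eq_mul,
        Derivation.map_one_eq_zero]
      ring
    have e2 : derivative (pp N (n + 2)) = - C (pb N (n + 2)) * pp N (n + 1)
        + (1 - C (pb N (n + 2)) * X) * derivative (pp N (n + 1))
        - C (pa N (n + 1)) * pp N n - X * C (pa N (n + 1)) * derivative (pp N n) := by
      simp only [pp, derivative_sub, derivative_mul, derivative_C, derivative_X, derivative_one]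
      ring
    rw [e1, e2, h1, h2, ha, hb]
    simp only [sS, pp, map_add, map_sub, map_mul, map_natCast, map_ofNat,
      show n + 2 - 1 = n + 1 from rfl]
    push_cast
    linear_combination ((n : (Pol N)[X]) + 1) * C (pa N (n + 1)) * e

end Consequences

/-! ### The first master symmetry and the cubic bracket -/

section FirstMaster
open Polynomial
variable {N : ℕ}

theorem sS_top : sS N N = HamP N 1 := by
  have : ∀ n, sS N (n + 1) = ∑ i ∈ Finset.range n, (pa N (i + 1) + pb N (i + 1)) + pb N (n + 1) := by
    intro n
    induction n with
    | zero => simp [sS]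
    | succ n ih => rw [sS, ih, Finset.sum_range_succ]; ring
  rcases N with _ | n
  · simp [HamP_one, sS]
  · rw [HamP_one, this, Finset.sum_range_succ, pa_top]; ring

theorem extPS_hamSeries_D1 : extPS (D1 N) (hamSeries N)
    = PowerSeries.derivative (Pol N) (hamSeries N) - PowerSeries.C (HamP N 1) := by
  have h := congrArg (fun F : (Pol N)[X] => (F : PowerSeries (Pol N))) (extP_D1_pp (N := N) N)
  simp only [pa_top, map_zero, mul_zero, zero_mul, add_zero, Polynomial.coe_add, Polynomial.coe_mul,
    coe_extP, extPS_pp, derivative_pp, Polynomial.coe_C, sS_top] at h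
  refine (pp_coe_isUnit (N := N) N).mul_left_cancel ?_
  linear_combination -h

theorem D1_HamP {m : ℕ} (hm : 1 ≤ m) : D1 N (HamP N m) = ((m : Pol N) + 1) * HamP N (m + 1) := by
  have := congrArg (PowerSeries.coeff m) (extPS_hamSeries_D1 (N := N))
  rw [coeff_extPS, map_sub, PowerSeries.coeff_derivative, PowerSeries.coeff_C,
    if_neg (by omega), sub_zero] at this
  simpa [hamSeries, mul_comm] using this

theorem D1_ham_one : D1 N (HamP N 1) = 2 * HamP N 2 := by
  rw [D1_HamP le_rfl]; norm_num

theorem along_X1_Ham {m : ℕ} (hm : 1 ≤ m) (x : Phase N) :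
    along (X1 N) (Ham N m) x = ((m : ℝ) + 1) * Ham N (m + 1) x := by
  rw [← vfOf_D1, ← fn_HamP, along_vfOf, D1_HamP hm, ← fn_HamP]
  simp [fn]

theorem bider_natCast_mul (B : Bider (Pol N)) (c : ℕ) (f : Pol N) :
    B ((c : Pol N) * f) = (c : Pol N) • B f := by
  rw [Derivation.leibniz, Derivation.map_natCast, smul_zero, add_zero]

/-- The relation `{H_m, ·}_3 = {H_{m+1}, ·}_2`. -/
theorem B3_HamP {m : ℕ} (hm : 1 ≤ m) : B3 N (HamP N m) = B2 N (HamP N (m + 1)) := by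
  refine DFunLike.ext _ _ fun g => ?_
  -- Rewritten by the Lenard relation, the equation for π₁ at H_{m+1} has the same left side as the
  -- equation for π₂ at H_m, up to one multiple of {H_{m+1}, g}₂; their difference is the claim.
  have h1 := congrArg (fun B : Bider (Pol N) => B (HamP N (m + 1)) g) (lieB_D1_B1 (N := N))
  have h2 := congrArg (fun B : Bider (Pol N) => B (HamP N m) g) (lieB_D1_B2 (N := N))
  have e1 : D1 N (HamP N (m + 1)) = ((m + 2 : ℕ) : Pol N) * HamP N (m + 2) := by
    rw [D1_HamP (by omega)]; push_cast; ring
  have e2 : D1 N (HamP N m) = ((m + 1 : ℕ) : Pol N) * HamP N (m + 1) := by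
    rw [D1_HamP hm]; push_cast; ring
  simp only [lieB_apply, e1, e2, bider_natCast_mul, ← B2_HamP, Derivation.neg_apply,
    Derivation.add_apply, Derivation.smul_apply, smul_eq_mul] at h1 h2
  push_cast at h1 h2
  linear_combination h2 - h1

theorem hamsInvolution_pi3 : HamsInvolution (pi3 N) := by
  rw [← tensorOf_B3]
  exact hamsInvolution_tensorOf fun m n hm _ => by rw [B3_HamP hm, B2_HamP_HamP]

/-- Evaluating L_{X₁} π₂ = -π₃ at H₁ gives [X₁, χ] - 2χ_{H₂} = -χ_{H₂}, with Hamiltonian fields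
taken for π₂. -/
theorem lie_D1_chi : ⁅D1 N, B2 N (HamP N 1)⁆ = B2 N (HamP N 2) := by
  refine DFunLike.ext _ _ fun g => ?_
  have h2 := congrArg (fun B : Bider (Pol N) => B (HamP N 1) g) (lieB_D1_B2 (N := N))
  have e2 : D1 N (HamP N 1) = ((2 : ℕ) : Pol N) * HamP N 2 := by rw [D1_ham_one]; norm_num
  simp only [lieB_apply, e2, bider_natCast_mul, Derivation.neg_apply, B3_HamP le_rfl,
    Derivation.smul_apply, smul_eq_mul] at h2
  push_cast at h2
  rw [Derivation.commutator_apply]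
  linear_combination h2

theorem lie_B2_HamP (m n : ℕ) : ⁅B2 N (HamP N m), B2 N (HamP N n)⁆ = 0 := by
  refine DFunLike.ext _ _ fun g => ?_
  have := jacobi_of_schouten (schouten_B2_B2 (N := N)) (HamP N m) (HamP N n) g
  rw [B2_HamP_HamP, map_zero, Derivation.zero_apply, zero_add] at this
  rw [Derivation.commutator_apply, this, sub_self]; rfl

/-- The flows of the `H_m`, `m ≥ 1`, are nonzero. -/
theorem B2_HamP_succ_ne_zero (hN : 2 ≤ N) (m : ℕ) : B2 N (HamP N (m + 1)) ≠ 0 := by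
  intro h
  obtain ⟨n, rfl⟩ : ∃ n, N = n + 2 := ⟨N - 2, by omega⟩
  -- At a₁ = b₁ = 1 and all other coordinates 0, only the first row of L is nonzero and (L^m)₁₁ =
  -- 2^m.
  let x : Phase (n + 2) := mkVec (n + 2) (fun i => if i = 1 then 1 else 0)
    (fun i => if i = 1 then 1 else 0)
  have ha : ∀ i, MvPolynomial.eval x (pa (n + 2) i) = if i = 1 then 1 else 0 := by
    intro i
    have : fn (pa (n + 2) i) x = a x i := by rw [fn_pa]
    rw [fn] at this
    rw [this, a]
    split_ifs with h1 h2 h2 <;> first | omega | rfl | skip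
    · simp [x, mkVec, h2]
    · simp [x, mkVec]; omega
  have hb : ∀ i, MvPolynomial.eval x (pb (n + 2) i) = if i = 1 then 1 else 0 := by
    intro i
    have : fn (pb (n + 2) i) x = b x i := by rw [fn_pb]
    rw [fn] at this
    rw [this, b]
    split_ifs with h1 h2 h2 <;> first | omega | rfl | skip
    · simp [x, mkVec, h2]
    · simp [x, mkVec]; omega
  have hL : ∀ m, (lax x ^ m) 0 0 = 2 ^ m ∧ ∀ i, i ≠ 0 → (lax x ^ (m + 1)) i 0 = 0 := by
    have h0 : ∀ i j, i ≠ 0 → lax x i j = 0 := by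
      intro i j hi
      have hi : i.val ≠ 0 := fun h => hi (Fin.ext h)
      rw [← laxP_map]
      simp only [laxP, laxOf, Matrix.map_apply, Matrix.of_apply]
      split_ifs <;> simp [ha, hb, hi]
    have h00 : lax x 0 0 = 2 := by
      rw [← laxP_map]
      simp [laxP, laxOf, ha, hb]; norm_num
    intro m
    induction m with
    | zero => exact ⟨by simp, fun i hi => by simpa using h0 i 0 hi⟩
    | succ m ih =>
      refine ⟨?_, fun i hi => ?_⟩
      · rw [pow_succ, Matrix.mul_apply, Finset.sum_eq_single 0, ih.1, h00, pow_succ]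
        · intro i _ hi
          rw [h0 i 0 hi, mul_zero]
        · simp
      · rw [pow_succ', Matrix.mul_apply]
        exact Finset.sum_eq_zero fun j _ => by rw [h0 i j hi, zero_mul]
  have h1 := derivation_HamP_succ ((B2 (n + 2)).left (pa (n + 2) 1)) m
  rw [Bider.left_apply, h, Derivation.zero_apply] at h1
  have h2 := congrArg (MvPolynomial.eval x) h1
  -- At this point {L, a₁}₂ has a single nonzero entry, in the upper left corner, equal to a₁b₁ = 1;
  -- so {H_{m+1}, a₁}₂ takes the value 2^m.
  have hM : ∀ i j, MvPolynomial.eval x ((B2 (n + 2)).left (pa (n + 2) 1) (laxP (n + 2) i j))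
      = if i = 0 ∧ j = 0 then 1 else 0 := by
    intro i j
    simp only [laxP, laxOf, Matrix.of_apply, Bider.left_apply, Fin.ext_iff, Fin.val_zero]
    split_ifs <;> first | omega | (simp [B2_aa, B2_ba]; done) |
      (simp only [map_add, Derivation.add_apply, B2_aa, B2_ba]
       split_ifs <;> first | omega |
         (simp only [map_neg, map_mul, map_zero, ha, hb]; done) |
         (simp only [map_neg, map_mul, map_zero, ha, hb]; norm_num; done) |
         (simp only [map_neg, map_mul, ha, hb]
          split_ifs <;> first | omega | norm_num))
  rw [Matrix.trace, map_zero, map_sum, Finset.sum_eq_single 0] at h2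
  · rw [Matrix.diag_apply, Matrix.mul_apply, map_sum, Finset.sum_eq_single 0] at h2
    · rw [map_mul, Matrix.map_apply, hM, if_pos ⟨rfl, rfl⟩, mul_one] at h2
      have h3 : MvPolynomial.eval x ((laxP (n + 2) ^ m) 0 0) = (lax x ^ m) 0 0 := by
        rw [← laxP_map, ← RingHom.mapMatrix_apply, ← map_pow]; rfl
      rw [h3, (hL m).1] at h2
      exact (pow_ne_zero m (two_ne_zero)) h2.symm
    · intro j _ hj
      rw [map_mul, Matrix.map_apply, hM, if_neg (fun h => hj h.1), mul_zero]
    · simp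
  · intro i _ hi
    rw [Matrix.diag_apply, Matrix.mul_apply, map_sum]
    exact Finset.sum_eq_zero fun j _ => by
      rw [map_mul, Matrix.map_apply, hM, if_neg (fun h => hi h.2), mul_zero]
  · simp

/-- The commutator with χ is the flow of some H_{m+1}: it commutes with χ by involution and the
Jacobi identity, and it is not zero. -/
theorem isMasterSymmetry_of_lie (hN : 2 ≤ N) {D : Derivation ℝ (Pol N) (Pol N)} {m : ℕ}
    (h : ⁅D, B2 N (HamP N 1)⁆ = B2 N (HamP N (m + 1))) :
    IsMasterSymmetry (vfOf D) (todaVF N) := by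
  rw [← vfOf_B2_HamP_one, IsMasterSymmetry, lieBracket_vfOf, lieBracket_vfOf, h, lie_B2_HamP]
  exact ⟨vfOf_eq_zero.mpr rfl, fun h0 => B2_HamP_succ_ne_zero hN m (vfOf_eq_zero.mp h0)⟩

theorem isMasterSymmetry_X1 (hN : 2 ≤ N) : IsMasterSymmetry (X1 N) (todaVF N) := by
  rw [← vfOf_D1]
  exact isMasterSymmetry_of_lie hN (m := 1) lie_D1_chi

end FirstMaster

/-! ### The Casimir of the cubic bracket -/

section InverseTrace
open Polynomial
variable {N : ℕ}

theorem X_mul_extP_B3 (g : Pol N) : X * extP ((B3 N).left g) (pp N N)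
    = extP ((B2 N).left g) (pp N N) + X * C (B2 N (HamP N 1) g) * pp N N := by
  apply Polynomial.coe_injective
  have h : PowerSeries.X * extPS ((B3 N).left g) (hamSeries N)
      = extPS ((B2 N).left g) (hamSeries N) - PowerSeries.X * PowerSeries.C (B2 N (HamP N 1) g) := by
    ext1 m
    rcases m with _ | _ | m
    · rw [map_sub, coeff_extPS]; simp [hamSeries, HamP_zero]
    · simp [hamSeries, HamP_zero, PowerSeries.coeff_succ_X_mul]
    · rw [PowerSeries.coeff_succ_X_mul, map_sub, PowerSeries.coeff_succ_X_mul]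
      simp [hamSeries, B3_HamP]
  simp only [Polynomial.coe_add, Polynomial.coe_mul, coe_extP, extPS_pp, Polynomial.coe_C,
    Polynomial.coe_X]
  linear_combination (- (pp N N : PowerSeries (Pol N))) * h

/-- The two highest coefficients of p_N are multiplied by the same factor {H₁, g}₂ under {·, g}₃:
for this one because the degree ends, for the next because det L is a Casimir of π₂. Their quotient,
which is -Tr L⁻¹, is therefore a Casimir. -/
theorem B3_coeff_top (g : Pol N) :
    B3 N ((pp N N).coeff N) g = B2 N (HamP N 1) g * (pp N N).coeff N := by
  have := congrArg (coeff · (N + 1)) (X_mul_extP_B3 (N := N) g)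
  simpa [coeff_X_mul, mul_assoc, coeff_pp_of_lt (Nat.lt_succ_self N)] using this

theorem B3_coeff_pred (g : Pol (N + 1)) :
    B3 (N + 1) ((pp (N + 1) (N + 1)).coeff N) g
      = B2 (N + 1) (HamP (N + 1) 1) g * (pp (N + 1) (N + 1)).coeff N := by
  have := congrArg (coeff · (N + 1)) (X_mul_extP_B3 (N := N + 1) g)
  simpa [coeff_X_mul, mul_assoc, B2_coeff_top] using this

theorem det_lax_eq (x : Phase N) : (lax x).det = (-1) ^ N * fn ((pp N N).coeff N) x := by
  rw [Matrix.det_eq_sign_charpoly_coeff, fn_coeff_pp x (Nat.zero_le N)]; simp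

theorem trace_inv_lax (x : Phase (N + 1)) : ((lax x)⁻¹).trace
    = - (fn ((pp (N + 1) (N + 1)).coeff N) x / fn ((pp (N + 1) (N + 1)).coeff (N + 1)) x) := by
  by_cases hd : (lax x).det = 0
  -- In the singular case both sides are 0 by convention, so the formula is an identity of functions
  -- on the whole space.
  · have h0 : fn ((pp (N + 1) (N + 1)).coeff (N + 1)) x = 0 := by
      rw [det_lax_eq] at hd
      simpa using hd
    rw [h0, Matrix.nonsing_inv_apply_not_isUnit _ (by simpa using hd)]; simp
  · have hu : IsUnit (lax x) := by rw [Matrix.isUnit_iff_isUnit_det]; exact isUnit_iff_ne_zero.mpr hd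
    rw [Matrix.trace_eq_neg_charpoly_coeff, Matrix.charpoly_inv _ hu, charpolyRev_lax]
    have h1 : ((-1 : ℝ[X]) ^ Fintype.card (Fin (N + 1))) = C ((-1) ^ (N + 1)) := by simp
    rw [h1, mul_assoc, coeff_C_mul, coeff_C_mul, Polynomial.coeff_map, det_lax_eq,
      Ring.inverse_eq_inv', Fintype.card_fin, Nat.add_sub_cancel]
    have h2 : ((-1 : ℝ) ^ (N + 1)) ≠ 0 := by simp
    rw [det_lax_eq] at hd
    have h3 := right_ne_zero_of_mul hd
    change - ((-1) ^ (N + 1) * (_ * fn _ x)) = _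
    field_simp

theorem isCasimirOn_pi3_trace_inv (hN : 2 ≤ N) :
    IsCasimirOn (pi3 N) {x | (lax x).det ≠ 0} (fun x => ((lax x)⁻¹).trace) := by
  obtain ⟨n, rfl⟩ : ∃ n, N = n + 1 := ⟨N - 1, by omega⟩
  set u := (pp (n + 1) (n + 1)).coeff n
  set w := (pp (n + 1) (n + 1)).coeff (n + 1)
  have hf : (fun x : Phase (n + 1) => ((lax x)⁻¹).trace) = fun x => - (fn u x / fn w x) :=
    funext trace_inv_lax
  have hw : ∀ x : Phase (n + 1), (lax x).det ≠ 0 → fn w x ≠ 0 := fun x hx =>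
    right_ne_zero_of_mul (det_lax_eq x ▸ hx)
  rw [hf]
  refine ⟨((contDiff_fn u).contDiffOn.div (contDiff_fn w).contDiffOn hw).neg, fun g _ x hx => ?_⟩
  have hskew : ∀ (x : Phase (n + 1)) i j, pi3 (n + 1) x i j = - pi3 (n + 1) x j i := by
    intro x i j
    rw [← tensorOf_B3]
    change fn _ x = - fn _ x
    rw [B3_skew]; simp [fn]
  -- The common factor of the two coefficients, now for an arbitrary smooth `g`; it cancels in the
  -- quotient rule.
  have key : ∀ c : Pol (n + 1), (∀ g, B3 (n + 1) c g = B2 (n + 1) (HamP (n + 1) 1) g * c) →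
      fderiv ℝ (fn c) x (hamVF (pi3 (n + 1)) g x)
        = - (∑ j, fn (B2 (n + 1) (HamP (n + 1) 1) (.X j)) x * pd j g x) * fn c x := by
    intro c hc
    rw [← bracket_eq_fderiv, bracket_skew hskew, ← tensorOf_B3, bracket_fn_left, neg_mul,
      Finset.sum_mul]
    refine congrArg _ (Finset.sum_congr rfl fun j _ => ?_)
    rw [hc]; simp [fn]; ring
  have hu' := key u B3_coeff_pred
  have hw' := key w B3_coeff_top
  have hdu : DifferentiableAt ℝ (fn u) x := (contDiff_fn u).differentiable (by simp) x
  have hdw : DifferentiableAt ℝ (fn w) x := (contDiff_fn w).differentiable (by simp) x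
  rw [bracket_skew hskew, bracket_eq_fderiv]
  have hinv := (hasDerivAt_inv (hw x hx)).comp_hasFDerivAt x hdw.hasFDerivAt
  have h2 : (fun x => - (fn u x / fn w x)) = -(fn u * ((fun y => y⁻¹) ∘ fn w)) := by
    ext y; simp [div_eq_mul_inv]
  rw [h2, ((hdu.hasFDerivAt.mul hinv).neg).fderiv]
  simp only [neg_apply, smul_apply,
    add_apply, hu', hw', smul_eq_mul, Function.comp_apply]
  have := hw x hx
  field_simp
  ring

end InverseTrace

/-! ### Eigenvalues in involution -/

section Eigenvalues
open Polynomial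
variable {N : ℕ}

/-- A derivation killing all H_m kills every coefficient of p_N, so involution passes to the
coefficients one argument at a time. -/
theorem coeff_pp_involution {B : Bider (Pol N)} (hB : B.Skew)
    (h : ∀ m n, 1 ≤ m → 1 ≤ n → B (HamP N m) (HamP N n) = 0) (j k : ℕ) :
    B ((pp N N).coeff j) ((pp N N).coeff k) = 0 := by
  have h1 : ∀ n, 1 ≤ n → B ((pp N N).coeff j) (HamP N n) = 0 := by
    intro n hn
    have := extP_eq_zero_of_ham (D := B (HamP N n)) fun m hm => h n m hn hm
    rw [hB]
    have := congrArg (coeff · j) this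
    simpa using this
  simpa using congrArg (coeff · k) (extP_eq_zero_of_ham h1)

/-- The coefficients of the characteristic polynomial as complex functions. -/
def cc (N k : ℕ) (x : Phase N) : ℂ := (((lax x).charpoly.coeff k : ℝ) : ℂ)

theorem cc_eq {k : ℕ} (hk : k ≤ N) : cc N k = Complex.ofRealCLM ∘ fn ((pp N N).coeff (N - k)) := by
  ext x; rw [cc, fn_coeff_pp x hk]; rfl

theorem contDiff_cc {k : ℕ} (hk : k ≤ N) : ContDiff ℝ ∞ (cc N k) := by
  rw [cc_eq hk]; exact Complex.ofRealCLM.contDiff.comp (contDiff_fn _)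

theorem pd_cc {k : ℕ} (hk : k ≤ N) (i : Idx N) (x : Phase N) :
    pd i (cc N k) x = ((pd i (fn ((pp N N).coeff (N - k))) x : ℝ) : ℂ) := by
  rw [pd, cc_eq hk, Complex.ofRealCLM.hasFDerivAt.comp x
    (((contDiff_fn _).differentiable (by simp) x).hasFDerivAt) |>.fderiv]
  rfl

theorem bracket_cc {B : Bider (Pol N)} (hB : B.Skew)
    (h : ∀ m n, 1 ≤ m → 1 ≤ n → B (HamP N m) (HamP N n) = 0) {j k : ℕ} (hj : j ≤ N) (hk : k ≤ N)
    (x : Phase N) : bracket (tensorOf B) (cc N j) (cc N k) x = 0 := by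
  have h1 : bracket (tensorOf B) (cc N j) (cc N k) x = ((bracket (tensorOf B)
      (fn ((pp N N).coeff (N - j))) (fn ((pp N N).coeff (N - k))) x : ℝ) : ℂ) := by
    simp only [bracket, pd_cc hj, pd_cc hk, Complex.ofReal_sum]
    refine Finset.sum_congr rfl fun i _ => Finset.sum_congr rfl fun j _ => ?_
    simp
  rw [h1, bracket_fn, coeff_pp_involution hB h]
  simp [fn]

theorem laxC_charpoly (x : Phase N) :
    ((lax x).map (fun t : ℝ => (t : ℂ))).charpoly = ∑ k ∈ Finset.range (N + 1), C (cc N k x) * X ^ k := by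
  have h : ((lax x).map (fun t : ℝ => (t : ℂ))).charpoly = (lax x).charpoly.map Complex.ofRealHom :=
    (Matrix.charpoly_map (lax x) Complex.ofRealHom)
  have hd : ((lax x).charpoly.map Complex.ofRealHom).natDegree < N + 1 := by
    have := natDegree_map_le (f := Complex.ofRealHom) (p := (lax x).charpoly)
    rw [Matrix.charpoly_natDegree_eq_dim, Fintype.card_fin] at this
    omega
  rw [h, Polynomial.as_sum_range_C_mul_X_pow' _ hd]
  refine Finset.sum_congr rfl fun k _ => ?_
  rw [coeff_map]; rfl

/-- The `r`-th derivative of the characteristic polynomial at `z`. -/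
def charDeriv (N r : ℕ) (x : Phase N) (z : ℂ) : ℂ :=
  ∑ k ∈ Finset.range (N + 1), cc N k x * (derivative^[r] (X ^ k : ℂ[X])).eval z

theorem charDeriv_eq (r : ℕ) (x : Phase N) (z : ℂ) : charDeriv N r x z
    = (derivative^[r] ((lax x).map (fun t : ℝ => (t : ℂ))).charpoly).eval z := by
  rw [laxC_charpoly, iterate_derivative_sum, eval_finsetSum]
  simp only [iterate_derivative_C_mul, eval_mul, eval_C, charDeriv]

theorem charDeriv_zero_of_hasEigenvalue {x : Phase N} {z : ℂ} (h : Module.End.HasEigenvalue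
      (Matrix.toLin' ((lax x).map (fun t : ℝ => (t : ℂ)))) z) : charDeriv N 0 x z = 0 := by
  rw [charDeriv_eq, Function.iterate_zero_apply]
  rw [Module.End.hasEigenvalue_iff_isRoot_charpoly, Matrix.charpoly_toLin'] at h
  exact h

theorem charDeriv_top_ne_zero (x : Phase N) (z : ℂ) : charDeriv N N x z ≠ 0 := by
  rw [charDeriv_eq]
  set P := ((lax x).map (fun t : ℝ => (t : ℂ))).charpoly
  have hP : P.natDegree = N := by rw [Matrix.charpoly_natDegree_eq_dim, Fintype.card_fin]
  have hm : P.Monic := Matrix.charpoly_monic _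
  have h1 := natDegree_iterate_derivative P N
  rw [hP, Nat.sub_self, Nat.le_zero] at h1
  rw [eq_C_of_natDegree_eq_zero h1, eval_C, coeff_iterate_derivative, Nat.zero_add, ← hP,
    hm.coeff_natDegree, hP, Nat.descFactorial_self]
  simpa using Nat.factorial_ne_zero N

theorem continuousOn_charDeriv {U : Set (Phase N)} {l : Phase N → ℂ} (hl : ContinuousOn l U) (r : ℕ) :
    ContinuousOn (fun x => charDeriv N r x (l x)) U := by
  refine continuousOn_finsetSum _ fun k hk => ?_
  refine ((contDiff_cc (by simpa [Nat.lt_succ_iff] using hk)).continuous.continuousOn).mul ?_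
  exact (Polynomial.continuous _).comp_continuousOn hl

/-- Near a generic point the differential of an eigenvalue is a combination of the differentials of
the coefficients of the characteristic polynomial. -/
theorem exists_open_pd_eigenvalue {U : Set (Phase N)} (hU : IsOpen U) (hne : U.Nonempty)
    {l : Phase N → ℂ} (hl : ContDiffOn ℝ ∞ l U) (h0 : ∀ x ∈ U, charDeriv N 0 x (l x) = 0) :
    ∃ V ⊆ U, IsOpen V ∧ V.Nonempty ∧ ∀ x ∈ V, ∃ α : ℕ → ℂ, ∀ i,
      pd i l x = ∑ k ∈ Finset.range (N + 1), α k * pd i (cc N k) x := by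
  -- An eigenvalue may be multiple on an open set, so the characteristic polynomial itself need not
  -- determine its differential. Instead the last r is used for which the r-th derivative vanishes
  -- along `l` on some open subset; it exists because the N-th derivative is the constant N!.
  let Q : ℕ → Prop := fun r => ∃ V ⊆ U, IsOpen V ∧ V.Nonempty ∧ ∀ x ∈ V, charDeriv N r x (l x) = 0
  obtain ⟨r, ⟨V, hVU, hV, hVne, hr⟩, hr'⟩ : ∃ r, Q r ∧ ¬ Q (r + 1) := by
    by_contra! hcon
    have : ∀ r, Q r := fun r => by
      induction r with
      | zero => exact ⟨U, subset_rfl, hU, hne, h0⟩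
      | succ r ih => exact hcon r ih
    obtain ⟨V, _, _, ⟨x, hx⟩, h⟩ := this N
    exact charDeriv_top_ne_zero x _ (h x hx)
  have hlV := hl.mono hVU
  obtain ⟨y, hy, hy'⟩ : ∃ y ∈ V, charDeriv N (r + 1) y (l y) ≠ 0 := by
    by_contra! hcon
    exact hr' ⟨V, hVU, hV, hVne, hcon⟩
  refine ⟨V ∩ (fun x => charDeriv N (r + 1) x (l x)) ⁻¹' {0}ᶜ, fun x hx => hVU hx.1,
    (continuousOn_charDeriv hlV.continuousOn (r + 1)).isOpen_inter_preimage hV isOpen_compl_singleton,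
    ⟨y, hy, hy'⟩, ?_⟩
  rintro x ⟨hx, hx'⟩
  have hlx : HasFDerivAt l (fderiv ℝ l x) x :=
    ((hlV.contDiffAt (hV.mem_nhds hx)).differentiableAt (by simp)).hasFDerivAt
  let G : ℕ → ℂ[X] := fun k => derivative^[r] (X ^ k)
  -- Implicit differentiation of χ^{(r)}(x, l(x)) = 0, where χ is the characteristic polynomial; the
  -- coefficient of dl is χ^{(r+1)}(x, l(x)), nonzero on the chosen set.
  have hd : HasFDerivAt (fun x => charDeriv N r x (l x))
      (∑ k ∈ Finset.range (N + 1), (cc N k x • ((derivative (G k)).eval (l x) • fderiv ℝ l x)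
        + (G k).eval (l x) • fderiv ℝ (cc N k) x)) x := by
    refine HasFDerivAt.fun_sum fun k hk => ?_
    have hc : HasFDerivAt (cc N k) (fderiv ℝ (cc N k) x) x :=
      ((contDiff_cc (by simpa [Nat.lt_succ_iff] using hk)).differentiable (by simp) x).hasFDerivAt
    exact hc.mul (((G k).hasDerivAt (l x)).comp_hasFDerivAt x hlx)
  have hz : HasFDerivAt (fun x => charDeriv N r x (l x)) (0 : Phase N →L[ℝ] ℂ) x :=
    (hasFDerivAt_const (0 : ℂ) x).congr_of_eventuallyEq <|
      Filter.eventually_of_mem (hV.mem_nhds hx) fun z hz => hr z hz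
  have he := hd.unique hz
  have hx' : charDeriv N (r + 1) x (l x) ≠ 0 := hx'
  refine ⟨fun k => - (G k).eval (l x) / charDeriv N (r + 1) x (l x), fun i => ?_⟩
  have hi := DFunLike.congr_fun he (Pi.single i 1)
  simp only [_root_.sum_apply, _root_.add_apply,
    _root_.smul_apply, smul_eq_mul, Finset.sum_add_distrib,
    _root_.zero_apply] at hi
  have h2 : ∑ k ∈ Finset.range (N + 1), cc N k x * ((derivative (G k)).eval (l x)
      * fderiv ℝ l x (Pi.single i 1)) = charDeriv N (r + 1) x (l x) * pd i l x := by
    rw [charDeriv, Finset.sum_mul]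
    refine Finset.sum_congr rfl fun k _ => ?_
    simp only [Function.iterate_succ_apply', G, pd]; ring
  rw [h2] at hi
  have h3 : pd i l x = - (∑ k ∈ Finset.range (N + 1), (G k).eval (l x) *
      fderiv ℝ (cc N k) x (Pi.single i 1)) / charDeriv N (r + 1) x (l x) := by
    rw [eq_div_iff hx']; linear_combination hi
  rw [h3, neg_div, Finset.sum_div, ← Finset.sum_neg_distrib]
  refine Finset.sum_congr rfl fun k _ => ?_
  rw [pd]; ring

theorem bracket_sum_pd {ι : Type} [Fintype ι] [DecidableEq ι] (π : Tensor2 ι) {l m : (ι → ℝ) → ℂ}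
    {s : Finset ℕ} {c : ℕ → (ι → ℝ) → ℂ} {α β : ℕ → ℂ} {x : ι → ℝ}
    (hl : ∀ i, pd i l x = ∑ k ∈ s, α k * pd i (c k) x)
    (hm : ∀ i, pd i m x = ∑ k ∈ s, β k * pd i (c k) x) :
    bracket π l m x = ∑ j ∈ s, ∑ k ∈ s, α j * β k * bracket π (c j) (c k) x := by
  simp only [bracket, hl, hm, Finset.sum_mul_sum]
  simp only [Finset.mul_sum, Finset.smul_sum]
  rw [Finset.sum_congr rfl fun i _ => Finset.sum_comm, Finset.sum_comm]
  refine Finset.sum_congr rfl fun j _ => ?_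
  rw [Finset.sum_congr rfl fun i _ => Finset.sum_comm, Finset.sum_comm]
  refine Finset.sum_congr rfl fun k _ => Finset.sum_congr rfl fun p _ =>
    Finset.sum_congr rfl fun q _ => ?_
  simp only [Complex.real_smul]; ring

theorem eigenvaluesInvolution_tensorOf {B : Bider (Pol N)} (hB : B.Skew)
    (h : ∀ m n, 1 ≤ m → 1 ≤ n → B (HamP N m) (HamP N n) = 0) :
    EigenvaluesInvolution (tensorOf B) := by
  intro U l m hU hl hm hl' hm' x hx
  by_contra hne
  have hcont : ContinuousOn (bracket (tensorOf B) l m) U := by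
    have hpd : ∀ {l : Phase N → ℂ}, ContDiffOn ℝ ∞ l U → ∀ i, ContinuousOn (pd i l) U :=
      fun hl i => (hl.continuousOn_fderiv_of_isOpen hU (by simp)).clm_apply continuousOn_const
    refine continuousOn_finsetSum _ fun i _ => continuousOn_finsetSum _ fun j _ => ?_
    exact ((contDiff_fn _).continuous.continuousOn).smul ((hpd hl i).mul (hpd hm j))
  -- If the bracket were nonzero at a point it would be nonzero on an open set, and that set
  -- contains a point generic for both eigenvalues, where the bracket reduces to brackets of
  -- coefficients.
  let U' := U ∩ (bracket (tensorOf B) l m) ⁻¹' {0}ᶜ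
  have hU' : IsOpen U' := hcont.isOpen_inter_preimage hU isOpen_compl_singleton
  have sub : U' ⊆ U := Set.inter_subset_left
  obtain ⟨V, hVU, hV, hVne, hVl⟩ := exists_open_pd_eigenvalue hU' ⟨x, hx, hne⟩ (hl.mono sub)
    fun y hy => charDeriv_zero_of_hasEigenvalue (hl' y (sub hy))
  obtain ⟨W, hWV, hW, ⟨y, hy⟩, hWm⟩ := exists_open_pd_eigenvalue hV hVne
    (hm.mono (hVU.trans sub)) fun y hy => charDeriv_zero_of_hasEigenvalue (hm' y (sub (hVU hy)))
  obtain ⟨α, hα⟩ := hVl y (hWV hy)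
  obtain ⟨β, hβ⟩ := hWm y hy
  refine (hVU (hWV hy)).2 ?_
  rw [Set.mem_singleton_iff, bracket_sum_pd _ hα hβ]
  refine Finset.sum_eq_zero fun j hj => Finset.sum_eq_zero fun k hk => ?_
  rw [bracket_cc hB h (by simpa [Nat.lt_succ_iff] using hj) (by simpa [Nat.lt_succ_iff] using hk),
    mul_zero]

theorem eigenvaluesInvolution_pi2 : EigenvaluesInvolution (pi2 N) := by
  rw [← tensorOf_B2]
  exact eigenvaluesInvolution_tensorOf B2_skew fun m n _ _ => B2_HamP_HamP m n

theorem eigenvaluesInvolution_pi3 : EigenvaluesInvolution (pi3 N) := by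
  rw [← tensorOf_B3]
  exact eigenvaluesInvolution_tensorOf B3_skew fun m n hm _ => by rw [B3_HamP hm, B2_HamP_HamP]

end Eigenvalues

/-! ### The second master symmetry -/

section SecondMaster
open Polynomial
variable {N : ℕ}

/-- The third coefficient of `pp N n`. -/
def sE (N : ℕ) : ℕ → Pol N
  | 0 => 0
  | n + 1 => sE N n + pb N (n + 1) * sS N n + pa N n * sS N (n - 1)

theorem sS_pred (n : ℕ) : sS N n = sS N (n - 1) + pb N n + pa N (n - 1) := by
  cases n with
  | zero => simp [sS, pb_eq_zero (N := N) (j := 0) (by omega)]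
  | succ n => rfl

/-- Auxiliary coefficients of the second master symmetry. -/
def auxH (N n : ℕ) : Pol N :=
  ((N : Pol N) - n - 2) * (pb N (n + 1) + pa N (n + 1) + pa N n) - 2 * sS N n + sS N N

/-- Auxiliary coefficients of the second master symmetry. -/
def auxA (N n : ℕ) : Pol N :=
  sS N n ^ 2 - 2 * sE N n + pa N n * (((n : Pol N) + 1 - N) * (pb N n + pa N (n - 1)) - auxH N n)

/-- The second master symmetry, up to a Hamiltonian vector field. -/
def D2 (N : ℕ) : Derivation ℝ (Pol N) (Pol N) :=
  MvPolynomial.mkDerivation ℝ fun k => match k with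
    | Sum.inl i => pa N (i + 1) * (auxA N (i + 2) - auxA N i - pb N (i + 2) * auxH N (i + 1)
        + pb N (i + 1) * auxH N i)
    | Sum.inr i => pb N (i + 1) * (auxA N (i + 1) - auxA N i)

theorem D2_pa (i : ℕ) : D2 N (pa N (i + 1)) = pa N (i + 1) * (auxA N (i + 2) - auxA N i
    - pb N (i + 2) * auxH N (i + 1) + pb N (i + 1) * auxH N i) := by
  by_cases h : 1 ≤ i + 1 ∧ i + 1 ≤ N - 1
  · conv_lhs => rw [pa, dif_pos h]
    simp [D2]
  · rw [pa_eq_zero h]; simp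

theorem D2_pb (i : ℕ) : D2 N (pb N (i + 1)) = pb N (i + 1) * (auxA N (i + 1) - auxA N i) := by
  by_cases h : 1 ≤ i + 1 ∧ i + 1 ≤ N
  · conv_lhs => rw [pb, dif_pos h]
    simp [D2]
  · rw [pb_eq_zero h]; simp

/-- The action of `D2` on the coordinates is chosen so that this ansatz is compatible with the
three-term recursion. Every extra term carries a_n except t A_n p_n, and A_N reduces to S_N² - 2E_N.
-/
theorem X_mul_extP_D2_pp (n : ℕ) : X * extP (D2 N) (pp N n) = derivative (pp N n)
    + C (sS N n + ((n : Pol N) + 1 - N) * pa N n) * pp N n + X * C (auxA N n) * pp N n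
    + C (pa N n) * ((N : (Pol N)[X]) - (n : (Pol N)[X]) - 1 + X * C (auxH N n)) * pp N (n - 1) := by
  have hC2 : C (2 : Pol N) = 2 := map_ofNat C 2
  induction n using Nat.twoStepInduction with
  | zero => simp [pp, sS, auxA, sE]
  | one =>
    have hb := D2_pb (N := N) 0
    simp only [zero_add] at hb
    have e1 : extP (D2 N) (pp N 1) = - C (D2 N (pb N 1)) * X := by
      simp only [pp, map_sub, Derivation.leibniz, extP_C, extP_X, smul_eq_mul,
        Derivation.map_one_eq_zero]
      ring
    rw [e1, hb]
    have h0 : pb N 0 = 0 := pb_eq_zero (by omega)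
    simp [pp, sS, auxA, sE, pp_zero, h0]
    ring
  | more n h1 h2 =>
    have ha := D2_pa (N := N) n
    have hb := D2_pb (N := N) (n + 1)
    have e := pp_succ (N := N) n
    rw [Nat.add_sub_cancel] at h2
    have e1 : X * extP (D2 N) (pp N (n + 2)) = - X * C (D2 N (pb N (n + 2))) * X * pp N (n + 1)
        + (1 - C (pb N (n + 2)) * X) * (X * extP (D2 N) (pp N (n + 1)))
        - X * X * C (D2 N (pa N (n + 1))) * pp N n
        - X * C (pa N (n + 1)) * (X * extP (D2 N) (pp N n)) := by
      simp only [pp, map_sub, Derivation.leibniz, extP_C, extP_X, smul_eq_mul,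
        Derivation.map_one_eq_zero]
      ring
    have e2 : derivative (pp N (n + 2)) = - C (pb N (n + 2)) * pp N (n + 1)
        + (1 - C (pb N (n + 2)) * X) * derivative (pp N (n + 1))
        - C (pa N (n + 1)) * pp N n - X * C (pa N (n + 1)) * derivative (pp N n) := by
      simp only [pp, derivative_sub, derivative_mul, derivative_C, derivative_X, derivative_one]
      ring
    have eS := sS_pred (N := N) n
    rw [e1, e2, h1, h2, ha, hb]
    simp only [auxA, auxH, sE, sS, pp, Nat.add_sub_cancel, show n + 2 - 1 = n + 1 from rfl]
    rw [eS]
    simp only [map_add, map_sub, map_mul, map_pow, map_natCast, map_one, hC2]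
    push_cast
    linear_combination -C (pa N (n + 1)) * ((N : (Pol N)[X]) - (n : (Pol N)[X]) - 1
      + X * (((N : (Pol N)[X]) - (n : (Pol N)[X]) - 2) * (C (pb N (n + 1)) + C (pa N (n + 1)) + C (pa N n))
        - 2 * (C (sS N (n - 1)) + C (pb N n) + C (pa N (n - 1))) + C (sS N N))) * e

end SecondMaster

/-! ### Quadratic brackets of the truncated characteristic polynomials -/

section TwoParameter
open Polynomial
variable {N : ℕ}

/-- The value of a polynomial at a real number. -/
def ev (s : ℝ) (F : (Pol N)[X]) : Pol N := F.eval (algebraMap ℝ (Pol N) s)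

theorem derivation_ev (D : Derivation ℝ (Pol N) (Pol N)) (s : ℝ) (F : (Pol N)[X]) :
    D (ev s F) = ev s (extP D F) := (eval_extP D F s).symm

theorem ev_pp_succ (s : ℝ) (n : ℕ) : ev s (pp N (n + 1))
    = (1 - pb N (n + 1) * algebraMap ℝ _ s) * ev s (pp N n)
      - algebraMap ℝ _ s * pa N n * ev s (pp N (n - 1)) := by
  rw [pp_succ]
  simp only [ev, eval_sub, eval_mul, eval_C, eval_X, eval_one]

theorem derivation_ev_pp_succ (D : Derivation ℝ (Pol N) (Pol N)) (s : ℝ) (n : ℕ) :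
    D (ev s (pp N (n + 1))) = (1 - pb N (n + 1) * algebraMap ℝ _ s) * D (ev s (pp N n))
      - algebraMap ℝ _ s * D (pb N (n + 1)) * ev s (pp N n)
      - algebraMap ℝ _ s * pa N n * D (ev s (pp N (n - 1)))
      - algebraMap ℝ _ s * D (pa N n) * ev s (pp N (n - 1)) := by
  rw [ev_pp_succ]
  simp only [map_sub, Derivation.leibniz, Derivation.map_algebraMap, smul_eq_mul,
    Derivation.map_one_eq_zero]
  ring

theorem derivation_ev_pp_of_le {D : Derivation ℝ (Pol N) (Pol N)} {k : ℕ}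
    (ha : ∀ n < k, D (pa N n) = 0) (hb : ∀ n < k, D (pb N (n + 1)) = 0) (s : ℝ) (n : ℕ)
    (hn : n ≤ k) : D (ev s (pp N n)) = 0 := by
  induction n using Nat.strong_induction_on with
  | _ n ih =>
    rcases n with _ | n
    · simp [pp_zero, ev]
    · rw [derivation_ev_pp_succ, ih n (by omega) (by omega), ih (n - 1) (by omega) (by omega),
        ha n (by omega), hb n (by omega)]
      simp

theorem B2_pb_ev_pp (n : ℕ) (t : ℝ) : B2 N (pb N (n + 1)) (ev t (pp N n)) = 0 :=
  derivation_ev_pp_of_le (k := n)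
    (fun m hm => by rw [B2_ba]; split_ifs <;> first | omega | rfl)
    (fun m hm => by rw [B2_bb]) t n le_rfl

theorem B2_pa_ev_pp_of_le {n k : ℕ} (h : n < k) (t : ℝ) : B2 N (pa N k) (ev t (pp N n)) = 0 :=
  derivation_ev_pp_of_le (k := n)
    (fun m hm => by rw [B2_aa]; split_ifs <;> first | omega | rfl)
    (fun m hm => by rw [B2_ab]; split_ifs <;> first | omega | rfl) t n le_rfl

theorem B2_pa_ev_pp (n : ℕ) (t : ℝ) : B2 N (pa N n) (ev t (pp N n))
    = pa N n * (ev t (pp N (n - 1)) - ev t (pp N n)) := by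
  rcases n with _ | n
  · simp
  · rw [derivation_ev_pp_succ, B2_pa_ev_pp_of_le (Nat.lt_succ_self n),
      B2_pa_ev_pp_of_le (by omega), B2_aa, B2_ab, ev_pp_succ]
    have h0 : ¬ (n = n + 1 + 1) := by omega
    simp [h0]
    ring

theorem algebraMap_sub_ne_zero {s t : ℝ} (h : s ≠ t) :
    (algebraMap ℝ (Pol N) s - algebraMap ℝ (Pol N) t) ≠ 0 := by
  rw [← map_sub]
  exact (map_ne_zero_iff _ (FaithfulSMul.algebraMap_injective ℝ (Pol N))).mpr (sub_ne_zero.mpr h)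

theorem algebraMap_real_ne_zero {s : ℝ} (h : s ≠ 0) : algebraMap ℝ (Pol N) s ≠ 0 :=
  (map_ne_zero_iff _ (FaithfulSMul.algebraMap_injective ℝ (Pol N))).mpr h

theorem B2_self (f : Pol N) : B2 N f f = 0 := by
  have h := B2_skew (N := N) f f
  have h2 : (2 : Pol N) * B2 N f f = 0 := by linear_combination h
  exact (mul_eq_zero.mp h2).resolve_left two_ne_zero

/-- The relations for (p_n, p_n), (p_{n-1}, p_{n-1}) and (p_n, p_{n-1}) close under the recursion
and must be proved together. The factor t - s in the mixed relation avoids division. -/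
theorem B2_ev_pp_aux (n : ℕ) : (∀ s t : ℝ, B2 N (ev s (pp N n)) (ev t (pp N n)) = 0) ∧
    (∀ s t : ℝ, B2 N (ev s (pp N (n - 1))) (ev t (pp N (n - 1))) = 0) ∧
    ∀ s t : ℝ, (algebraMap ℝ (Pol N) t - algebraMap ℝ (Pol N) s)
        * B2 N (ev s (pp N n)) (ev t (pp N (n - 1)))
      = (algebraMap ℝ (Pol N) t - algebraMap ℝ (Pol N) s)
          * (ev s (pp N (n - 1)) * ev t (pp N (n - 1)))
        - algebraMap ℝ (Pol N) t * ev s (pp N n) * ev t (pp N (n - 1))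
        + algebraMap ℝ (Pol N) s * ev t (pp N n) * ev s (pp N (n - 1)) := by
  induction n with
  | zero => simp [pp_zero, ev]
  | succ n ih =>
    obtain ⟨hPP, hQQ, hPQ⟩ := ih
    have hleft : ∀ (s : ℝ) (g : Pol N), B2 N (ev s (pp N (n + 1))) g =
        (1 - pb N (n + 1) * algebraMap ℝ _ s) * B2 N (ev s (pp N n)) g
        - algebraMap ℝ _ s * B2 N (pb N (n + 1)) g * ev s (pp N n)
        - algebraMap ℝ _ s * pa N n * B2 N (ev s (pp N (n - 1))) g
        - algebraMap ℝ _ s * B2 N (pa N n) g * ev s (pp N (n - 1)) := fun s g =>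
      derivation_ev_pp_succ ((B2 N).left g) s n
    have hQP : ∀ s t : ℝ, (algebraMap ℝ (Pol N) t - algebraMap ℝ (Pol N) s)
        * B2 N (ev s (pp N (n - 1))) (ev t (pp N n))
      = - (algebraMap ℝ (Pol N) t - algebraMap ℝ (Pol N) s)
          * (ev s (pp N (n - 1)) * ev t (pp N (n - 1)))
        + algebraMap ℝ (Pol N) t * ev s (pp N n) * ev t (pp N (n - 1))
        - algebraMap ℝ (Pol N) s * ev t (pp N n) * ev s (pp N (n - 1)) := by
      intro s t
      rw [B2_skew]
      linear_combination hPQ t s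
    have hb := B2_pb_ev_pp (N := N) n
    have ha := B2_pa_ev_pp (N := N) n
    have hb' : ∀ s, B2 N (ev s (pp N n)) (pb N (n + 1)) = 0 := fun s => by rw [B2_skew, hb, neg_zero]
    have ha' : ∀ s, B2 N (ev s (pp N n)) (pa N n)
        = - (pa N n * (ev s (pp N (n - 1)) - ev s (pp N n))) := fun s => by rw [B2_skew, ha]
    have hbq : ∀ s, B2 N (pb N (n + 1)) (ev s (pp N (n - 1))) = 0 := fun s =>
      derivation_ev_pp_of_le (k := n)
        (fun m hm => by rw [B2_ba]; split_ifs <;> first | omega | rfl)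
        (fun m hm => by rw [B2_bb]) s _ (by omega)
    have hbq' : ∀ s, B2 N (ev s (pp N (n - 1))) (pb N (n + 1)) = 0 := fun s => by
      rw [B2_skew, hbq, neg_zero]
    have haq : ∀ s, B2 N (pa N n) (ev s (pp N (n - 1))) = 0 := fun s => by
      rcases n with _ | n
      · simp
      · exact B2_pa_ev_pp_of_le (by omega) s
    have haq' : ∀ s, B2 N (ev s (pp N (n - 1))) (pa N n) = 0 := fun s => by
      rw [B2_skew, haq, neg_zero]
    have hab : B2 N (pa N n) (pb N (n + 1)) = pa N n * pb N (n + 1) := by simp [B2_ab]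
    have hba : B2 N (pb N (n + 1)) (pa N n) = - (pa N n * pb N (n + 1)) := by rw [B2_skew, hab]
    refine ⟨fun s t => ?_, hPP, fun s t => ?_⟩
    -- The mixed relation is available only after multiplication by t - s, which can be cancelled
    -- off the diagonal; on the diagonal skew-symmetry suffices.
    · rcases eq_or_ne t s with rfl | hst
      · exact B2_self _
      refine (mul_eq_zero.mp ?_).resolve_left (algebraMap_sub_ne_zero (N := N) hst)
      simp only [hleft, derivation_ev_pp_succ, hPP, hQQ, hb, ha, hb', ha', hbq, haq, hbq', haq', hab,
        hba, B2_self]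
      linear_combination (- (1 - pb N (n + 1) * algebraMap ℝ _ s) * algebraMap ℝ _ t * pa N n) * hPQ s t
        - algebraMap ℝ _ s * pa N n * (1 - pb N (n + 1) * algebraMap ℝ _ t) * hQP s t
    · rw [Nat.add_sub_cancel, hleft, hPP, hb, ha, ev_pp_succ s, ev_pp_succ t]
      linear_combination (- algebraMap ℝ _ s * pa N n) * hQP s t

theorem B2_ev_pp_ev_pp (n : ℕ) (s t : ℝ) : B2 N (ev s (pp N n)) (ev t (pp N n)) = 0 :=
  (B2_ev_pp_aux n).1 s t

theorem B2_ev_pp_ev_pp_pred (n : ℕ) (s t : ℝ) :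
    (algebraMap ℝ (Pol N) t - algebraMap ℝ (Pol N) s)
        * B2 N (ev s (pp N n)) (ev t (pp N (n - 1)))
      = (algebraMap ℝ (Pol N) t - algebraMap ℝ (Pol N) s)
          * (ev s (pp N (n - 1)) * ev t (pp N (n - 1)))
        - algebraMap ℝ (Pol N) t * ev s (pp N n) * ev t (pp N (n - 1))
        + algebraMap ℝ (Pol N) s * ev t (pp N n) * ev s (pp N (n - 1)) :=
  (B2_ev_pp_aux n).2.2 s t

theorem coeff_one_pp (n : ℕ) : (pp N n).coeff 1 = - sS N n := by
  induction n using Nat.twoStepInduction with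
  | zero => simp [pp, sS, coeff_one]
  | one => simp [pp, sS, coeff_one]
  | more n h1 h2 =>
    simp only [pp, sub_mul, one_mul, coeff_sub, mul_assoc, coeff_C_mul, coeff_X_mul, h2,
      coeff_zero_pp, sS]
    ring

theorem coeff_two_pp (n : ℕ) : (pp N n).coeff 2 = sE N n := by
  induction n using Nat.twoStepInduction with
  | zero => simp [pp, sE, coeff_one]
  | one => simp [pp, sE, sS, coeff_one]
  | more n h1 h2 =>
    simp only [pp, sub_mul, one_mul, coeff_sub, mul_assoc, coeff_C_mul, coeff_X_mul, h2,
      coeff_one_pp, sE, Nat.add_sub_cancel]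
    ring

/-- Formal version in the first parameter. -/
theorem extP_left_B2_pp (n : ℕ) (t : ℝ) :
    (C (algebraMap ℝ (Pol N) t) - X) * extP ((B2 N).left (ev t (pp N (n - 1)))) (pp N n)
      = (C (algebraMap ℝ (Pol N) t) - X) * (pp N (n - 1) * C (ev t (pp N (n - 1))))
        - C (algebraMap ℝ (Pol N) t) * pp N n * C (ev t (pp N (n - 1)))
        + X * C (ev t (pp N n)) * pp N (n - 1) := by
  refine polynomial_ext_real ∅ fun s _ => ?_
  simp only [eval_mul, eval_sub, eval_add, eval_C, eval_X, eval_extP]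
  exact B2_ev_pp_ev_pp_pred n s t

/-- Formal version in the second parameter. -/
theorem extP_right_B2_pp (n : ℕ) (s : ℝ) :
    (X - C (algebraMap ℝ (Pol N) s)) * extP (B2 N (ev s (pp N n))) (pp N (n - 1))
      = (X - C (algebraMap ℝ (Pol N) s)) * (C (ev s (pp N (n - 1))) * pp N (n - 1))
        - X * C (ev s (pp N n)) * pp N (n - 1)
        + C (algebraMap ℝ (Pol N) s) * pp N n * C (ev s (pp N (n - 1))) := by
  refine polynomial_ext_real ∅ fun t _ => ?_
  simp only [eval_mul, eval_sub, eval_add, eval_C, eval_X, eval_extP]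
  exact B2_ev_pp_ev_pp_pred n s t

/-- Obtained from the mixed relation as its coefficient of s¹. The neighbouring lemmas extract the
low coefficients and the parameter derivatives that occur in D2(p_N) and D2(p_{N-1}). -/
theorem B2_sS_ev (n : ℕ) (t : ℝ) :
    algebraMap ℝ (Pol N) t * B2 N (sS N n) (ev t (pp N (n - 1)))
      = (1 - (sS N n - sS N (n - 1)) * algebraMap ℝ _ t) * ev t (pp N (n - 1)) - ev t (pp N n) := by
  have h := congrArg (coeff · 1) (extP_left_B2_pp (N := N) n t)
  simp only [sub_mul, coeff_sub, coeff_add, mul_assoc, coeff_C_mul, coeff_X_mul, coeff_mul_C,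
    coeff_extP, coeff_one_pp, coeff_zero_pp, Bider.left_apply, map_neg, Derivation.map_one_eq_zero] at h
  linear_combination -h

theorem B2_ev_sS (n : ℕ) (s : ℝ) :
    algebraMap ℝ (Pol N) s * B2 N (ev s (pp N n)) (sS N (n - 1))
      = (1 - (sS N n - sS N (n - 1)) * algebraMap ℝ _ s) * ev s (pp N (n - 1)) - ev s (pp N n) := by
  have h := congrArg (coeff · 1) (extP_right_B2_pp (N := N) n s)
  simp only [sub_mul, coeff_sub, coeff_add, mul_assoc, coeff_C_mul, coeff_X_mul, coeff_mul_C,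
    coeff_extP, coeff_one_pp, coeff_zero_pp, map_neg, Derivation.map_one_eq_zero] at h
  linear_combination h

theorem B2_ev_sE (n : ℕ) (s : ℝ) :
    algebraMap ℝ (Pol N) s ^ 2 * B2 N (ev s (pp N n)) (sE N (n - 1))
      = - algebraMap ℝ _ s * B2 N (ev s (pp N n)) (sS N (n - 1))
        + algebraMap ℝ _ s * (- sS N (n - 1) * ev s (pp N n)
          + (sS N (n - 1) + (sE N (n - 1) - sE N n) * algebraMap ℝ _ s) * ev s (pp N (n - 1))) := by
  have h := congrArg (coeff · 2) (extP_right_B2_pp (N := N) n s)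
  simp only [sub_mul, coeff_sub, coeff_add, mul_assoc, coeff_C_mul, coeff_X_mul, coeff_mul_C,
    coeff_extP, coeff_one_pp, coeff_two_pp, map_neg] at h
  linear_combination (- algebraMap ℝ (Pol N) s) * h

theorem B2_ev_derivative_ev (n : ℕ) (s t : ℝ) :
    (algebraMap ℝ (Pol N) t - algebraMap ℝ (Pol N) s)
        * B2 N (ev s (derivative (pp N n))) (ev t (pp N (n - 1)))
      = B2 N (ev s (pp N n)) (ev t (pp N (n - 1))) - ev s (pp N (n - 1)) * ev t (pp N (n - 1))
        + (algebraMap ℝ (Pol N) t - algebraMap ℝ (Pol N) s)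
          * (ev s (derivative (pp N (n - 1))) * ev t (pp N (n - 1)))
        - algebraMap ℝ (Pol N) t * ev s (derivative (pp N n)) * ev t (pp N (n - 1))
        + ev t (pp N n) * ev s (pp N (n - 1))
        + algebraMap ℝ (Pol N) s * ev t (pp N n) * ev s (derivative (pp N (n - 1))) := by
  have h := congrArg (ev s ∘ derivative) (extP_left_B2_pp (N := N) n t)
  simp only [Function.comp_apply, derivative_mul, derivative_sub, derivative_add, derivative_C,
    derivative_X, ← extP_derivative, ev, eval_mul, eval_sub, eval_add, eval_C, eval_X, eval_extP,
    eval_one, eval_zero, Bider.left_apply] at h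
  simp only [ev]
  linear_combination h

theorem B2_ev_ev_derivative (n : ℕ) (s t : ℝ) :
    (algebraMap ℝ (Pol N) t - algebraMap ℝ (Pol N) s)
        * B2 N (ev s (pp N n)) (ev t (derivative (pp N (n - 1))))
      = - B2 N (ev s (pp N n)) (ev t (pp N (n - 1))) + ev s (pp N (n - 1)) * ev t (pp N (n - 1))
        + (algebraMap ℝ (Pol N) t - algebraMap ℝ (Pol N) s)
          * (ev s (pp N (n - 1)) * ev t (derivative (pp N (n - 1))))
        - ev s (pp N n) * ev t (pp N (n - 1))
        - algebraMap ℝ (Pol N) t * ev s (pp N n) * ev t (derivative (pp N (n - 1)))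
        + algebraMap ℝ (Pol N) s * ev t (derivative (pp N n)) * ev s (pp N (n - 1)) := by
  have h := congrArg (ev t ∘ derivative) (extP_right_B2_pp (N := N) n s)
  simp only [Function.comp_apply, derivative_mul, derivative_sub, derivative_add, derivative_C,
    derivative_X, ← extP_derivative, ev, eval_mul, eval_sub, eval_add, eval_C, eval_X, eval_extP,
    eval_one, eval_zero] at h
  simp only [ev]
  linear_combination h

end TwoParameter

/-! ### Lenard relations for the fourth bracket -/

section FourthBracket
open Polynomial
variable {N : ℕ}

theorem pb_ne_zero_poly {j : ℕ} (h : 1 ≤ j ∧ j ≤ N) : pb N j ≠ 0 := by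
  rw [pb, dif_pos h]; exact MvPolynomial.X_ne_zero _

theorem pa_ne_zero_poly {j : ℕ} (h : 1 ≤ j ∧ j ≤ N - 1) : pa N j ≠ 0 := by
  rw [pa, dif_pos h]; exact MvPolynomial.X_ne_zero _

theorem coeff_pp_self_ne_zero {n : ℕ} (h : n ≤ N) : (pp N n).coeff n ≠ 0 := by
  induction n with
  | zero => rw [coeff_zero_pp]; exact one_ne_zero
  | succ n ih =>
    have hlt : (pp N (n - 1)).coeff n = 0 ∨ n = 0 := by
      rcases n with _ | n
      · exact .inr rfl
      · exact .inl (coeff_pp_of_lt (by simp))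
    have : (pp N (n + 1)).coeff (n + 1) = - (pb N (n + 1) * (pp N n).coeff n) := by
      rw [pp_succ]
      simp only [sub_mul, one_mul, coeff_sub, mul_assoc, coeff_C_mul, coeff_X_mul,
        coeff_pp_of_lt (Nat.lt_succ_self n)]
      rcases hlt with h0 | rfl
      · rw [h0]; ring
      · simp
    rw [this]
    exact neg_ne_zero.mpr (mul_ne_zero (pb_ne_zero_poly ⟨by omega, h⟩) (ih (by omega)))

/-- The recursion can be run backwards: in D p_{n+2} = 0 the top coefficient isolates D b_{n+2}, the
constant term then isolates D a_{n+1}, and what is left gives D p_n = 0. -/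
theorem derivation_coord_of_extP_pp {D : Derivation ℝ (Pol N) (Pol N)} {n : ℕ} (hn : n + 1 ≤ N)
    (h1 : extP D (pp N (n + 1)) = 0) (h0 : extP D (pp N n) = 0) :
    (∀ j ≤ n, D (pa N j) = 0) ∧ ∀ j ≤ n + 1, D (pb N j) = 0 := by
  have ha0 : D (pa N 0) = 0 := by simp
  have hb0 : D (pb N 0) = 0 := by rw [pb_eq_zero (by omega), map_zero]
  induction n with
  | zero =>
    have hb : D (pb N 1) = 0 := by
      have := congrArg (coeff · 1) h1
      simpa [pp, coeff_one] using this
    exact ⟨fun j hj => by rw [Nat.le_zero.mp hj, ha0], fun j hj => by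
      rcases j with _ | _ | j
      · exact hb0
      · exact hb
      · omega⟩
  | succ n ih =>
    have e : X * (C (D (pb N (n + 2))) * pp N (n + 1) + C (D (pa N (n + 1))) * pp N n
        + C (pa N (n + 1)) * extP D (pp N n)) = 0 := by
      rw [← neg_eq_zero, ← h1]
      simp only [pp, map_sub, Derivation.leibniz, extP_C, extP_X, smul_eq_mul,
        Derivation.map_one_eq_zero, h0]
      ring
    replace e := (mul_eq_zero.mp e).resolve_left X_ne_zero
    have e1 := congrArg (coeff · (n + 1)) e
    simp only [coeff_add, coeff_C_mul, coeff_extP, coeff_pp_of_lt (Nat.lt_succ_self n), map_zero,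
      mul_zero, add_zero, coeff_zero] at e1
    have hb : D (pb N (n + 2)) = 0 :=
      (mul_eq_zero.mp e1).resolve_right (coeff_pp_self_ne_zero (by omega))
    have e2 := congrArg (coeff · 0) e
    simp only [coeff_add, coeff_C_mul, coeff_extP, coeff_zero_pp, hb, Derivation.map_one_eq_zero,
      mul_zero, add_zero, coeff_zero, mul_one, zero_add] at e2
    rw [hb, e2, map_zero, zero_mul, zero_mul, zero_add, zero_add] at e
    have h3 : extP D (pp N n) = 0 := (mul_eq_zero.mp e).resolve_left
      (C_ne_zero.mpr (pa_ne_zero_poly ⟨by omega, by omega⟩))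
    obtain ⟨hA, hB⟩ := ih (by omega) h0 h3
    exact ⟨fun j hj => (Nat.le_succ_iff.mp hj).elim (hA j) fun h => h ▸ e2,
      fun j hj => (Nat.le_succ_iff.mp hj).elim (hB j) fun h => h ▸ hb⟩

theorem derivation_eq_zero_of_extP_pp (hN : 1 ≤ N) {D : Derivation ℝ (Pol N) (Pol N)}
    (h1 : extP D (pp N N) = 0) (h0 : extP D (pp N (N - 1)) = 0) : D = 0 := by
  obtain ⟨n, rfl⟩ : ∃ n, N = n + 1 := ⟨N - 1, by omega⟩
  obtain ⟨hA, hB⟩ := derivation_coord_of_extP_pp le_rfl h1 h0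
  refine separating_coord (fun i => ?_) fun i => ?_
  · by_cases h : i ≤ n
    · exact hA i h
    · rw [pa_eq_zero (by omega), map_zero]
  · by_cases h : i ≤ n + 1
    · exact hB i h
    · rw [pb_eq_zero (by omega), map_zero]

theorem extP_eq_of_ev {D : Derivation ℝ (Pol N) (Pol N)} {F : (Pol N)[X]} (S : Finset ℝ)
    (h : ∀ t ∉ S, D (ev t F) = 0) : extP D F = 0 :=
  polynomial_ext_real S fun t ht => by
    rw [eval_extP, eval_zero]; exact h t ht

theorem X_mul_extP_D2_top : X * extP (D2 N) (pp N N) = derivative (pp N N)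
    + C (sS N N) * pp N N + X * C (sS N N ^ 2 - 2 * sE N N) * pp N N := by
  rw [X_mul_extP_D2_pp]
  simp only [auxA, pa_top, zero_mul, mul_zero, map_zero, add_zero]

/-- The dependence of `auxH` on N pays off here: at n = N - 1 the terms with factor N - n - 1 vanish
and `auxH` becomes -S_{N-1}, so p_{N-1} is sent to an expression in p_N and p_{N-1} alone. -/
theorem X_mul_extP_D2_pred (hN : 1 ≤ N) : X * extP (D2 N) (pp N (N - 1))
    = derivative (pp N (N - 1))
      + X * C (sS N (N - 1) * sS N N - 2 * sE N (N - 1)) * pp N (N - 1)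
      + C (sS N (N - 1)) * pp N N := by
  obtain ⟨n, rfl⟩ : ∃ n, N = n + 1 := ⟨N - 1, by omega⟩
  have hC2 : C (2 : Pol (n + 1)) = 2 := map_ofNat C 2
  have e := pp_succ (N := n + 1) n
  have eS : sS (n + 1) (n + 1) = sS (n + 1) n + pb (n + 1) (n + 1) + pa (n + 1) n := rfl
  have hH : auxH (n + 1) n = - sS (n + 1) n := by
    rw [auxH, eS, pa_top]; push_cast; ring
  rw [Nat.add_sub_cancel, X_mul_extP_D2_pp, auxA, hH, eS]
  simp only [map_add, map_sub, map_mul, map_pow, map_natCast, map_one, map_neg, hC2]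
  push_cast
  linear_combination (- C (sS (n + 1) n)) * e

/-- The fourth bracket. -/
def B4 (N : ℕ) : Bider (Pol N) := lieB (D2 N) (B2 N)

theorem B4_skew : (B4 N).Skew := B2_skew.lieB _

theorem D2_ev_top (s : ℝ) : algebraMap ℝ (Pol N) s * D2 N (ev s (pp N N))
    = ev s (derivative (pp N N)) + sS N N * ev s (pp N N)
      + algebraMap ℝ (Pol N) s * (sS N N ^ 2 - 2 * sE N N) * ev s (pp N N) := by
  have := congrArg (ev s) (X_mul_extP_D2_top (N := N))
  simpa only [ev, eval_mul, eval_add, eval_X, eval_C, eval_extP] using this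

theorem D2_ev_pred (hN : 1 ≤ N) (s : ℝ) : algebraMap ℝ (Pol N) s * D2 N (ev s (pp N (N - 1)))
    = ev s (derivative (pp N (N - 1)))
      + algebraMap ℝ (Pol N) s * (sS N (N - 1) * sS N N - 2 * sE N (N - 1)) * ev s (pp N (N - 1))
      + sS N (N - 1) * ev s (pp N N) := by
  have := congrArg (ev s) (X_mul_extP_D2_pred hN)
  simpa only [ev, eval_mul, eval_add, eval_X, eval_C, eval_extP] using this

/-- The defect of the Lenard relation for the fourth bracket. -/
def defect (N : ℕ) (s : ℝ) : Derivation ℝ (Pol N) (Pol N) :=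
  algebraMap ℝ (Pol N) s ^ 2 • B4 N (ev s (pp N N)) + (2 : Pol N) • (B2 N (ev s (pp N N))
    + (algebraMap ℝ (Pol N) s * ev s (pp N N)) • B2 N (sS N N)
    + (algebraMap ℝ (Pol N) s ^ 2 * ev s (pp N N)) • (sS N N • B2 N (sS N N) - B2 N (sE N N)))

theorem defect_apply (s : ℝ) (g : Pol N) : defect N s g =
    algebraMap ℝ (Pol N) s ^ 2 * (D2 N (B2 N (ev s (pp N N)) g) - B2 N (D2 N (ev s (pp N N))) g
      - B2 N (ev s (pp N N)) (D2 N g))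
    + 2 * (B2 N (ev s (pp N N)) g
    + (algebraMap ℝ (Pol N) s * ev s (pp N N)) * B2 N (sS N N) g
    + (algebraMap ℝ (Pol N) s ^ 2 * ev s (pp N N)) * (sS N N * B2 N (sS N N) g - B2 N (sE N N) g)) := by
  rw [← lieB_apply]; rfl

theorem B2_sS_top_ev (t : ℝ) : B2 N (sS N N) (ev t (pp N N)) = 0 := by
  have h : extP ((B2 N).left (ev t (pp N N))) (pp N N) = 0 :=
    extP_eq_of_ev ∅ fun s _ => B2_ev_pp_ev_pp N s t
  have := congrArg (coeff · 1) h
  simpa [coeff_one_pp] using this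

/-- All ingredients of D2(p_N) are functions of the coefficients of p_N, which commute for π₂; hence
every term vanishes separately. -/
theorem defect_ev_top {s t : ℝ} (hs : s ≠ 0) (ht : t ≠ 0) : defect N s (ev t (pp N N)) = 0 := by
  have key : ∀ {s t : ℝ}, s ≠ 0 → B2 N (D2 N (ev s (pp N N))) (ev t (pp N N)) = 0
      ∧ B2 N (sE N N) (ev t (pp N N)) = 0 := by
    intro s t hs
    have h : extP ((B2 N).left (ev t (pp N N))) (pp N N) = 0 :=
      extP_eq_of_ev ∅ fun s _ => B2_ev_pp_ev_pp N s t
    have hE : B2 N (sE N N) (ev t (pp N N)) = 0 := by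
      have := congrArg (coeff · 2) h
      simpa [coeff_two_pp] using this
    have hS := B2_sS_top_ev (N := N) t
    have hd : (B2 N).left (ev t (pp N N)) (ev s (derivative (pp N N))) = 0 := by
      rw [derivation_ev, extP_derivative, h]; simp [ev]
    have hP : (B2 N).left (ev t (pp N N)) (ev s (pp N N)) = 0 := B2_ev_pp_ev_pp N s t
    have hS' : (B2 N).left (ev t (pp N N)) (sS N N) = 0 := hS
    have hE' : (B2 N).left (ev t (pp N N)) (sE N N) = 0 := hE
    have h2 : (B2 N).left (ev t (pp N N)) 2 = 0 := der_ofNat _ 2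
    have := congrArg ((B2 N).left (ev t (pp N N))) (D2_ev_top (N := N) s)
    simp only [map_add, map_sub, Derivation.leibniz, Derivation.leibniz_pow, hd, hP, hS', hE', h2,
      Derivation.map_algebraMap, smul_zero, add_zero, sub_zero, smul_eq_mul, mul_zero] at this
    exact ⟨(mul_eq_zero.mp this).resolve_left (algebraMap_real_ne_zero hs), hE⟩
  have h1 : B2 N (ev s (pp N N)) (D2 N (ev t (pp N N))) = 0 := by
    rw [B2_skew, (key ht).1, neg_zero]
  rw [defect_apply, B2_ev_pp_ev_pp, (key hs).1, (key hs).2, h1, B2_sS_top_ev]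
  simp

-- Applying D2 to the mixed quadratic relation and substituting the formulas for D2(p_N),
-- D2(p_{N-1}) and their brackets leaves an identity in finitely many independent letters.
set_option maxHeartbeats 1000000 in
theorem defect_ev_pred (hN : 1 ≤ N) {s t : ℝ} (hs : s ≠ 0) (ht : t ≠ 0) (hst : t ≠ s) :
    defect N s (ev t (pp N (N - 1))) = 0 := by
  have h2 (D : Derivation ℝ (Pol N) (Pol N)) : D 2 = 0 := der_ofNat _ 2
  have hA := B2_ev_pp_ev_pp_pred (N := N) N s t
  have hV := congrArg (D2 N) hA
  simp only [map_add, map_sub, Derivation.leibniz, Derivation.map_algebraMap, smul_eq_mul,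
    mul_zero, add_zero, sub_self] at hV
  have e1 := D2_ev_top (N := N) s
  have e2 := D2_ev_pred hN s
  have e3 := D2_ev_top (N := N) t
  have e4 := D2_ev_pred hN t
  have hPP := B2_ev_pp_ev_pp (N := N) N s t
  have hPS : B2 N (ev s (pp N N)) (sS N N) = 0 := by rw [B2_skew, B2_sS_top_ev, neg_zero]
  have hX1 := congrArg ((B2 N).left (ev t (pp N (N - 1)))) e1
  simp only [map_add, map_sub, Derivation.leibniz, Derivation.leibniz_pow, Derivation.map_algebraMap,
    smul_eq_mul, mul_zero, add_zero, h2, Bider.left_apply, nsmul_eq_mul] at hX1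
  have hX2 := congrArg (B2 N (ev s (pp N N))) e4
  simp only [map_add, map_sub, Derivation.leibniz, Derivation.map_algebraMap,
    smul_eq_mul, mul_zero, add_zero, h2, hPP, hPS] at hX2
  have hD1 := B2_ev_derivative_ev (N := N) N s t
  have hD2 := B2_ev_ev_derivative (N := N) N s t
  have hT := B2_sS_ev (N := N) N t
  have hW := B2_ev_sS (N := N) N s
  have hF := B2_ev_sE (N := N) N s
  rw [defect_apply]
  -- The source relations determine their unknowns only up to factors s, t and t - s; this
  -- multiplier clears all of them.
  have hne : algebraMap ℝ (Pol N) s * algebraMap ℝ (Pol N) t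
      * (algebraMap ℝ (Pol N) t - algebraMap ℝ (Pol N) s) ^ 2 ≠ 0 :=
    mul_ne_zero (mul_ne_zero (algebraMap_real_ne_zero hs) (algebraMap_real_ne_zero ht))
      (pow_ne_zero 2 (algebraMap_sub_ne_zero hst))
  refine (mul_eq_zero.mp ?_).resolve_left hne
  generalize algebraMap ℝ (Pol N) s = S at *
  generalize algebraMap ℝ (Pol N) t = T at *
  generalize ev s (pp N N) = P at *
  generalize ev s (pp N (N - 1)) = Q at *
  generalize ev t (pp N N) = P' at *
  generalize ev t (pp N (N - 1)) = Q' at *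
  generalize sS N N = τ at *
  generalize sS N (N - 1) = σ at *
  generalize sE N N = e at *
  generalize sE N (N - 1) = f at *
  linear_combination (S ^ 3 * T * (T - S)) * hV
    + (S ^ 2 * T * (T - S) * ((T - S) * Q' + S * P')) * e2
    + (S ^ 3 * (T - S) * ((T - S) * Q - T * P)) * e4
    - (S ^ 2 * T ^ 2 * (T - S) * Q') * e1 + (S ^ 4 * (T - S) * Q) * e3
    - (S ^ 2 * T * (T - S) ^ 2) * hX1 - (S ^ 2 * T * (T - S)) * hD1
    - (S ^ 3 * (T - S) ^ 2) * hX2 - (S ^ 3 * (T - S)) * hD2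
    + (2 * T * S * (T - S) ^ 2 * Q') * hF
    + (- S ^ 2 * (T - S) ^ 2 * (T * τ * Q' + P') - 2 * T * S * (T - S) ^ 2 * Q') * hW
    + (S ^ 2 * (T - S) ^ 2 * P) * hT
    + (- S ^ 2 * T * (T - S) * (τ + S * (τ ^ 2 - 2 * e)) - S ^ 2 * T
      - S ^ 3 * (T - S) * T * (σ * τ - 2 * f) + S ^ 3 + 2 * T * (T - S) * S) * hA

end FourthBracket

/-! ### The fourth bracket -/

section FourthPoisson
open Polynomial
variable {N : ℕ}

theorem defect_eq_zero (hN : 1 ≤ N) {s : ℝ} (hs : s ≠ 0) : defect N s = 0 :=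
  derivation_eq_zero_of_extP_pp hN
    (extP_eq_of_ev {0} fun _ ht => defect_ev_top hs (by simpa using ht))
    (extP_eq_of_ev {0, s} fun t ht => by
      simp only [Finset.mem_insert, Finset.mem_singleton, not_or] at ht
      exact defect_ev_pred hN hs ht.1 ht.2)

theorem X_sq_mul_extP_B4 (hN : 1 ≤ N) (g : Pol N) : X ^ 2 * extP ((B4 N).left g) (pp N N)
    = - 2 * (extP ((B2 N).left g) (pp N N) + X * C (B2 N (sS N N) g) * pp N N
      + X ^ 2 * C (sS N N * B2 N (sS N N) g - B2 N (sE N N) g) * pp N N) := by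
  refine polynomial_ext_real {0} fun s hs => ?_
  have h := DFunLike.congr_fun (defect_eq_zero hN (s := s) (by simpa using hs)) g
  have h' : algebraMap ℝ (Pol N) s ^ 2 * B4 N (ev s (pp N N)) g + 2 * (B2 N (ev s (pp N N)) g
    + (algebraMap ℝ (Pol N) s * ev s (pp N N)) * B2 N (sS N N) g
    + (algebraMap ℝ (Pol N) s ^ 2 * ev s (pp N N)) * (sS N N * B2 N (sS N N) g - B2 N (sE N N) g)) = 0 := h
  simp only [eval_mul, eval_add, eval_pow, eval_X, eval_C, eval_extP, Bider.left_apply, eval_neg,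
    eval_ofNat]
  simp only [ev] at h'
  linear_combination h'

/-- The relation `{H_m, ·}_4 = -2 {H_{m+2}, ·}_2`. -/
theorem B4_HamP (hN : 1 ≤ N) {m : ℕ} (hm : 1 ≤ m) :
    B4 N (HamP N m) = - (2 : Pol N) • B2 N (HamP N (m + 2)) := by
  refine DFunLike.ext _ _ fun g => ?_
  have h := congrArg (fun F : (Pol N)[X] => (F : PowerSeries (Pol N))) (X_sq_mul_extP_B4 hN g)
  have h2 : ((-2 : (Pol N)[X]) : PowerSeries (Pol N)) = PowerSeries.C (-2) := by
    rw [← Polynomial.coe_C, map_neg, map_ofNat]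
  simp only [Polynomial.coe_mul, Polynomial.coe_add, Polynomial.coe_pow, Polynomial.coe_C,
    Polynomial.coe_X, coe_extP, extPS_pp, h2] at h
  have h3 : PowerSeries.X ^ 2 * extPS ((B4 N).left g) (hamSeries N) = PowerSeries.C (-2) *
      (extPS ((B2 N).left g) (hamSeries N) - PowerSeries.X * PowerSeries.C (B2 N (sS N N) g)
        - PowerSeries.X ^ 2 * PowerSeries.C (sS N N * B2 N (sS N N) g - B2 N (sE N N) g)) := by
    refine (pp_coe_isUnit (N := N) N).mul_left_cancel ?_
    linear_combination -h
  have h4 := congrArg (PowerSeries.coeff (m + 2)) h3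
  rw [PowerSeries.coeff_X_pow_mul, PowerSeries.coeff_C_mul, map_sub, map_sub,
    PowerSeries.coeff_X_pow_mul, PowerSeries.coeff_succ_X_mul, PowerSeries.coeff_C,
    PowerSeries.coeff_C, if_neg (by omega), if_neg (by omega), coeff_extPS, coeff_extPS, sub_zero,
    sub_zero] at h4
  simpa [hamSeries] using h4

theorem D2_HamP {m : ℕ} (hm : 1 ≤ m) : D2 N (HamP N m) = ((m : Pol N) + 2) * HamP N (m + 2) := by
  have h := congrArg (fun F : (Pol N)[X] => (F : PowerSeries (Pol N))) (X_mul_extP_D2_top (N := N))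
  simp only [Polynomial.coe_mul, Polynomial.coe_add, Polynomial.coe_C,
    Polynomial.coe_X, coe_extP, extPS_pp, derivative_pp] at h
  have h3 : PowerSeries.X * extPS (D2 N) (hamSeries N) = PowerSeries.derivative (Pol N) (hamSeries N)
      - PowerSeries.C (sS N N) - PowerSeries.X * PowerSeries.C (sS N N ^ 2 - 2 * sE N N) := by
    refine (pp_coe_isUnit (N := N) N).mul_left_cancel ?_
    linear_combination -h
  have h4 := congrArg (PowerSeries.coeff (m + 1)) h3
  rw [PowerSeries.coeff_succ_X_mul, map_sub, map_sub, PowerSeries.coeff_succ_X_mul,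
    PowerSeries.coeff_C, PowerSeries.coeff_C, if_neg (by omega), if_neg (by omega), coeff_extPS,
    PowerSeries.coeff_derivative, sub_zero, sub_zero] at h4
  simp only [hamSeries, PowerSeries.coeff_mk] at h4
  rw [h4]; push_cast; ring

theorem B4_HamP_HamP (hN : 1 ≤ N) {m : ℕ} (hm : 1 ≤ m) (n : ℕ) :
    B4 N (HamP N m) (HamP N n) = 0 := by
  rw [B4_HamP hN hm, Derivation.smul_apply, B2_HamP_HamP, smul_zero]

/-- Because the π₂ bracket of these functions vanishes, the π₄ bracket is the antisymmetrization of
-{D2 p_{N-1}(s), p_{N-1}(t)}₂, and `key` shows that quantity to be symmetric in s and t. -/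
theorem B4_ev_pred_ev_pred (hN : 1 ≤ N) {s t : ℝ} (hs : s ≠ 0) (ht : t ≠ 0) (hst : t ≠ s) :
    B4 N (ev s (pp N (N - 1))) (ev t (pp N (N - 1))) = 0 := by
  have h2 (D : Derivation ℝ (Pol N) (Pol N)) : D 2 = 0 := der_ofNat _ 2
  have hQQ : ∀ s t : ℝ, B2 N (ev s (pp N (N - 1))) (ev t (pp N (N - 1))) = 0 :=
    B2_ev_pp_ev_pp (N - 1)
  have key : ∀ s t : ℝ, algebraMap ℝ (Pol N) s * algebraMap ℝ (Pol N) t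
      * (algebraMap ℝ (Pol N) t - algebraMap ℝ (Pol N) s)
      * B2 N (D2 N (ev s (pp N (N - 1)))) (ev t (pp N (N - 1)))
      = sS N (N - 1) * (algebraMap ℝ (Pol N) s * ev s (pp N (N - 1))
        * (algebraMap ℝ (Pol N) t - algebraMap ℝ (Pol N) s)
        * ((1 - (sS N N - sS N (N - 1)) * algebraMap ℝ _ t) * ev t (pp N (N - 1)) - ev t (pp N N))
      + algebraMap ℝ (Pol N) t * ((algebraMap ℝ (Pol N) t - algebraMap ℝ (Pol N) s)
          * (ev s (pp N (N - 1)) * ev t (pp N (N - 1)))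
        - algebraMap ℝ (Pol N) t * ev s (pp N N) * ev t (pp N (N - 1))
        + algebraMap ℝ (Pol N) s * ev t (pp N N) * ev s (pp N (N - 1)))) := by
    intro s t
    have h : extP ((B2 N).left (ev t (pp N (N - 1)))) (pp N (N - 1)) = 0 :=
      extP_eq_of_ev ∅ fun s _ => hQQ s t
    have hd : B2 N (ev s (derivative (pp N (N - 1)))) (ev t (pp N (N - 1))) = 0 := by
      rw [← Bider.left_apply, derivation_ev, extP_derivative, h]; simp [ev]
    have hσ : B2 N (sS N (N - 1)) (ev t (pp N (N - 1))) = 0 := by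
      have := congrArg (coeff · 1) h
      simpa [coeff_one_pp] using this
    have hf : B2 N (sE N (N - 1)) (ev t (pp N (N - 1))) = 0 := by
      have := congrArg (coeff · 2) h
      simpa [coeff_two_pp] using this
    have e := congrArg ((B2 N).left (ev t (pp N (N - 1)))) (D2_ev_pred hN s)
    simp only [map_add, map_sub, Derivation.leibniz, Derivation.map_algebraMap, smul_eq_mul,
      mul_zero, add_zero, h2, Bider.left_apply, hd, hσ, hf, hQQ] at e
    have hT := B2_sS_ev (N := N) N t
    have hA := B2_ev_pp_ev_pp_pred (N := N) N s t
    linear_combination (algebraMap ℝ (Pol N) t * (algebraMap ℝ (Pol N) t - algebraMap ℝ (Pol N) s)) * e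
      + (algebraMap ℝ (Pol N) s * sS N (N - 1) * ev s (pp N (N - 1))
          * (algebraMap ℝ (Pol N) t - algebraMap ℝ (Pol N) s)) * hT
      + (algebraMap ℝ (Pol N) t * sS N (N - 1)) * hA
  have hne : algebraMap ℝ (Pol N) s * algebraMap ℝ (Pol N) t
      * (algebraMap ℝ (Pol N) t - algebraMap ℝ (Pol N) s) ≠ 0 :=
    mul_ne_zero (mul_ne_zero (algebraMap_real_ne_zero hs) (algebraMap_real_ne_zero ht))
      (algebraMap_sub_ne_zero hst)
  refine (mul_eq_zero.mp ?_).resolve_left hne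
  rw [B4, lieB_apply, hQQ, map_zero, B2_skew (ev s (pp N (N - 1))) (D2 N _)]
  linear_combination - key s t - key t s

theorem coeff_pred_B4 (hN : 1 ≤ N) (j k : ℕ) :
    B4 N ((pp N (N - 1)).coeff j) ((pp N (N - 1)).coeff k) = 0 := by
  have h1 : ∀ s : ℝ, s ≠ 0 → extP (B4 N (ev s (pp N (N - 1)))) (pp N (N - 1)) = 0 := fun s hs =>
    extP_eq_of_ev {0, s} fun t ht => by
      simp only [Finset.mem_insert, Finset.mem_singleton, not_or] at ht
      exact B4_ev_pred_ev_pred hN hs ht.1 ht.2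
  have h2 : extP ((B4 N).left ((pp N (N - 1)).coeff k)) (pp N (N - 1)) = 0 :=
    extP_eq_of_ev {0} fun s hs => by
      simpa using congrArg (coeff · k) (h1 s (by simpa using hs))
  simpa using congrArg (coeff · j) h2

/-- The H_m control p_N, and p_N together with p_{N-1} controls all coordinates. -/
theorem separating_coeff (hN : 1 ≤ N) : Separating
    (Set.range (HamP N) ∪ Set.range fun k => (pp N (N - 1)).coeff k) := fun D hD => by
  refine derivation_eq_zero_of_extP_pp hN
    (extP_eq_zero_of_ham fun m _ => hD _ (.inl ⟨m, rfl⟩)) ?_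
  ext1 k
  rw [coeff_extP, coeff_zero, hD _ (.inr ⟨k, rfl⟩)]

theorem schouten_B2_B4 (f g h : Pol N) : schouten (B2 N) (B4 N) f g h = 0 := by
  have := schouten_lieB_of_eq_zero schouten_B2_B2 (D2 N) f g h
  change schouten (B4 N) (B2 N) f g h + schouten (B2 N) (B4 N) f g h = 0 at this
  rw [schouten_comm (B4 N), ← two_mul] at this
  exact (mul_eq_zero.mp this).resolve_left two_ne_zero

/-- With first argument F the mixed Schouten bracket is L_{B F} B' + L_{B' F} B. The second term is
c L_{B G} B = 0, since c is a constant and Hamiltonian fields preserve a Poisson tensor. -/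
theorem lieB_ham_eq_zero_of_schouten {B B' : Bider (Pol N)} {F : Pol N} {c : Pol N} {G : Pol N}
    (h0 : ∀ f g h, schouten B B f g h = 0) (h1 : ∀ f g h, schouten B B' f g h = 0)
    (hc : ∀ D : Derivation ℝ (Pol N) (Pol N), D c = 0) (hF : B' F = c • B G) (g h : Pol N) :
    lieB (B F) B' g h = 0 := by
  have e1 := h1 F g h
  have e2 := DFunLike.congr_fun (DFunLike.congr_fun (lieB_ham_self h0 G) g) h
  have e3 := hc (B g)
  have e4 : B c = 0 := by
    ext1 i
    rw [← Bider.left_apply, hc]; rfl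
  simp only [schouten, lieB_apply, hF, Derivation.smul_apply, smul_eq_mul, bider_mul_right,
    bider_mul_left, e3, e4, Derivation.zero_apply] at e1 e2 ⊢
  linear_combination e1 - c * e2

theorem neg_two_const (D : Derivation ℝ (Pol N) (Pol N)) : D (-2) = 0 := by
  rw [map_neg, der_ofNat, neg_zero]

theorem schouten_B4_HamP (hN : 1 ≤ N) {m : ℕ} (hm : 1 ≤ m) (g h : Pol N) :
    schouten (B4 N) (B4 N) (HamP N m) g h = 0 := by
  have e := lieB_ham_eq_zero_of_schouten schouten_B2_B2 schouten_B2_B4 neg_two_const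
    (B4_HamP hN (m := m + 2) (by omega)) g h
  have e4 : B4 N (-2) = 0 := by rw [map_neg, bider_ofNat, neg_zero]
  simp only [schouten, lieB_apply, B4_HamP hN hm, Derivation.smul_apply, smul_eq_mul,
    bider_mul_left, bider_mul_right, neg_two_const, e4, Derivation.zero_apply] at e ⊢
  linear_combination (-4) * e

/-- If an argument is some H_m, its π₄ field is -2 times the π₂ field of H_{m+2}, which preserves
π₄. If all three are coefficients of p_{N-1}, their pairwise brackets already vanish. -/
theorem schouten_B4_B4 (hN : 1 ≤ N) (f g h : Pol N) : schouten (B4 N) (B4 N) f g h = 0 := by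
  have hH : ∀ m g h, schouten (B4 N) (B4 N) (HamP N m) g h = 0 := by
    intro m g h
    rcases m with _ | m
    · rw [HamP_zero]; simp [schouten]
    · exact schouten_B4_HamP hN (by omega) g h
  refine schouten_of_separating (separating_coeff hN) B4_skew B4_skew ?_ f g h
  rintro _ (⟨m, rfl⟩ | ⟨i, rfl⟩) g hg k hk
  · exact hH m g k
  rcases hg with ⟨m, rfl⟩ | ⟨j, rfl⟩
  · rw [schouten_swap_left B4_skew B4_skew, hH, neg_zero]
  rcases hk with ⟨m, rfl⟩ | ⟨k, rfl⟩
  · rw [schouten_swap_right B4_skew B4_skew, schouten_swap_left B4_skew B4_skew, hH]; simp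
  · simp only [schouten, coeff_pred_B4 hN, map_zero, Derivation.zero_apply]; simp

/-- A derivation with the properties of a second master symmetry. -/
structure IsSecondMaster (D : Derivation ℝ (Pol N) (Pol N)) : Prop where
  ham : ∀ m, 1 ≤ m → D (HamP N m) = ((m : Pol N) + 2) * HamP N (m + 2)
  lie : lieB D (B2 N) = B4 N

/-- A π₂-Hamiltonian field leaves π₂ invariant, and F commutes with the H_m. This is the freedom
used to match the prescribed vector field for N = 3. -/
theorem isSecondMaster_add_ham (F : Pol N) (hF : ∀ m, B2 N F (HamP N m) = 0) :
    IsSecondMaster (D2 N + B2 N F) where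
  ham m hm := by rw [Derivation.add_apply, D2_HamP hm, hF, add_zero]
  lie := by rw [lieB_add_left, lieB_ham_self schouten_B2_B2, add_zero]; rfl

theorem IsSecondMaster.lie_chi {D : Derivation ℝ (Pol N) (Pol N)} (hD : IsSecondMaster D)
    (hN : 1 ≤ N) : ⁅D, B2 N (HamP N 1)⁆ = B2 N (HamP N 3) := by
  refine DFunLike.ext _ _ fun g => ?_
  have h2 := congrArg (fun B : Bider (Pol N) => B (HamP N 1) g) hD.lie
  have e2 : D (HamP N 1) = ((3 : ℕ) : Pol N) * HamP N 3 := by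
    rw [hD.ham 1 le_rfl]; norm_num
  simp only [lieB_apply, e2, bider_natCast_mul, B4_HamP hN le_rfl,
    Derivation.smul_apply, smul_eq_mul] at h2
  push_cast at h2
  rw [Derivation.commutator_apply]
  linear_combination h2

/-- Evaluating L_D π₂ = π₄ at H_{m+2} shows that the coefficients of {H_{m+4}, ·}₂ add up to (m+4) -
2 - (m+2) = 0. -/
theorem IsSecondMaster.lieB_B4_HamP {D : Derivation ℝ (Pol N) (Pol N)} (hD : IsSecondMaster D)
    (hN : 1 ≤ N) {m : ℕ} (hm : 1 ≤ m) : lieB D (B4 N) (HamP N m) = 0 := by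
  refine DFunLike.ext _ _ fun g => ?_
  have h2 := congrArg (fun B : Bider (Pol N) => B (HamP N (m + 2)) g) hD.lie
  have e1 : D (HamP N m) = ((m + 2 : ℕ) : Pol N) * HamP N (m + 2) := by
    rw [hD.ham m hm]; push_cast; ring
  have e2 : D (HamP N (m + 2)) = ((m + 4 : ℕ) : Pol N) * HamP N (m + 4) := by
    rw [hD.ham (m + 2) (by omega)]; push_cast; ring
  simp only [lieB_apply, e1, e2, bider_natCast_mul, B4_HamP hN hm,
    B4_HamP hN (m := m + 2) (by omega), Derivation.smul_apply, smul_eq_mul,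
    Derivation.zero_apply] at h2 ⊢
  rw [Derivation.leibniz, neg_two_const, smul_zero, add_zero, smul_eq_mul]
  push_cast at h2 ⊢
  linear_combination (-2) * h2

theorem IsSecondMaster.conclusion {D : Derivation ℝ (Pol N) (Pol N)} (hD : IsSecondMaster D)
    (hN : 2 ≤ N) :
    ContDiff ℝ ∞ (vfOf D) ∧
      (∀ m : ℕ, 1 ≤ m → ∀ x, along (vfOf D) (Ham N m) x = ((m : ℝ) + 2) * Ham N (m + 2) x) ∧
      IsMasterSymmetry (vfOf D) (todaVF N) ∧
      IsPoisson (lieDeriv (vfOf D) (pi2 N)) ∧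
      HamsInvolution (lieDeriv (vfOf D) (pi2 N)) ∧
      EigenvaluesInvolution (lieDeriv (vfOf D) (pi2 N)) ∧
      IsTrivialBracket (lieDeriv (vfOf D) (lieDeriv (vfOf D) (pi2 N))) := by
  have h4 : lieDeriv (vfOf D) (pi2 N) = tensorOf (B4 N) := by
    rw [← tensorOf_B2, lieDeriv_tensorOf, hD.lie]
  have hH : ∀ m n, 1 ≤ m → 1 ≤ n → B4 N (HamP N m) (HamP N n) = 0 := fun m n hm _ =>
    B4_HamP_HamP (by omega) hm n
  rw [h4]
  refine ⟨contDiff_vfOf D, fun m hm x => ?_, ?_, isPoisson_tensorOf B4_skew (schouten_B4_B4 (by omega)),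
    hamsInvolution_tensorOf hH, eigenvaluesInvolution_tensorOf B4_skew hH, fun m hm => ?_⟩
  · rw [← fn_HamP, along_vfOf, hD.ham m hm, ← fn_HamP]
    simp [fn]
  · exact isMasterSymmetry_of_lie hN (m := 2) (hD.lie_chi (by omega))
  · rw [lieDeriv_tensorOf, ← fn_HamP]
    exact isCasimirOn_univ_fn (hD.lieB_B4_HamP (by omega) hm)

end FourthPoisson

/-! ### The second master symmetry for three particles -/

section ThreeParticles
variable {N : ℕ}

/-- The Hamiltonian `2 H_2 - H_1^2 / 2`. -/
def correction (N : ℕ) : Pol N := 2 * HamP N 2 - MvPolynomial.C (1 / 2) * HamP N 1 ^ 2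

theorem B2_correction (g : Pol N) : B2 N (correction N) g
    = B2 N ((laxP N ^ 2).trace) g - HamP N 1 * B2 N (HamP N 1) g := by
  have h := trace_eq_HamP (N := N) 1
  have h2 : (MvPolynomial.C (1 / 2) : Pol N) * 2 = 1 := by
    rw [← map_ofNat (MvPolynomial.C : ℝ →+* Pol N) 2, ← map_mul, ← map_one MvPolynomial.C]
    norm_num
  have e2 : B2 N (2 : Pol N) = 0 := bider_ofNat _ 2
  have eC : B2 N (MvPolynomial.C (1 / 2) : Pol N) = 0 := (B2 N).map_algebraMap _
  norm_num at h
  rw [h, correction, map_sub, Derivation.sub_apply, pow_two]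
  simp only [bider_mul_left, e2, eC,
    Derivation.zero_apply]
  linear_combination - HamP N 1 * B2 N (HamP N 1) g * h2

theorem B2_correction_HamP (m : ℕ) : B2 N (correction N) (HamP N m) = 0 := by
  have h := trace_eq_HamP (N := N) 1
  have e2 : B2 N (2 : Pol N) = 0 := bider_ofNat _ 2
  norm_num at h
  rw [B2_correction, h, bider_mul_left]
  simp [B2_HamP_HamP, e2]

/-- A second master symmetry. -/
def Z2 (N : ℕ) : Derivation ℝ (Pol N) (Pol N) := D2 N + B2 N (correction N)

theorem isSecondMaster_Z2 : IsSecondMaster (Z2 N) :=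
  isSecondMaster_add_ham _ B2_correction_HamP

theorem trace_laxP_three : (laxP 3 ^ 2).trace = (pa 3 1 + pb 3 1) ^ 2 + (pa 3 2 + pb 3 2) ^ 2
    + pb 3 3 ^ 2 + 2 * pa 3 1 * (pa 3 2 + pb 3 2) + 2 * pa 3 2 * pb 3 3 := by
  have h3 : pa 3 3 = 0 := pa_top
  simp [pow_two, Matrix.trace_fin_three, Matrix.mul_apply, Fin.sum_univ_three, laxP, laxOf, h3]
  ring

theorem B2_trace_laxP_three (g : Pol 3) : B2 3 ((laxP 3 ^ 2).trace) g =
    2 * ((pa 3 1 + pb 3 1 + pa 3 2 + pb 3 2) * B2 3 (pa 3 1) g + (pa 3 1 + pb 3 1) * B2 3 (pb 3 1) g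
      + (pa 3 1 + pa 3 2 + pb 3 2 + pb 3 3) * B2 3 (pa 3 2) g
      + (pa 3 1 + pa 3 2 + pb 3 2) * B2 3 (pb 3 2) g + (pb 3 3 + pa 3 2) * B2 3 (pb 3 3) g) := by
  have e2 : B2 3 (2 : Pol 3) = 0 := bider_ofNat _ 2
  rw [trace_laxP_three]
  simp only [pow_two, map_add, bider_mul_left, Derivation.add_apply, e2, Derivation.zero_apply]
  ring

theorem vfOf_Z2_three : vfOf (Z2 3) = X2three 3 := by
  have hH : HamP 3 1 = pa 3 1 + pb 3 1 + (pa 3 2 + pb 3 2) + pb 3 3 := by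
    have h3 : pa 3 3 = 0 := pa_top
    rw [HamP_one]; simp [Finset.sum_range_succ, h3]
  have a0 : pa 3 0 = 0 := pa_zero
  have a3 : pa 3 3 = 0 := pa_top
  have a4 : pa 3 4 = 0 := pa_eq_zero (by omega)
  have b0 : pb 3 0 = 0 := pb_eq_zero (by omega)
  have b4 : pb 3 4 = 0 := pb_eq_zero (by omega)
  have key : ∀ (F G : Pol 3), F = G → ∀ x, fn F x = fn G x := fun F G h x => by rw [h]
  have ha : ∀ i, B2 3 (correction 3) (pa 3 (i + 1)) = _ := fun i => by
    rw [B2_correction, B2_trace_laxP_three, B2_HamP_one_pa, hH, B2_aa, B2_aa, B2_ba, B2_ba, B2_ba]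
  have hb : ∀ i, B2 3 (correction 3) (pb 3 (i + 1)) = _ := fun i => by
    rw [B2_correction, B2_trace_laxP_three, B2_HamP_one_pb, hH, B2_ab, B2_ab, B2_bb, B2_bb, B2_bb]
  ext x k
  rcases k with i | i
  · rw [vfOf, X_inl, Z2, Derivation.add_apply, D2_pa, ha]
    fin_cases i
    all_goals
      simp [auxA, auxH, sE, sS, a0, a3, a4, b0, b4, X2three, mkVec, ← fn_pa, ← fn_pb, fn]
      ring
  · rw [vfOf, X_inr, Z2, Derivation.add_apply, D2_pb, hb]
    fin_cases i
    all_goals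
      simp [auxA, auxH, sE, sS, a0, a3, a4, b0, b4, X2three, mkVec, ← fn_pa, ← fn_pb, fn]
      ring

end ThreeParticles

/-! ### Canonical variables -/

section Canonical
variable {N : ℕ}

/-- The coordinate `q_j` as a linear form. -/
def qL (N j : ℕ) : (CanIdx N → ℝ) →L[ℝ] ℝ :=
  if h : 1 ≤ j ∧ j ≤ N then .proj (Sum.inl ⟨j - 1, by omega⟩) else 0

/-- The coordinate `p_j` as a linear form. -/
def pL (N j : ℕ) : (CanIdx N → ℝ) →L[ℝ] ℝ :=
  if h : 1 ≤ j ∧ j ≤ N then .proj (Sum.inr ⟨j - 1, by omega⟩) else 0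

theorem qL_apply (j : ℕ) (z : CanIdx N → ℝ) : qL N j z = q z j := by
  unfold qL q; split_ifs <;> simp

theorem pL_apply (j : ℕ) (z : CanIdx N → ℝ) : pL N j z = p z j := by
  unfold pL p; split_ifs <;> simp

theorem q_single_inl (j : ℕ) (k : Fin N) :
    q (Pi.single (Sum.inl k) 1) j = if j = k + 1 then 1 else 0 := by
  have := k.2
  unfold q
  split_ifs with h1 h2 h2
  · rw [Pi.single_apply, if_pos]; simp [Fin.ext_iff]; omega
  · rw [Pi.single_apply, if_neg]; simp [Fin.ext_iff]; omega
  · omega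
  · rfl

theorem p_single_inr (j : ℕ) (k : Fin N) :
    p (Pi.single (Sum.inr k) 1) j = if j = k + 1 then 1 else 0 := by
  have := k.2
  unfold p
  split_ifs with h1 h2 h2
  · rw [Pi.single_apply, if_pos]; simp [Fin.ext_iff]; omega
  · rw [Pi.single_apply, if_neg]; simp [Fin.ext_iff]; omega
  · omega
  · rfl

theorem q_single_inr (j : ℕ) (k : Fin N) : q (Pi.single (Sum.inr k) 1) j = 0 := by
  unfold q; split_ifs <;> simp

theorem p_single_inl (j : ℕ) (k : Fin N) : p (Pi.single (Sum.inl k) 1) j = 0 := by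
  unfold p; split_ifs <;> simp

theorem hasFDerivAt_q (j : ℕ) (z : CanIdx N → ℝ) : HasFDerivAt (fun z => q z j) (qL N j) z := by
  simpa only [← qL_apply] using (qL N j).hasFDerivAt

theorem hasFDerivAt_p (j : ℕ) (z : CanIdx N → ℝ) : HasFDerivAt (fun z => p z j) (pL N j) z := by
  simpa only [← pL_apply] using (pL N j).hasFDerivAt

variable (g : ℝ) (z : CanIdx N → ℝ)

theorem link_pos (j : ℕ) : 0 < link g z j := by
  unfold link; split_ifs
  · positivity
  · exact one_pos

theorem link_sq {j : ℕ} (h : 1 ≤ j ∧ j ≤ N - 1) :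
    link g z j ^ 2 = 1 + g ^ 2 * Real.exp (q z j - q z (j + 1)) := by
  rw [link, if_pos h, Real.sq_sqrt (by positivity)]

/-- Half the logarithmic derivative of `link g z j ^ 2`. -/
def linkRate (j : ℕ) : ℝ := (link g z j ^ 2 - 1) / (2 * link g z j ^ 2)

theorem linkRate_eq_zero {j : ℕ} (h : ¬ (1 ≤ j ∧ j ≤ N - 1)) : linkRate g z j = 0 := by
  simp [linkRate, link, h]

theorem hasFDerivAt_link (j : ℕ) : HasFDerivAt (fun z => link g z j)
    ((linkRate g z j * link g z j) • (qL N j - qL N (j + 1))) z := by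
  by_cases h : 1 ≤ j ∧ j ≤ N - 1
  · have e : (fun z : CanIdx N → ℝ => link g z j)
        = fun z => Real.sqrt (1 + g ^ 2 * Real.exp (q z j - q z (j + 1))) := by
      ext z; rw [link, if_pos h]
    have h1 := ((((hasFDerivAt_q j z).sub (hasFDerivAt_q (j + 1) z)).exp.const_mul (g ^ 2)).const_add
      1).sqrt (by positivity)
    rw [e]
    refine h1.congr_fderiv ?_
    have hl : Real.sqrt (1 + g ^ 2 * Real.exp (q z j - q z (j + 1))) = link g z j := by
      rw [link, if_pos h]
    have hp := link_pos g z j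
    have h2 := link_sq g z h
    simp only [Pi.sub_apply] at hl ⊢
    rw [hl, smul_smul, smul_smul]
    congr 1
    rw [linkRate]
    field_simp
    linarith
  · have e : (fun z : CanIdx N → ℝ => link g z j) = fun _ => 1 := by
      ext z; rw [link, if_neg h]
    rw [e, linkRate_eq_zero g z h, zero_mul, zero_smul]
    exact hasFDerivAt_const 1 z

theorem fderiv_canHam (k : Fin N) : pd (Sum.inr k) (canHam N g) z
    = Real.exp (p z (k + 1)) * link g z k * link g z (k + 1) := by
  have h : ∀ j ∈ Finset.Icc 1 N, HasFDerivAt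
      (fun z => Real.exp (p z j) * link g z (j - 1) * link g z j) _ z := fun j _ =>
    ((hasFDerivAt_p j z).exp.mul (hasFDerivAt_link g z (j - 1))).mul (hasFDerivAt_link g z j)
  have hs : HasFDerivAt (canHam N g) _ z := HasFDerivAt.fun_sum h
  have hk := k.2
  rw [pd, hs.fderiv, FunLike.coe_sum, Finset.sum_apply, Finset.sum_eq_single (k.val + 1)]
  · simp [qL_apply, pL_apply, q_single_inr, p_single_inr]
    ring
  · intro j _ hj
    simp [qL_apply, pL_apply, q_single_inr, p_single_inr, hj]
  · intro h; simp at h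

/-- The coordinate `b_j` in canonical variables. -/
def bCan (j : ℕ) : ℝ := Real.exp (p z j) * link g z (j - 1) / link g z j

/-- The factor f_j² - 1 equals g² e^{q_j - q_{j+1}} inside the chain and 0 at its ends, so the
boundary convention for a_N is included. -/
theorem aOf_eq (j : ℕ) : aOf g z j = (link g z j ^ 2 - 1) * bCan g z j := by
  unfold aOf
  split_ifs with h
  · rw [link_sq g z h, bCan, Real.exp_add]; ring
  · simp [link, h]

theorem qdot_sub_aOf (k : Fin N) : qdot g z (k + 1) - aOf g z (k + 1) = bCan g z (k + 1) := by
  have hk := k.2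
  have hp := link_pos g z (k + 1)
  rw [qdot, dif_pos ⟨by omega, by omega⟩, aOf_eq, bCan]
  simp only [Nat.add_sub_cancel, Fin.eta]
  rw [fderiv_canHam]
  field_simp
  ring

theorem changeVar_inl (i : Fin (N - 1)) :
    changeVar N g z (Sum.inl i) = (link g z (i + 1) ^ 2 - 1) * bCan g z (i + 1) := by
  simp [changeVar, mkVec, aOf_eq]

theorem changeVar_inr (i : Fin N) : changeVar N g z (Sum.inr i) = bCan g z (i + 1) := by
  rw [← qdot_sub_aOf]; rfl

theorem a_changeVar (j : ℕ) : a (changeVar N g z) j = (link g z j ^ 2 - 1) * bCan g z j := by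
  unfold a
  split_ifs with h
  · rw [changeVar_inl, Nat.sub_add_cancel h.1]
  · simp [link, h]

theorem b_changeVar {j : ℕ} (h : 1 ≤ j ∧ j ≤ N) : b (changeVar N g z) j = bCan g z j := by
  rw [b, dif_pos h, changeVar_inr, Nat.sub_add_cancel h.1]

/-- Termwise: a_j + b_j = f_j² b_j = e^{p_j} f_{j-1} f_j. -/
theorem canHam_eq : canHam N g z = Ham N 1 (changeVar N g z) := by
  rw [← fn_HamP, HamP_one, canHam, ← Finset.Ico_add_one_right_eq_Icc,
    Finset.sum_Ico_eq_sum_range, Nat.add_sub_cancel]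
  simp only [fn, map_sum, map_add]
  refine Finset.sum_congr rfl fun j hj => ?_
  have hj := Finset.mem_range.1 hj
  have h1 := fn_pa (j + 1) (changeVar N g z)
  have h2 := fn_pb (j + 1) (changeVar N g z)
  rw [fn] at h1 h2
  have hp := link_pos g z (j + 1)
  rw [h1, h2, a_changeVar, b_changeVar g z ⟨by omega, by omega⟩, bCan, add_comm 1 j]
  field_simp
  ring

/-- The logarithmic differential of `b_j` in canonical variables. -/
def bForm (j : ℕ) : (CanIdx N → ℝ) →L[ℝ] ℝ :=
  pL N j + linkRate g z (j - 1) • (qL N (j - 1) - qL N (j - 1 + 1))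
    - linkRate g z j • (qL N j - qL N (j + 1))

theorem hasFDerivAt_bCan (j : ℕ) :
    HasFDerivAt (fun z => bCan g z j) (bCan g z j • bForm g z j) z := by
  have hp := (link_pos g z j).ne'
  have h := ((hasFDerivAt_p j z).exp.mul (hasFDerivAt_link g z (j - 1))).mul
    ((hasDerivAt_inv hp).comp_hasFDerivAt z (hasFDerivAt_link g z j))
  refine h.congr_fderiv ?_
  ext v
  simp only [bCan, bForm, add_apply, sub_apply, smul_apply, smul_eq_mul, Pi.mul_apply,
    Function.comp_apply]
  field_simp
  ring

/-- The logarithmic differential of f_j² - 1 is dq_j - dq_{j+1}. The multiplicative form remains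
valid when a_j = 0, in particular for g = 0. -/
theorem hasFDerivAt_aCan (j : ℕ) :
    HasFDerivAt (fun z => (link g z j ^ 2 - 1) * bCan g z j)
      (((link g z j ^ 2 - 1) * bCan g z j) • (bForm g z j + (qL N j - qL N (j + 1)))) z := by
  have h := (((hasFDerivAt_link g z j).pow 2).sub_const 1).mul (hasFDerivAt_bCan g z j)
  refine h.congr_fderiv ?_
  have hp := (link_pos g z j).ne'
  ext v
  simp only [linkRate, add_apply, sub_apply, smul_apply, smul_eq_mul]
  field_simp
  ring

theorem bracket_piSymp (f h : (CanIdx N → ℝ) → ℝ) : bracket (piSymp N) f h z =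
    ∑ k : Fin N, (pd (Sum.inr k) f z * pd (Sum.inl k) h z
      - pd (Sum.inl k) f z * pd (Sum.inr k) h z) := by
  rw [bracket, Fintype.sum_sum_type]
  simp [piSymp, Fintype.sum_sum_type]
  ring

/-- Log-linear functions whose `p`-part is a coordinate. -/
theorem bracket_piSymp_of_hasFDerivAt {f h : (CanIdx N → ℝ) → ℝ} {i j : Fin N}
    {F G : (CanIdx N → ℝ) →L[ℝ] ℝ} (hf : HasFDerivAt f (f z • F) z)
    (hh : HasFDerivAt h (h z • G) z)
    (hF : ∀ k, F (Pi.single (Sum.inr k) 1) = if k = i then 1 else 0)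
    (hG : ∀ k, G (Pi.single (Sum.inr k) 1) = if k = j then 1 else 0) :
    bracket (piSymp N) f h z = f z * h z * (G (Pi.single (Sum.inl i) 1)
      - F (Pi.single (Sum.inl j) 1)) := by
  rw [bracket_piSymp]
  simp only [pd, hf.fderiv, hh.fderiv, smul_apply, smul_eq_mul, hF, hG]
  simp [Finset.sum_sub_distrib]
  ring

theorem bForm_single_inr (i k : Fin N) :
    bForm g z (i + 1) (Pi.single (Sum.inr k) 1) = if k = i then 1 else 0 := by
  simp [bForm, qL_apply, pL_apply, q_single_inr, p_single_inr, Fin.ext_iff, eq_comm]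

theorem bForm_single_inl (i j : Fin N) : bForm g z (i + 1) (Pi.single (Sum.inl j) 1)
    = (if i.val = j + 1 then linkRate g z i else 0)
      + (if j.val = i + 1 then linkRate g z j else 0)
      - (if i = j then linkRate g z i + linkRate g z (i + 1) else 0) := by
  simp only [bForm, add_apply, sub_apply, smul_apply, smul_eq_mul, qL_apply, pL_apply,
    q_single_inl, p_single_inl, Nat.add_sub_cancel, Fin.ext_iff]
  generalize i.val = m
  generalize j.val = n
  split_ifs <;> first | omega | (subst_vars; ring)

/-- The q-part of log b_j is the q_j-derivative of a function of q, so its Jacobian is symmetric.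
Hence the b_j commute, and all nonzero brackets come from the extra q_j - q_{j+1} in log a_j. -/
theorem bForm_single_inl_comm (i j : Fin N) :
    bForm g z (i + 1) (Pi.single (Sum.inl j) 1) = bForm g z (j + 1) (Pi.single (Sum.inl i) 1) := by
  simp only [bForm_single_inl, Fin.ext_iff]
  generalize i.val = m
  generalize j.val = n
  split_ifs <;> first | omega | (subst_vars; ring)

theorem apply_inl (x : Phase N) (i : Fin (N - 1)) : x (Sum.inl i) = a x (i + 1) := by
  rw [a, dif_pos ⟨by omega, by omega⟩]; rfl

theorem apply_inr (x : Phase N) (i : Fin N) : x (Sum.inr i) = b x (i + 1) := by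
  rw [b, dif_pos ⟨by omega, by omega⟩]; rfl

theorem hasFDerivAt_changeVar_inl (i : Fin (N - 1)) :
    HasFDerivAt (fun z => changeVar N g z (Sum.inl i)) (changeVar N g z (Sum.inl i) •
      (bForm g z (i + 1) + (qL N (i + 1) - qL N (i + 1 + 1)))) z := by
  simpa only [← changeVar_inl] using hasFDerivAt_aCan g z (i + 1)

theorem hasFDerivAt_changeVar_inr (i : Fin N) :
    HasFDerivAt (fun z => changeVar N g z (Sum.inr i)) (changeVar N g z (Sum.inr i) •
      bForm g z (i + 1)) z := by
  simpa only [← changeVar_inr] using hasFDerivAt_bCan g z (i + 1)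

theorem differentiableAt_changeVar (k : Idx N) :
    DifferentiableAt ℝ (fun z => changeVar N g z k) z := by
  rcases k with i | i
  · exact (hasFDerivAt_changeVar_inl g z i).differentiableAt
  · exact (hasFDerivAt_changeVar_inr g z i).differentiableAt

theorem bracket_changeVar (k l : Idx N) :
    bracket (piSymp N) (fun z => changeVar N g z k) (fun z => changeVar N g z l) z
      = pi2 N (changeVar N g z) k l := by
  have hr : ∀ i : Fin (N - 1), i.val < N := fun i => by omega
  have haF : ∀ (i : Fin (N - 1)) k, (bForm g z (i + 1) + (qL N (i + 1) - qL N (i + 1 + 1)))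
      (Pi.single (Sum.inr k) 1) = if k = ⟨i, hr i⟩ then 1 else 0 := fun i k => by
    rw [add_apply, bForm_single_inr g z ⟨i, hr i⟩ k]
    simp [qL_apply, q_single_inr]
  rcases k with i | i <;> rcases l with j | j
  · rw [bracket_piSymp_of_hasFDerivAt z (hasFDerivAt_changeVar_inl g z i)
      (hasFDerivAt_changeVar_inl g z j) (haF i) (haF j), add_apply, add_apply,
      bForm_single_inl_comm g z ⟨i, hr i⟩ ⟨j, hr j⟩]
    generalize bForm g z (j + 1) (Pi.single (Sum.inl (⟨i, hr i⟩ : Fin N)) 1) = w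
    simp only [sub_apply, qL_apply, q_single_inl, pi2, ofTable, apply_inl (changeVar N g z),
      Matrix.sub_apply, Nat.add_right_cancel_iff, Matrix.transpose_apply, Matrix.of_apply]
    generalize i.val = m
    generalize j.val = n
    split_ifs <;> first | omega | (subst_vars; ring)
  · rw [bracket_piSymp_of_hasFDerivAt z (hasFDerivAt_changeVar_inl g z i)
      (hasFDerivAt_changeVar_inr g z j) (haF i) (bForm_single_inr g z j), add_apply,
      bForm_single_inl_comm g z ⟨i, hr i⟩ j]
    generalize bForm g z (j + 1) (Pi.single (Sum.inl (⟨i, hr i⟩ : Fin N)) 1) = w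
    simp only [sub_apply, qL_apply, q_single_inl, pi2, ofTable, apply_inl (changeVar N g z),
      apply_inr (changeVar N g z), Matrix.sub_apply, Nat.add_right_cancel_iff, Matrix.transpose_apply, Matrix.of_apply]
    generalize i.val = m
    generalize j.val = n
    split_ifs <;> first | omega | (subst_vars; ring)
  · rw [bracket_piSymp_of_hasFDerivAt z (hasFDerivAt_changeVar_inr g z i)
      (hasFDerivAt_changeVar_inl g z j) (bForm_single_inr g z i) (haF j), add_apply,
      bForm_single_inl_comm g z i ⟨j, hr j⟩]
    generalize bForm g z (j + 1) (Pi.single (Sum.inl i) 1) = w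
    simp only [sub_apply, qL_apply, q_single_inl, pi2, ofTable, apply_inl (changeVar N g z),
      apply_inr (changeVar N g z), Matrix.sub_apply, Nat.add_right_cancel_iff, Matrix.transpose_apply, Matrix.of_apply]
    generalize i.val = m
    generalize j.val = n
    split_ifs <;> first | omega | (subst_vars; ring)
  · rw [bracket_piSymp_of_hasFDerivAt z (hasFDerivAt_changeVar_inr g z i)
      (hasFDerivAt_changeVar_inr g z j) (bForm_single_inr g z i) (bForm_single_inr g z j),
      bForm_single_inl_comm g z i j]
    simp [pi2, ofTable]

/-- The bracket of pulled back functions, by the chain rule. -/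
theorem bracket_comp {ι κ : Type} [Fintype ι] [DecidableEq ι] [Fintype κ] [DecidableEq κ]
    (π : Tensor2 κ) {φ : (κ → ℝ) → ι → ℝ} {z : κ → ℝ}
    (hφ : ∀ i, DifferentiableAt ℝ (fun z => φ z i) z) {u v : (ι → ℝ) → ℝ}
    (hu : DifferentiableAt ℝ u (φ z)) (hv : DifferentiableAt ℝ v (φ z)) :
    bracket π (u ∘ φ) (v ∘ φ) z = ∑ i, ∑ j,
      bracket π (fun z => φ z i) (fun z => φ z j) z * (pd i u (φ z) * pd j v (φ z)) := by
  have hpd : ∀ {u : (ι → ℝ) → ℝ}, DifferentiableAt ℝ u (φ z) → ∀ k, pd k (u ∘ φ) z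
      = ∑ i, pd i u (φ z) * pd k (fun z => φ z i) z := by
    intro u hu k
    have hd : HasFDerivAt φ _ z := hasFDerivAt_pi.2 fun i => (hφ i).hasFDerivAt
    rw [pd, fderiv_comp z hu hd.differentiableAt, hd.fderiv, ContinuousLinearMap.comp_apply,
      pi_eq_sum_univ' ((ContinuousLinearMap.pi _) _), map_sum]
    refine Finset.sum_congr rfl fun i _ => ?_
    rw [map_smul, smul_eq_mul, mul_comm]
    rfl
  have hswap : ∀ f : ι → ι → κ → κ → ℝ, ∑ i, ∑ j, ∑ k, ∑ l, f i j k l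
      = ∑ k, ∑ l, ∑ i, ∑ j, f i j k l := by
    intro f
    rw [Finset.sum_congr rfl fun i _ => Finset.sum_comm, Finset.sum_comm]
    refine Finset.sum_congr rfl fun k _ => ?_
    rw [Finset.sum_congr rfl fun i _ => Finset.sum_comm, Finset.sum_comm]
  simp only [bracket, hpd hu, hpd hv, smul_eq_mul, Finset.sum_mul]
  rw [hswap]
  simp only [Finset.mul_sum]
  refine Finset.sum_congr rfl fun k _ => Finset.sum_congr rfl fun l _ =>
    Finset.sum_congr rfl fun i _ => Finset.sum_congr rfl fun j _ => ?_
  ring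

theorem bracket_piSymp_comp_changeVar {u v : Phase N → ℝ} (hu : ContDiff ℝ ∞ u)
    (hv : ContDiff ℝ ∞ v) : bracket (piSymp N) (u ∘ changeVar N g) (v ∘ changeVar N g) z
      = bracket (pi2 N) u v (changeVar N g z) := by
  rw [bracket_comp _ (differentiableAt_changeVar g z) (hu.differentiable (by simp) _)
    (hv.differentiable (by simp) _)]
  simp only [bracket_changeVar]
  rfl

end Canonical

end RelToda

end

/-! ### Assembly of the theorem -/

theorem mainTheorem3 (N : ℕ) (hN : 2 ≤ N) :
    -- the quadratic bracket is the transformed symplectic bracket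
    (∀ (g : ℝ) (u v : RelToda.Phase N → ℝ), ContDiff ℝ ∞ u → ContDiff ℝ ∞ v →
      ∀ z, RelToda.bracket (RelToda.piSymp N) (u ∘ RelToda.changeVar N g)
          (v ∘ RelToda.changeVar N g) z
        = RelToda.bracket (RelToda.pi2 N) u v (RelToda.changeVar N g z)) ∧
    (∀ (g : ℝ) (z : RelToda.CanIdx N → ℝ),
      RelToda.canHam N g z = RelToda.Ham N 1 (RelToda.changeVar N g z)) ∧
    -- the bi-Hamiltonian pair
    RelToda.Compatible (RelToda.pi1 N) (RelToda.pi2 N) ∧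
    RelToda.hamVF (RelToda.pi2 N) (RelToda.Ham N 1) = RelToda.todaVF N ∧
    RelToda.hamVF (RelToda.pi1 N) (RelToda.Ham N 2) = RelToda.todaVF N ∧
    RelToda.IsCasimirOn (RelToda.pi1 N) Set.univ (fun x => (RelToda.lax x).trace) ∧
    RelToda.IsCasimirOn (RelToda.pi2 N) Set.univ (fun x => (RelToda.lax x).det) ∧
    RelToda.HamsInvolution (RelToda.pi2 N) ∧
    RelToda.EigenvaluesInvolution (RelToda.pi2 N) ∧
    -- the first master symmetry and the cubic bracket
    (∀ m : ℕ, 1 ≤ m → ∀ x, RelToda.along (RelToda.X1 N) (RelToda.Ham N m) x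
      = ((m : ℝ) + 1) * RelToda.Ham N (m + 1) x) ∧
    RelToda.IsMasterSymmetry (RelToda.X1 N) (RelToda.todaVF N) ∧
    RelToda.lieDeriv (RelToda.X1 N) (RelToda.pi2 N) = - RelToda.pi3 N ∧
    RelToda.Compatible (RelToda.pi1 N) (RelToda.pi3 N) ∧
    RelToda.Compatible (RelToda.pi2 N) (RelToda.pi3 N) ∧
    RelToda.HamsInvolution (RelToda.pi3 N) ∧
    RelToda.EigenvaluesInvolution (RelToda.pi3 N) ∧
    RelToda.IsCasimirOn (RelToda.pi3 N) {x | (RelToda.lax x).det ≠ 0}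
      (fun x => ((RelToda.lax x)⁻¹).trace) ∧
    RelToda.lieDeriv (RelToda.X1 N) (RelToda.pi3 N) = 0 ∧
    -- the second master symmetry and the bracket it generates
    ∃ X2 : RelToda.VField (RelToda.Idx N),
      ContDiff ℝ ∞ X2 ∧
      (N = 3 → X2 = RelToda.X2three N) ∧
      (∀ m : ℕ, 1 ≤ m → ∀ x, RelToda.along X2 (RelToda.Ham N m) x
        = ((m : ℝ) + 2) * RelToda.Ham N (m + 2) x) ∧
      RelToda.IsMasterSymmetry X2 (RelToda.todaVF N) ∧
      RelToda.IsPoisson (RelToda.lieDeriv X2 (RelToda.pi2 N)) ∧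
      RelToda.HamsInvolution (RelToda.lieDeriv X2 (RelToda.pi2 N)) ∧
      RelToda.EigenvaluesInvolution (RelToda.lieDeriv X2 (RelToda.pi2 N)) ∧
      RelToda.IsTrivialBracket
        (RelToda.lieDeriv X2 (RelToda.lieDeriv X2 (RelToda.pi2 N))) := by
  refine ⟨fun g u v hu hv z => RelToda.bracket_piSymp_comp_changeVar g z hu hv,
    RelToda.canHam_eq, RelToda.compatible_pi1_pi2, RelToda.hamVF_pi2_Ham_one,
    RelToda.hamVF_pi1_Ham_two, RelToda.isCasimirOn_pi1_trace, RelToda.isCasimirOn_pi2_det,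
    RelToda.hamsInvolution_pi2, RelToda.eigenvaluesInvolution_pi2,
    fun m hm x => RelToda.along_X1_Ham hm x, RelToda.isMasterSymmetry_X1 hN,
    RelToda.lieDeriv_X1_pi2, RelToda.compatible_pi1_pi3, RelToda.compatible_pi2_pi3,
    RelToda.hamsInvolution_pi3, RelToda.eigenvaluesInvolution_pi3,
    RelToda.isCasimirOn_pi3_trace_inv hN, RelToda.lieDeriv_X1_pi3,
    RelToda.vfOf (RelToda.Z2 N), ?_⟩
  obtain ⟨h1, h2⟩ := RelToda.isSecondMaster_Z2.conclusion hN
  refine ⟨h1, ?_, h2⟩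
  rintro rfl
  exact RelToda.vfOf_Z2_three
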